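/- **Theorem 4.1.** *Model.* Let $\mathcal S$ be a finite set of links with capacities $C_i>0$. Documents arrive on the route $ij$ (an unordered pair of distinct links) as a Poisson process of rate $\lambda_{ij}\ge 0$ and have exponential sizes with parameter $\mu_{ij}>0$. Let $\mathcal R$ be the set of active routes, those with $\lambda_{ij}>0$. For $x\in\mathbb R_+^{\mathcal R}$ put $x_i=\sum_j x_{ij}$ and $$\mu_{ij}(x)=\mu_{ij}\,x_{ij}\Big(\frac{C_i}{x_i}\wedge\frac{C_j}{x_j}\Big)\quad\text{if }x_{ij}>0,\qquad \mu_{ij}(x)=0\quad\text{if }x_{ij}=0 .$$ Let $Q(t,y)$ be the Markov jump process on $\mathbb Z_+^{\mathcal R}$ started at $y$ which jumps from $z$ to $z+e_{ij}$ at rate $\lambda_{ij}$ and to $z-e_{ij}$ at rate $\mu_{ij}(z)$, and let $A_{ij}(t)$ be the number of arrivals on route $ij$ up to time $t$. Assume that $Q$ is ergodic (positive recurrent). *Faces and generators.* For $\Lambda\subset\mathcal R$ let $\Lambda_1$ be the set of routes of $\mathcal R\setminus\Lambda$ that share a link with some route of $\Lambda$. The face $\Lambda$ is also the set of $x\in\mathbb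 R_+^{\mathcal R}$ with $x_{ij}>0$ exactly for $ij\in\Lambda$; write $\Lambda(x)=\{ij\in\mathcal R:x_{ij}>0\}$. Let $\Gamma^\Lambda$ be the set of pairs $(A,D)$, $A=(a_{ij})_{ij\in\Lambda\cup\Lambda_1}$, $D\in\mathbb R^{\mathcal R}$, with $a_{ij}\ge0$ and $a_{ij}-D_{ij}\ge 0$ for all $ij\in\Lambda\cup\Lambda_1$, equipped with the distance $$d\big((A,D),(A',D')\big)=\sum_{ij\in\Lambda\cup\Lambda_1}|a_{ij}-a'_{ij}|+\sum_{ij\in\mathcal R}|D_{ij}-D'_{ij}|.$$ Let $\mathcal G^\Lambda$ be the set of $(A,D)\in\Gamma^\Lambda$ with $D_{ij}=0$ for $ij\notin\Lambda$, $a_{ij}=0$ for $ij\in\Lambda_1$, and $a_{ij}>0$, $a_{ij}-D_{ij}>0$ for $ij\in\Lambda$, and let $\overline{\mathcal G}^\Lambda$ be its closure. The localized empirical generator is $G^\Lambda_t=\big(\tfrac1t(A_{ij}(t))_{ij\in\Lambda\cup\Lambda_1},\tfrac1t(Q_t-Q_0)\big)$. For $G=(A,D)\in\overline{\mathcal G}^{\Lambda(x)}$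 put $$E^{(n)}_{\tau,\delta,y}(x,G)=\Big\{G^{\Lambda(x)}_{n\tau}\in B(G,\delta),\ \sup_{t\in[0,n\tau]}|Q(t,y)-nx-Dt|<\delta n\Big\},$$ where $B(G,\delta)$ is the open ball in $(\Gamma^{\Lambda(x)},d)$ and the empirical generator is that of $Q(\cdot,y)$, and $$H(G\|R(x))=\sum_{ij\in\Lambda(x)\cup\Lambda_1(x)}\Big(I_p(a_{ij}\|\lambda_{ij})+I_p(a_{ij}-D_{ij}\|\mu_{ij}(x))\Big),\qquad I_p(\nu\|\lambda)=\nu\log\frac{\nu}{\lambda}-\nu+\lambda,$$ with the conventions $0/0=0$ and $0\log 0=0$; $\Lambda_1(x)$ is $\Lambda_1$ for $\Lambda=\Lambda(x)$. Write $\lim_{\tau,\delta,\epsilon\to0}$ for $\lim_{\tau\to0}\lim_{\delta\to0}\lim_{\epsilon\to0}$ (limits in $[-\infty,\infty]$ along positive parameters, with $\log 0=-\infty$). *Claim.* For every $x\in\mathbb R_+^{\mathcal R}$ and every $G=(A,D)\in\overline{\mathcal G}^{\Lambda(x)}$, the following iterated limits exist and $$\begin{aligned}-H(G\|R(x))&=\lim_{\tau,\delta,\epsilon\to0}\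 \liminf_{n\to\infty}\ \inf_{y\in\mathbb Z_+^{\mathcal R},\,|y-nx|<\epsilon n}\frac1{n\tau}\log\mathbb P\big[E^{(n)}_{\tau,\delta,y}(x,G)\big]\\&=\lim_{\tau,\delta,\epsilon\to0}\ \limsup_{n\to\infty}\ \sup_{y\in\mathbb Z_+^{\mathcal R},\,|y-nx|<\epsilon n}\frac1{n\tau}\log\mathbb P\big[E^{(n)}_{\tau,\delta,y}(x,G)\big].\end{aligned}$$ Moreover, for a fixed face $\Lambda$ and a fixed $G=(A,D)\in\overline{\mathcal G}^{\Lambda}$, the limits as $\tau\to0$ (of the inner limits in $\epsilon$, then $\delta$) are uniform with respect to $x$ in compact subsets of the face $\Lambda$. -/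

import Mathlib

open MeasureTheory ProbabilityTheory Filter Topology
open scoped ENNReal

/-- A star network with set of links `S`. A route is an unordered pair of distinct links.
`lam r` is the intensity of the Poisson arrivals on route `r`, `mu r` the parameter of the
exponential document sizes on route `r`, and `cap i` the capacity of link `i`. -/
structure StarNetwork (S : Type*) where
  lam : Sym2 S → ℝ
  mu : Sym2 S → ℝ
  cap : S → ℝ
  lam_nonneg : ∀ r, 0 ≤ lam r
  mu_pos : ∀ r, 0 < mu r
  cap_pos : ∀ i, 0 < cap i

namespace StarNetwork

/-- The set of active routes: unordered pairs of distinct links with positive arrival rate. -/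
def Route {S : Type*} (W : StarNetwork S) : Type _ :=
  {r : Sym2 S // ¬ r.IsDiag ∧ 0 < W.lam r}

noncomputable section

variable {S : Type*} [Fintype S] (W : StarNetwork S)

instance : Fintype W.Route :=
  @Fintype.ofFinite {r : Sym2 S // ¬ r.IsDiag ∧ 0 < W.lam r} inferInstance

instance : DecidableEq W.Route := Classical.decEq _

/-! ### The Markov process of the network -/

open Classical in
/-- `x_i`, the total amount on the routes that use link `i`. -/
def load (x : W.Route → ℝ) (i : S) : ℝ := ∑ r : W.Route, if i ∈ r.1 then x r else 0

/-- The service rate `μ_ij(x) = μ_ij x_ij (C_i / x_i ∧ C_j / x_j)` of the min policy. It vanishes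
when `x_ij = 0`; when `x_ij > 0`, both `x_i` and `x_j` are positive. -/
def serviceRate (x : W.Route → ℝ) (r : W.Route) : ℝ :=
  W.mu r.1 * (x r * Sym2.lift
    ⟨fun i j => min (W.cap i / W.load x i) (W.cap j / W.load x j), fun _ _ => min_comm _ _⟩ r.1)

/-- The states of the queueing process: numbers of connections on each route. -/
abbrev State : Type _ := W.Route → ℕ

/-- A state, seen as a point of `ℝ^R`. -/
def toReal (y : W.State) : W.Route → ℝ := fun r => (y r : ℝ)

/-- Transition rates: `inl r` is an arrival on route `r`, `inr r` a departure from route `r`. -/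
def rate (y : W.State) : W.Route ⊕ W.Route → ℝ
  | .inl r => W.lam r.1
  | .inr r => W.serviceRate (W.toReal y) r

/-- The state after a transition. (A departure from an empty route has rate zero.) -/
def target (y : W.State) : W.Route ⊕ W.Route → W.State
  | .inl r => y + Pi.single r 1
  | .inr r => y - Pi.single r 1

/-- The jump rates `q(y, z)`: equal to `λ_r` if `z - y = e_r`, to `μ_r(y)` if `z - y = -e_r`,
and to `0` otherwise. -/
def q (y z : W.State) : ℝ := ∑ c, if W.target y c = z then W.rate y c else 0

/-- The total jump rate out of the state `y`. -/
def totalRate (y : W.State) : ℝ := ∑ c, W.rate y c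

/-- Ergodicity (positive recurrence). The process is irreducible with bounded jump rates, so this
is the existence of an invariant probability distribution `π`, i.e. of a solution of the balance
equations `∑ y, π y * q(y, z) = π z * ∑ y, q(z, y)`. -/
def Ergodic : Prop :=
  ∃ π : PMF W.State, ∀ z : W.State,
    ∑' y, π y * ENNReal.ofReal (W.q y z) = π z * ENNReal.ofReal (W.totalRate z)

lemma load_nonneg {x : W.Route → ℝ} (hx : ∀ r, 0 ≤ x r) (i : S) : 0 ≤ W.load x i :=
  Finset.sum_nonneg fun r _ => by split_ifs <;> simp [hx r]

lemma serviceRate_nonneg {x : W.Route → ℝ} (hx : ∀ r, 0 ≤ x r) (r : W.Route) :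
    0 ≤ W.serviceRate x r := by
  refine mul_nonneg (W.mu_pos _).le (mul_nonneg (hx r) ?_)
  induction r.1 using Sym2.ind with
  | _ i j =>
    exact le_min (div_nonneg (W.cap_pos i).le (W.load_nonneg hx i))
      (div_nonneg (W.cap_pos j).le (W.load_nonneg hx j))

lemma rate_nonneg (y : W.State) (c : W.Route ⊕ W.Route) : 0 ≤ W.rate y c := by
  cases c with
  | inl r => exact W.lam_nonneg _
  | inr r => exact W.serviceRate_nonneg (fun _ => Nat.cast_nonneg _) r

lemma totalRate_nonneg (y : W.State) : 0 ≤ W.totalRate y :=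
  Finset.sum_nonneg fun c _ => W.rate_nonneg y c

open Classical in
/-- The law of the state entered at the first jump from `y`: it is `z` with probability
`q(y, z) / q(y)`. (If there is no active route at all, the only state is absorbing; it is given
dummy jumps to itself, here and in `holding`.) -/
def jump (y : W.State) : Measure W.State :=
  if W.totalRate y = 0 then Measure.dirac y
  else ∑ c, ENNReal.ofReal (W.rate y c / W.totalRate y) • Measure.dirac (W.target y c)

open Classical in
/-- The law of the holding time in `y`: exponential with parameter the total jump rate. -/
def holding (y : W.State) : Measure ℝ :=
  expMeasure (if W.totalRate y = 0 then 1 else W.totalRate y)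

instance (y : W.State) : IsProbabilityMeasure (W.jump y) := by
  unfold jump
  split_ifs with h
  · infer_instance
  · constructor
    simp only [Measure.coe_finsetSum, Finset.sum_apply, Measure.smul_apply, measure_univ,
      smul_eq_mul, mul_one]
    rw [← ENNReal.ofReal_sum_of_nonneg
      (fun c _ => div_nonneg (W.rate_nonneg y c) (W.totalRate_nonneg y)), ← Finset.sum_div]
    change ENNReal.ofReal (W.totalRate y / W.totalRate y) = 1
    rw [div_self h, ENNReal.ofReal_one]

instance (y : W.State) : IsProbabilityMeasure (W.holding y) := by
  unfold holding
  split_ifs with h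
  · exact isProbabilityMeasure_expMeasure one_pos
  · exact isProbabilityMeasure_expMeasure (lt_of_le_of_ne (W.totalRate_nonneg y) (Ne.symm h))

/-- From the state `y`: an exponential holding time and, independently, the next state. -/
def step : Kernel W.State (ℝ × W.State) where
  toFun y := (W.holding y).prod (W.jump y)
  measurable' := Measurable.of_discrete

instance : IsMarkovKernel W.step :=
  ⟨fun y => inferInstanceAs (IsProbabilityMeasure ((W.holding y).prod (W.jump y)))⟩

/-- A trajectory `ω` of the process, recorded jump by jump: `(ω k).2` is the state after the `k`-th
jump and `(ω (k + 1)).1` is the holding time in that state. -/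
abbrev Traj : Type _ := ℕ → ℝ × W.State

/-- The conditional law of the `(n + 1)`-st record given the past: it only depends on the
current state. -/
def pathStep (n : ℕ) : Kernel ((_ : Finset.Iic n) → ℝ × W.State) (ℝ × W.State) :=
  W.step.comap (fun h => (h ⟨n, Finset.mem_Iic.2 le_rfl⟩).2)
    (measurable_snd.comp (measurable_pi_apply _))

instance (n : ℕ) : IsMarkovKernel (W.pathStep n) := by
  unfold pathStep; infer_instance

/-- The law of the Markov jump process with jump rates `q`, started in `y`: the law of its
embedded chain together with its holding times. -/
def law (y : W.State) : Measure W.Traj :=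
  Kernel.traj (X := fun _ => ℝ × W.State) W.pathStep 0 (fun _ => (0, y))

variable {W} in
/-- The time of the `k`-th jump. -/
def jumpTime (k : ℕ) (ω : W.Traj) : ℝ := ∑ i ∈ Finset.range k, (ω (i + 1)).1

variable {W} in
/-- `N_t`, the number of jumps in `[0, t]` (almost surely finite, as the jump rates are
bounded). -/
def numJumps (t : ℝ) (ω : W.Traj) : ℕ := Set.ncard {k : ℕ | jumpTime (k + 1) ω ≤ t}

variable {W} in
/-- `Q(t)`, the state of the network at time `t`. -/
def queue (t : ℝ) (ω : W.Traj) : W.State := (ω (numJumps t ω)).2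

variable {W} in
/-- `A_r(t)`, the number of arrivals on route `r` till `t`. -/
def arrivals (t : ℝ) (ω : W.Traj) (r : W.Route) : ℕ :=
  ((Finset.range (numJumps t ω)).filter
    fun k => (ω (k + 1)).2 = (ω k).2 + Pi.single r 1).card

/-! ### Faces and localized empirical generators -/

variable {W} in
/-- The face `Λ(x)`, as a set of routes. -/
def face (x : W.Route → ℝ) : Set W.Route := {r | 0 < x r}

variable {W} in
/-- The face `Λ`, as a set of points: `y_r > 0` on `Λ` and `y_r = 0` off `Λ`. -/
def facePoints (Λ : Set W.Route) : Set (W.Route → ℝ) :=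
  {y | (∀ r ∈ Λ, 0 < y r) ∧ ∀ r ∉ Λ, y r = 0}

variable {W} in
/-- `Λ₁`: the routes outside `Λ` that share a link with some route of `Λ`. -/
def jammed (Λ : Set W.Route) : Set W.Route :=
  {r | r ∉ Λ ∧ ∃ i ∈ r.1, ∃ s ∈ Λ, i ∈ s.1}

variable {W} in
/-- Pairs `(A, D)` with `A` indexed by `Λ ∪ Λ₁` and `D` indexed by all active routes. -/
abbrev GenPair (Λ : Set W.Route) : Type _ := (↥(Λ ∪ jammed Λ) → ℝ) × (W.Route → ℝ)

instance (Λ : Set W.Route) : Fintype ↥(Λ ∪ jammed Λ) := Fintype.ofFinite _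

variable {W} in
/-- `Γ^Λ`, the set of localized empirical generators on the face `Λ`. -/
def Gam (Λ : Set W.Route) : Set (GenPair Λ) :=
  {G | (∀ r, 0 ≤ G.1 r) ∧ ∀ r, 0 ≤ G.1 r - G.2 r.1}

variable {W} in
/-- The distance `d` between localized empirical generators. It induces the product topology. -/
def genDist {Λ : Set W.Route} (G G' : GenPair Λ) : ℝ :=
  ∑ r, |G.1 r - G'.1 r| + ∑ r, |G.2 r - G'.2 r|

variable {W} in
/-- The ball `B(G, δ)` of the metric space `(Γ^Λ, d)`. -/
def genBall {Λ : Set W.Route} (G : GenPair Λ) (δ : ℝ) : Set (GenPair Λ) :=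
  {G' | G' ∈ Gam Λ ∧ genDist G' G < δ}

variable {W} in
/-- `𝒢^Λ`: the elements `(A, D)` of `Γ^Λ` such that `D` vanishes off `Λ`, `A` vanishes on `Λ₁`,
and `a_r > 0`, `a_r - D_r > 0` on `Λ`. -/
def calG (Λ : Set W.Route) : Set (GenPair Λ) :=
  {G | G ∈ Gam Λ ∧ (∀ r ∉ Λ, G.2 r = 0) ∧ (∀ r, r.1 ∈ jammed Λ → G.1 r = 0) ∧
    ∀ r, r.1 ∈ Λ → 0 < G.1 r ∧ 0 < G.1 r - G.2 r.1}

variable {W} in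
/-- The localized empirical generator `G_t^Λ = (A^Λ(t) / t, (Q_t - Q_0) / t)`. -/
def empGen (Λ : Set W.Route) (t : ℝ) (ω : W.Traj) : GenPair Λ :=
  (fun r => (arrivals t ω r.1 : ℝ) / t,
    fun r => ((queue t ω r : ℝ) - (queue 0 ω r : ℝ)) / t)

variable {W} in
/-- The event `E_{τ,δ}^{(n)}(x, G)`: the empirical generator at time `nτ` belongs to `B(G, δ)`, and
`sup_{t ∈ [0, nτ]} |Q(t) - n x - D t| < δ n`. The norm on `ℝ^R` is the maximum norm. -/
def event (Λ : Set W.Route) (x : W.Route → ℝ) (G : GenPair Λ) (τ δ : ℝ) (n : ℕ) : Set W.Traj :=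
  {ω | empGen Λ (n * τ) ω ∈ genBall G δ ∧
    ⨆ t ∈ Set.Icc (0 : ℝ) (n * τ), ‖W.toReal (queue t ω) - (n : ℝ) • x - t • G.2‖ₑ
      < ENNReal.ofReal (δ * n)}

/-- `(1 / (nτ)) log P[E_{τ,δ,y}^{(n)}(x, G)]`, with `log 0 = -∞`. -/
def logProb (Λ : Set W.Route) (x : W.Route → ℝ) (G : GenPair Λ) (τ δ : ℝ) (n : ℕ)
    (y : W.State) : EReal :=
  ((1 / (n * τ) : ℝ) : EReal) * ENNReal.log (W.law y (event Λ x G τ δ n))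

/-- `liminf_n inf_{|y - nx| < εn} (1 / (nτ)) log P[E_{τ,δ,y}^{(n)}(x, G)]`. -/
def lowerRate (Λ : Set W.Route) (x : W.Route → ℝ) (G : GenPair Λ) (τ δ ε : ℝ) : EReal :=
  liminf (fun n : ℕ => ⨅ y : W.State, ⨅ _ : ‖W.toReal y - (n : ℝ) • x‖ < ε * n,
    W.logProb Λ x G τ δ n y) atTop

/-- `limsup_n sup_{|y - nx| < εn} (1 / (nτ)) log P[E_{τ,δ,y}^{(n)}(x, G)]`. -/
def upperRate (Λ : Set W.Route) (x : W.Route → ℝ) (G : GenPair Λ) (τ δ ε : ℝ) : EReal :=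
  limsup (fun n : ℕ => ⨆ y : W.State, ⨆ _ : ‖W.toReal y - (n : ℝ) • x‖ < ε * n,
    W.logProb Λ x G τ δ n y) atTop

/-- The relative entropy `I_p(ν ‖ λ) = ν log (ν / λ) - ν + λ` of Poisson processes. The conventions
`0 / 0 = 0` and `0 log 0 = 0` hold for the real operations used here. (The remaining case
`ν > 0 = λ` does not occur in `entropy` for generators in the closure of `𝒢^Λ`.) -/
def poissonEntropy (ν l : ℝ) : ℝ := ν * Real.log (ν / l) - ν + l

/-- The relative entropy `H(G ‖ R(x))` of a localized generator `G = (A, D)`, whose arrival and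
service rates on `Λ ∪ Λ₁` are `a_r` and `a_r - D_r`. -/
def entropy (Λ : Set W.Route) (G : GenPair Λ) (x : W.Route → ℝ) : ℝ :=
  ∑ r : ↥(Λ ∪ jammed Λ), (poissonEntropy (G.1 r) (W.lam r.1.1) +
    poissonEntropy (G.1 r - G.2 r.1) (W.serviceRate x r.1))

/-- `lim_{δ → 0} lim_{ε → 0} F δ ε` exists and equals `c`. -/
def HasInnerLimit (F : ℝ → ℝ → EReal) (c : EReal) : Prop :=
  ∃ g : ℝ → EReal, (∀ δ > 0, Tendsto (F δ) (𝓝[>] 0) (𝓝 (g δ))) ∧ Tendsto g (𝓝[>] 0) (𝓝 c)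

end

end StarNetwork

namespace StarNetwork

noncomputable section

set_option linter.unusedSectionVars false

variable {S : Type*} [Fintype S] (W : StarNetwork S)

/-! ### The Markov property of the recorded trajectories -/

/-! Multiplying the rate of every transition by a weight gives a new jump process, whose likelihood
ratio on `[0, T]` is the product of the weights of the jumps made, times the exponential of minus
the time integral of the change of total rate. Read after `K` jumps, this ratio is `density`, and it
has mean one (`lintegral_density`). All the probability below goes through such densities under the
original law; no second process is built.

Service rates are homogeneous of degree zero, so near `n x` and for times up to `n τ` with `τ`
small, the arrivals on `Λ ∪ Λ₁` and the departures on `Λ` have rates nearly equal to constants `R`,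
while the generator prescribes their frequencies `α`. Departures on `Λ₁` have zero frequency and
zero limiting rate, and do not enter the entropy.

Upper bound: give these transitions weights close to `α / R`. On the event their counts are close to
`n τ α`, so the density is at least `exp (n τ (H - η))` whatever the other routes do, and Markov's
inequality concludes (`law_le_of_le_density`).

Lower bound: inside a tube around `n x`, give these transitions exactly the rates `α`. It must be
shown that at least half of the tilted mass lies on paths of the event whose density is at most `exp
(n τ (H + 2η/3))` (`le_law_of_density_le`). Doob's maximal inequality for further tilts by `exp
(±θ)` keeps the counts near their means, which keeps the path in the tube (`Valid.mem_tube`). The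
routes away from `Λ ∪ Λ₁` must stay small compared with `n` at no cost, and this is where ergodicity
enters: it forces the traffic `∑ ρ_r` through each link to be below its capacity. As `Λ₁` is nearly
empty in the tube, the free route with the largest `z_r / ρ_r` is served faster than it is fed, so a
smooth maximum of these ratios has an exponentially small drift (`exists_lyap_drift_le`), and the
maximal inequality for its Doob transform bounds it along the whole path.

The limits in `ε` and `δ` exist by monotonicity in `EReal`. The threshold on `τ` in both bounds
depends on `x` only through a lower bound of its coordinates on `Λ`, whence the uniformity on
compact sets. -/

instance (y : W.State) : IsProbabilityMeasure (W.law y) := by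
  unfold law; infer_instance

/-- The Markov property in the form used throughout: the last relevant record may be redrawn from
the one-step kernel at the current state. -/
lemma lintegral_law_succ (y : W.State) (k : ℕ) {F : W.Traj → ℝ≥0∞} (hF : Measurable F)
    (hd : DependsOn F (Set.Iic (k + 1))) :
    ∫⁻ ω, F ω ∂W.law y =
      ∫⁻ ω, ∫⁻ p, F (Function.update ω (k + 1) p) ∂W.step (ω k).2 ∂W.law y := by
  -- The values of `ext` beyond `k + 1` are immaterial, since `F` does not see them.
  let ext : ((_ : Finset.Iic k) → ℝ × W.State) × (ℝ × W.State) → W.Traj := fun q i =>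
    if h : i ≤ k then q.1 ⟨i, Finset.mem_Iic.2 h⟩ else q.2
  have hext : Measurable ext := by
    refine measurable_pi_lambda _ fun i => ?_
    by_cases h : i ≤ k
    · simp only [ext, h, dite_true]; fun_prop
    · simp only [ext, h, dite_false]; fun_prop
  have hg : Measurable fun q => F (ext q) := hF.comp hext
  have h1 : ∀ ω : W.Traj, F ω = F (ext (Preorder.frestrictLe k ω, ω (k + 1))) := by
    intro ω
    apply hd
    intro i hi
    by_cases h : i ≤ k
    · simp [ext, h]
    · have : i = k + 1 := le_antisymm hi (by omega)
      subst this
      simp [ext]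
  have h2 : ∀ (ω : W.Traj) p, F (Function.update ω (k + 1) p) =
      F (ext (Preorder.frestrictLe k ω, p)) := by
    intro ω p
    apply hd
    intro i hi
    by_cases h : i ≤ k
    · simp [ext, h, Function.update_of_ne (show i ≠ k + 1 by omega)]
    · have : i = k + 1 := le_antisymm hi (by omega)
      subst this
      simp [ext]
  have key := Kernel.partialTraj_compProd_eq_map_traj (X := fun _ => ℝ × W.State)
    (κ := W.pathStep) (Nat.zero_le k) (x₀ := fun _ => (0, y))
  have hm : Measurable fun ω : W.Traj => (Preorder.frestrictLe (π := fun _ => ℝ × W.State) k ω,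
      ω (k + 1)) := by fun_prop
  calc ∫⁻ ω, F ω ∂W.law y
      = ∫⁻ q, F (ext q) ∂((W.law y).map fun ω =>
        (Preorder.frestrictLe (π := fun _ => ℝ × W.State) k ω, ω (k + 1))) := by
        rw [lintegral_map hg hm]
        exact lintegral_congr h1
    _ = ∫⁻ h : (_ : Finset.Iic k) → ℝ × W.State, ∫⁻ p, F (ext (h, p)) ∂W.pathStep k h
          ∂(Kernel.partialTraj (X := fun _ => ℝ × W.State) W.pathStep 0 k (fun _ => (0, y))) := by
        rw [law, ← key, Measure.lintegral_compProd hg]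
    _ = _ := by
        rw [← Kernel.traj_map_frestrictLe_apply, lintegral_map hg.lintegral_kernel_prod_right'
          (Preorder.measurable_frestrictLe k)]
        refine lintegral_congr fun ω => ?_
        simp only [h2]
        rfl

lemma law_zero (y : W.State) : ∀ᵐ ω ∂W.law y, ω 0 = (0, y) := by
  have h := Kernel.traj_map_frestrictLe_apply (X := fun _ => ℝ × W.State) (κ := W.pathStep) 0 0
    (fun _ => (0, y))
  rw [Kernel.partialTraj_self, Kernel.id_apply] at h
  have hm : Measurable (Preorder.frestrictLe (π := fun _ : ℕ => ℝ × W.State) 0) := by fun_prop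
  have h2 : ∀ᵐ x ∂(Measure.map (Preorder.frestrictLe (π := fun _ : ℕ => ℝ × W.State) 0)
      ((Kernel.traj (X := fun _ => ℝ × W.State) W.pathStep 0) fun _ => (0, y))),
      (x : (_ : Finset.Iic 0) → ℝ × W.State) ⟨0, by simp⟩ = ((0, y) : ℝ × W.State) := by
    rw [h, ae_dirac_iff]
    exact measurableSet_eq_fun (by fun_prop) (by fun_prop)
  exact ae_of_ae_map hm.aemeasurable h2

/-- A property of the next record given the current one, valid almost surely for the transition
kernel, holds along the whole trajectory. -/
lemma ae_law_of_ae_step (y : W.State) {P : W.State → ℝ × W.State → Prop}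
    (hm : ∀ z, MeasurableSet {p | P z p}) (h : ∀ z, ∀ᵐ p ∂W.step z, P z p) :
    ∀ᵐ ω ∂W.law y, ∀ k, P (ω k).2 (ω (k + 1)) := by
  rw [ae_all_iff]
  intro k
  have hms : MeasurableSet {q : W.State × (ℝ × W.State) | ¬ P q.1 q.2} := by
    have : {q : W.State × (ℝ × W.State) | ¬ P q.1 q.2} = ⋃ z, {z} ×ˢ {p | P z p}ᶜ := by
      ext q; simp
    rw [this]
    exact .iUnion fun z => (measurableSet_singleton z).prod (hm z).compl
  have hm2 : MeasurableSet {ω : W.Traj | ¬ P (ω k).2 (ω (k + 1))} :=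
    hms.preimage (f := fun ω : W.Traj => ((ω k).2, ω (k + 1))) (by fun_prop)
  rw [ae_iff, ← lintegral_indicator_one hm2, lintegral_law_succ W y k]
  · refine (lintegral_congr fun ω => ?_).trans lintegral_zero
    refine (lintegral_congr_ae ?_).trans lintegral_zero
    filter_upwards [h (ω k).2] with p hp
    simp [Set.indicator, hp]
  · exact measurable_one.indicator hm2
  · intro a b hab
    have h1 := hab k (by simp)
    have h2 := hab (k + 1) (by simp)
    have hP : P (a k).2 (a (k + 1)) ↔ P (b k).2 (b (k + 1)) :=
      Iff.of_eq (congrArg₂ (fun u v : ℝ × W.State => P u.2 v) h1 h2)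
    simp only [Set.indicator, Set.mem_ofPred_eq, Pi.one_apply]
    by_cases hb : P (b k).2 (b (k + 1))
    · rw [if_neg (not_not.2 hb), if_neg (not_not.2 (hP.2 hb))]
    · rw [if_pos hb, if_pos (mt hP.1 hb)]

/-! ### Transitions and the one-step laws -/

variable {W} in
/-- The state moves from `z` to `z'` by a transition of type `c`. -/
def IsTrans (c : W.Route ⊕ W.Route) (z z' : W.State) : Prop :=
  match c with
  | .inl r => z' = z + Pi.single r 1
  | .inr r => z = z' + Pi.single r 1

-- The displacement `±e_r` determines both the route and the sign. Hence at most one factor of the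
-- product that defines `weight` differs from one.
variable {W} in
lemma IsTrans.unique {c c' : W.Route ⊕ W.Route} {z z' : W.State} (h : IsTrans c z z')
    (h' : IsTrans c' z z') : c = c' := by
  rcases c with r | r <;> rcases c' with s | s <;> simp only [IsTrans] at h h'
  · rw [h] at h'
    have := congrFun (add_left_cancel h') r
    by_contra hne
    have hrs : r ≠ s := fun e => hne (by rw [e])
    simp [hrs] at this
  · rw [h'] at h
    have := congrFun h s
    simp only [Pi.add_apply, Pi.single_eq_same] at this
    omega
  · rw [h'] at h
    have := congrFun h r
    simp only [Pi.add_apply, Pi.single_eq_same] at this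
    omega
  · rw [h] at h'
    have := congrFun (add_left_cancel h') r
    by_contra hne
    have hrs : r ≠ s := fun e => hne (by rw [e])
    simp [hrs] at this

lemma serviceRate_eq_zero {x : W.Route → ℝ} {r : W.Route} (h : x r = 0) :
    W.serviceRate x r = 0 := by
  simp [serviceRate, h]

/-- The truncated subtraction in `target` is wrong only for a departure from an empty route, whose
rate is zero. -/
lemma isTrans_target {z : W.State} {c : W.Route ⊕ W.Route} (h : W.rate z c ≠ 0) :
    IsTrans c z (W.target z c) := by
  rcases c with r | r
  · rfl
  · have hz : z r ≠ 0 := fun h0 => h (W.serviceRate_eq_zero (by simp [toReal, h0]))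
    change z = z - Pi.single r 1 + Pi.single r 1
    funext s
    by_cases hs : s = r
    · subst hs
      simp only [Pi.add_apply, Pi.sub_apply, Pi.single_eq_same]
      omega
    · simp [hs]

lemma rate_inl_pos (z : W.State) (r : W.Route) : 0 < W.rate z (.inl r) := r.2.2

lemma totalRate_pos [Nonempty W.Route] (z : W.State) : 0 < W.totalRate z := by
  obtain ⟨r⟩ := ‹Nonempty W.Route›
  exact (W.rate_inl_pos z r).trans_le
    (Finset.single_le_sum (f := fun c => W.rate z c) (fun c _ => W.rate_nonneg z c)
      (Finset.mem_univ (Sum.inl r)))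

lemma lintegral_jump [Nonempty W.Route] (z : W.State) (f : W.State → ℝ≥0∞) :
    ∫⁻ z', f z' ∂W.jump z =
      ∑ c, ENNReal.ofReal (W.rate z c / W.totalRate z) * f (W.target z c) := by
  rw [jump, if_neg (W.totalRate_pos z).ne', lintegral_finsetSum_measure]
  refine Finset.sum_congr rfl fun c _ => ?_
  rw [lintegral_smul_measure, lintegral_dirac, smul_eq_mul]

lemma holding_eq [Nonempty W.Route] (z : W.State) :
    W.holding z = expMeasure (W.totalRate z) := by
  rw [holding, if_neg (W.totalRate_pos z).ne']

lemma ae_expMeasure_pos {q : ℝ} (hq : 0 < q) : ∀ᵐ s ∂expMeasure q, 0 < s := by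
  have h : {s : ℝ | ¬ 0 < s} = Set.Iic 0 := by ext; simp
  rw [ae_iff, h, expMeasure, gammaMeasure, withDensity_apply _ measurableSet_Iic]
  change ∫⁻ y in Set.Iic 0, exponentialPDF q y = 0
  rw [lintegral_exponentialPDF_eq_antiDeriv hq]
  simp

/-- The integrand is the likelihood ratio of the exponential laws of parameters `p` and `q`. The
case `p = 0` is needed because weights may vanish. -/
lemma setLIntegral_expMeasure {q p u : ℝ} (hq : 0 < q) (hp : 0 ≤ p) (hu : 0 ≤ u) :
    ∫⁻ s in Set.Iic u, ENNReal.ofReal (p / q * Real.exp (-(p - q) * s)) ∂expMeasure q =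
      ENNReal.ofReal (1 - Real.exp (-(p * u))) := by
  rcases hp.eq_or_lt with rfl | hp
  · simp
  have hm : Measurable (exponentialPDF q) := (measurable_exponentialPDFReal q).ennreal_ofReal
  have h1 : expMeasure q = volume.withDensity (exponentialPDF q) := rfl
  rw [h1, setLIntegral_withDensity_eq_setLIntegral_mul _ hm (by fun_prop) measurableSet_Iic]
  have h2 := lintegral_exponentialPDF_eq_antiDeriv hp u
  rw [if_pos hu] at h2
  rw [← h2]
  refine lintegral_congr fun s => ?_
  simp only [Pi.mul_apply, exponentialPDF_eq]
  split_ifs with hs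
  · rw [← ENNReal.ofReal_mul (by positivity)]
    congr 1
    rw [show -(p - q) * s = -(p * s) + q * s by ring, Real.exp_add, Real.exp_neg (q * s)]
    field_simp
  · simp

lemma expMeasure_Ioi {q u : ℝ} (hq : 0 < q) (hu : 0 ≤ u) :
    expMeasure q (Set.Ioi u) = ENNReal.ofReal (Real.exp (-(q * u))) := by
  have hP : IsProbabilityMeasure (expMeasure q) := isProbabilityMeasure_expMeasure hq
  have h := setLIntegral_expMeasure hq hq.le hu
  have h1 : expMeasure q (Set.Iic u) = ENNReal.ofReal (1 - Real.exp (-(q * u))) := by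
    rw [← h]; simp [hq.ne']
  rw [← Set.compl_Iic, prob_compl_eq_one_sub measurableSet_Iic, h1, ← ENNReal.ofReal_one,
    ← ENNReal.ofReal_sub _ (by rw [sub_nonneg]; exact Real.exp_le_one_iff.2 (by nlinarith))]
  congr 1; ring

/-- Almost surely the holding times are positive, and every jump is a transition of positive
rate. -/
lemma ae_law_valid [Nonempty W.Route] (y : W.State) :
    ∀ᵐ ω ∂W.law y, ∀ k, 0 < (ω (k + 1)).1 ∧
      ∃ c, W.rate (ω k).2 c ≠ 0 ∧ (ω (k + 1)).2 = W.target (ω k).2 c := by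
  refine W.ae_law_of_ae_step y (P := fun z p => 0 < p.1 ∧ ∃ c, W.rate z c ≠ 0 ∧
    p.2 = W.target z c) (fun z => ?_) (fun z => ?_)
  · exact (measurableSet_lt measurable_const measurable_fst).inter
      ((Set.to_countable {z' | ∃ c, W.rate z c ≠ 0 ∧ z' = W.target z c}).measurableSet.preimage
        measurable_snd)
  · change ∀ᵐ p ∂(W.holding z).prod (W.jump z), _
    have h1 : ∀ᵐ p ∂(W.holding z).prod (W.jump z), 0 < p.1 := by
      refine Measure.quasiMeasurePreserving_fst.ae (p := fun s : ℝ => 0 < s) ?_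
      rw [holding_eq]
      exact ae_expMeasure_pos (W.totalRate_pos z)
    have h2 : ∀ᵐ p ∂(W.holding z).prod (W.jump z),
        ∃ c, W.rate z c ≠ 0 ∧ p.2 = W.target z c := by
      refine Measure.quasiMeasurePreserving_snd.ae
        (p := fun z' => ∃ c, W.rate z c ≠ 0 ∧ z' = W.target z c) ?_
      rw [ae_iff, ← lintegral_indicator_one (Set.to_countable _).measurableSet, lintegral_jump]
      refine Finset.sum_eq_zero fun c _ => ?_
      by_cases hc : W.rate z c = 0
      · simp [hc]
      · refine mul_eq_zero_of_right _ (Set.indicator_of_notMem ?_ _)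
        simp only [Set.mem_ofPred_eq, not_not]
        exact ⟨c, hc, rfl⟩
    exact h1.and h2

/-! ### Exponential martingales -/

open Classical in
variable {W} in
/-- The weight `v z c` given by `v` to the transition from `z` to `z'`, of type `c`. -/
def weight (v : W.State → W.Route ⊕ W.Route → ℝ) (z z' : W.State) : ℝ :=
  ∏ c, if IsTrans c z z' then v z c else 1

/-- The change of the total jump rate when the rate of each transition is multiplied by its
weight. -/
def excess (v : W.State → W.Route ⊕ W.Route → ℝ) (z : W.State) : ℝ :=
  ∑ c, W.rate z c * (v z c - 1)

/-- The contribution to `density` of a record `p` that follows a jump at time `t` to the state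
`z`. -/
def stepFactor (v : W.State → W.Route ⊕ W.Route → ℝ) (T t : ℝ) (z : W.State)
    (p : ℝ × W.State) : ℝ :=
  (if t + p.1 ≤ T then weight v z p.2 else 1) *
    Real.exp (-W.excess v z * (min (t + p.1) T - min t T))

/-- The density on `[0, T]`, seen after `k` jumps, of the jump process with rates
`rate z c * v z c` with respect to the process with rates `rate z c`. -/
def density (v : W.State → W.Route ⊕ W.Route → ℝ) (T : ℝ) (k : ℕ) (ω : W.Traj) : ℝ :=
  ∏ i ∈ Finset.range k, W.stepFactor v T (jumpTime i ω) (ω i).2 (ω (i + 1))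

variable {W} in
lemma weight_eq {v : W.State → W.Route ⊕ W.Route → ℝ} {c : W.Route ⊕ W.Route} {z z' : W.State}
    (h : IsTrans c z z') : weight v z z' = v z c := by
  rw [weight, Finset.prod_eq_single c]
  · rw [if_pos h]
  · intro c' _ hc
    rw [if_neg fun h' => hc (h'.unique h)]
  · simp

variable {W} in
lemma weight_nonneg {v : W.State → W.Route ⊕ W.Route → ℝ} (hv : ∀ z c, 0 ≤ v z c)
    (z z' : W.State) : 0 ≤ weight v z z' :=
  Finset.prod_nonneg fun c _ => by split_ifs <;> simp [hv]

lemma stepFactor_nonneg {v : W.State → W.Route ⊕ W.Route → ℝ} (hv : ∀ z c, 0 ≤ v z c)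
    (T t : ℝ) (z : W.State) (p : ℝ × W.State) : 0 ≤ W.stepFactor v T t z p := by
  refine mul_nonneg ?_ (Real.exp_pos _).le
  split_ifs
  · exact weight_nonneg hv _ _
  · exact zero_le_one

lemma density_nonneg {v : W.State → W.Route ⊕ W.Route → ℝ} (hv : ∀ z c, 0 ≤ v z c)
    (T : ℝ) (k : ℕ) (ω : W.Traj) : 0 ≤ W.density v T k ω :=
  Finset.prod_nonneg fun _ _ => W.stepFactor_nonneg hv _ _ _ _

lemma measurable_jumpTime (k : ℕ) : Measurable (jumpTime (W := W) k) := by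
  unfold jumpTime
  fun_prop

lemma measurable_stepFactor (v : W.State → W.Route ⊕ W.Route → ℝ) (T : ℝ) :
    Measurable fun q : (ℝ × W.State) × (ℝ × W.State) => W.stepFactor v T q.1.1 q.1.2 q.2 := by
  unfold stepFactor
  have hw : Measurable fun q : W.State × W.State => weight v q.1 q.2 := .of_discrete
  have he : Measurable fun z : W.State => W.excess v z := .of_discrete
  refine Measurable.mul (Measurable.ite ?_ ?_ measurable_const) ?_
  · exact measurableSet_le (by fun_prop) (by fun_prop)
  · exact hw.comp (f := fun q : (ℝ × W.State) × (ℝ × W.State) => (q.1.2, q.2.2)) (by fun_prop)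
  · have := he.comp (f := fun q : (ℝ × W.State) × (ℝ × W.State) => q.1.2) (by fun_prop)
    exact Real.measurable_exp.comp (Measurable.mul this.neg (by fun_prop))

lemma measurable_density (v : W.State → W.Route ⊕ W.Route → ℝ) (T : ℝ) (k : ℕ) :
    Measurable (W.density v T k) := by
  unfold density
  refine Finset.measurable_fun_prod _ fun i _ => ?_
  have := W.measurable_jumpTime i
  exact (W.measurable_stepFactor v T).comp
    (f := fun ω : W.Traj => ((jumpTime i ω, (ω i).2), ω (i + 1))) (by fun_prop)

lemma jumpTime_congr {k : ℕ} {a b : W.Traj} (h : ∀ i ≤ k, a i = b i) :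
    jumpTime k a = jumpTime k b :=
  Finset.sum_congr rfl fun i hi => by rw [h (i + 1) (Finset.mem_range.1 hi)]

lemma density_congr (v : W.State → W.Route ⊕ W.Route → ℝ) (T : ℝ) {k : ℕ} {a b : W.Traj}
    (h : ∀ i ≤ k, a i = b i) : W.density v T k a = W.density v T k b := by
  refine Finset.prod_congr rfl fun i hi => ?_
  have hi := Finset.mem_range.1 hi
  rw [h i hi.le, h (i + 1) hi, W.jumpTime_congr fun j hj => h j (by omega)]

/-- One holding time and one jump, stopped at `T`: with tilted total rate `P`, a jump before `T`
contributes `1 - exp (-P (T - t))` and a holding time that passes `T` contributes `exp (-P (T -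
t))`. -/
lemma lintegral_stepFactor [Nonempty W.Route] {v : W.State → W.Route ⊕ W.Route → ℝ}
    (hv : ∀ z c, 0 ≤ v z c) (T t : ℝ) (z : W.State) :
    ∫⁻ p, ENNReal.ofReal (W.stepFactor v T t z p) ∂W.step z = 1 := by
  set q := W.totalRate z
  have hq : 0 < q := W.totalRate_pos z
  set P := ∑ c, W.rate z c * v z c
  have hP : 0 ≤ P := Finset.sum_nonneg fun c _ => mul_nonneg (W.rate_nonneg z c) (hv z c)
  have he : W.excess v z = P - q := by
    simp only [excess, mul_sub, mul_one, Finset.sum_sub_distrib, P, q, totalRate]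
  have hprob : IsProbabilityMeasure (expMeasure q) := isProbabilityMeasure_expMeasure hq
  have hm : Measurable fun p : ℝ × W.State => ENNReal.ofReal (W.stepFactor v T t z p) :=
    ((W.measurable_stepFactor v T).comp
      (f := fun p : ℝ × W.State => ((t, z), p)) (by fun_prop)).ennreal_ofReal
  change ∫⁻ p, _ ∂(W.holding z).prod (W.jump z) = 1
  rw [lintegral_prod _ hm.aemeasurable, holding_eq]
  have inner : ∀ s : ℝ, ∫⁻ z', ENNReal.ofReal (W.stepFactor v T t z (s, z')) ∂W.jump z =
      ENNReal.ofReal ((if t + s ≤ T then P / q else 1) *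
        Real.exp (-(P - q) * (min (t + s) T - min t T))) := by
    intro s
    by_cases hs : t + s ≤ T
    · rw [lintegral_jump, if_pos hs, Finset.sum_div, Finset.sum_mul,
        ENNReal.ofReal_sum_of_nonneg fun c _ => mul_nonneg
          (div_nonneg (mul_nonneg (W.rate_nonneg z c) (hv z c)) hq.le) (Real.exp_pos _).le]
      refine Finset.sum_congr rfl fun c _ => ?_
      rw [← ENNReal.ofReal_mul (div_nonneg (W.rate_nonneg z c) hq.le), stepFactor, if_pos hs, he]
      by_cases hc : W.rate z c = 0
      · simp [hc]
      · rw [weight_eq (W.isTrans_target hc)]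
        congr 1
        change W.rate z c / q * _ = _
        ring
    · simp only [stepFactor, if_neg hs, he, lintegral_const, measure_univ, mul_one]
  simp only [inner]
  -- Once `T` is passed the factor is almost surely one.
  rcases lt_or_ge T t with ht | ht
  · rw [← measure_univ (μ := expMeasure q), ← lintegral_one]
    refine lintegral_congr_ae ?_
    filter_upwards [ae_expMeasure_pos hq] with s hs
    rw [if_neg (by linarith), min_eq_right (by linarith), min_eq_right ht.le]
    simp
  · have hu : 0 ≤ T - t := by linarith
    rw [← lintegral_add_compl _ (measurableSet_Iic (a := T - t)), Set.compl_Iic]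
    have h1 : ∫⁻ s in Set.Iic (T - t), ENNReal.ofReal ((if t + s ≤ T then P / q else 1) *
        Real.exp (-(P - q) * (min (t + s) T - min t T))) ∂expMeasure q =
        ENNReal.ofReal (1 - Real.exp (-(P * (T - t)))) := by
      rw [← setLIntegral_expMeasure hq hP hu]
      refine setLIntegral_congr_fun measurableSet_Iic fun s hs => ?_
      have hs' : t + s ≤ T := by linarith [Set.mem_Iic.1 hs]
      simp only [if_pos hs', min_eq_left hs', min_eq_left ht, add_sub_cancel_left]
    have h2 : ∫⁻ s in Set.Ioi (T - t), ENNReal.ofReal ((if t + s ≤ T then P / q else 1) *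
        Real.exp (-(P - q) * (min (t + s) T - min t T))) ∂expMeasure q =
        ENNReal.ofReal (Real.exp (-(P * (T - t)))) := by
      have : ∀ s ∈ Set.Ioi (T - t), ENNReal.ofReal ((if t + s ≤ T then P / q else 1) *
          Real.exp (-(P - q) * (min (t + s) T - min t T))) =
          ENNReal.ofReal (Real.exp (-(P - q) * (T - t))) := by
        intro s hs
        have hs' : T < t + s := by linarith [Set.mem_Ioi.1 hs]
        rw [if_neg hs'.not_ge, min_eq_right hs'.le, min_eq_left ht, one_mul]
      rw [setLIntegral_congr_fun measurableSet_Ioi this, lintegral_const,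
        Measure.restrict_apply_univ, expMeasure_Ioi hq hu,
        ← ENNReal.ofReal_mul (Real.exp_pos _).le, ← Real.exp_add]
      congr 2; ring
    rw [h1, h2, ← ENNReal.ofReal_add _ (Real.exp_pos _).le]
    · simp
    · rw [sub_nonneg]
      exact Real.exp_le_one_iff.2 (neg_nonpos.2 (mul_nonneg hP hu))

/-- The martingale property of `density` in the number of jumps: the last factor integrates to one
given the past. -/
lemma lintegral_density_succ_mul [Nonempty W.Route] {v : W.State → W.Route ⊕ W.Route → ℝ}
    (hv : ∀ z c, 0 ≤ v z c) (T : ℝ) (y : W.State) (k : ℕ) {G : W.Traj → ℝ≥0∞}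
    (hG : Measurable G) (hd : ∀ a b : W.Traj, (∀ i ≤ k, a i = b i) → G a = G b) :
    ∫⁻ ω, ENNReal.ofReal (W.density v T (k + 1) ω) * G ω ∂W.law y =
      ∫⁻ ω, ENNReal.ofReal (W.density v T k ω) * G ω ∂W.law y := by
  rw [lintegral_law_succ W y k]
  · refine lintegral_congr fun ω => ?_
    have hu : ∀ p i, i ≤ k → Function.update ω (k + 1) p i = ω i := fun p i hi =>
      Function.update_of_ne (by omega) _ _
    have : ∀ p, ENNReal.ofReal (W.density v T (k + 1) (Function.update ω (k + 1) p)) *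
        G (Function.update ω (k + 1) p) = ENNReal.ofReal (W.density v T k ω) * G ω *
          ENNReal.ofReal (W.stepFactor v T (jumpTime k ω) (ω k).2 p) := by
      intro p
      rw [hd _ ω (hu p), density, Finset.prod_range_succ, ← density, W.density_congr v T (hu p),
        W.jumpTime_congr (hu p), hu p k le_rfl, Function.update_self,
        ENNReal.ofReal_mul (W.density_nonneg hv _ _ _)]
      ring
    simp only [this]
    rw [lintegral_const_mul, W.lintegral_stepFactor hv, mul_one]
    exact ((W.measurable_stepFactor v T).comp
      (f := fun p : ℝ × W.State => ((jumpTime k ω, (ω k).2), p)) (by fun_prop)).ennreal_ofReal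
  · exact (W.measurable_density v T _).ennreal_ofReal.mul hG
  · intro a b hab
    have h : ∀ i ≤ k + 1, a i = b i := fun i hi => hab i hi
    simp only
    rw [W.density_congr v T h, hd a b fun i hi => h i (by omega)]

lemma lintegral_density [Nonempty W.Route] {v : W.State → W.Route ⊕ W.Route → ℝ}
    (hv : ∀ z c, 0 ≤ v z c) (T : ℝ) (y : W.State) (k : ℕ) :
    ∫⁻ ω, ENNReal.ofReal (W.density v T k ω) ∂W.law y = 1 := by
  induction k with
  | zero => simp [density]
  | succ k ih =>
    have := W.lintegral_density_succ_mul hv T y k (G := fun _ => 1) measurable_const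
      fun _ _ _ => rfl
    simpa [ih] using this

/-- Doob's maximal inequality for the ratio of two densities. -/
lemma lintegral_density_maximal [Nonempty W.Route] {v v' : W.State → W.Route ⊕ W.Route → ℝ}
    (hv : ∀ z c, 0 ≤ v z c) (hv' : ∀ z c, 0 ≤ v' z c) (T : ℝ) (y : W.State) (K : ℕ) {l : ℝ}
    (hl : 0 < l) :
    ∫⁻ ω in {ω | ∃ k ≤ K, l * W.density v T k ω ≤ W.density v' T k ω},
      ENNReal.ofReal (W.density v T K ω) ∂W.law y ≤ ENNReal.ofReal (1 / l) := by
  set B : ℕ → Set W.Traj := fun K => {ω | ∃ k ≤ K, l * W.density v T k ω ≤ W.density v' T k ω}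
  set C : ℕ → Set W.Traj := fun k => {ω | l * W.density v T k ω ≤ W.density v' T k ω}
  have hC : ∀ k, MeasurableSet (C k) := fun k =>
    measurableSet_le ((W.measurable_density v T k).const_mul l) (W.measurable_density v' T k)
  have hB : ∀ K, MeasurableSet (B K) := fun K => by
    have : B K = ⋃ k ∈ Set.Iic K, C k := by ext; simp [B, C]
    rw [this]
    exact MeasurableSet.biUnion (Set.to_countable _) fun k _ => hC k
  have hdep : ∀ K, ∀ a b : W.Traj, (∀ i ≤ K, a i = b i) → (a ∈ B K ↔ b ∈ B K) := by
    intro K a b hab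
    refine exists_congr fun k => and_congr_right fun hk => ?_
    rw [W.density_congr v T fun i hi => hab i (hi.trans hk),
      W.density_congr v' T fun i hi => hab i (hi.trans hk)]
  -- Splitting according to whether the level is first reached at the index `K + 1`.
  have hBs : ∀ K, B (K + 1) = B K ∪ ((B K)ᶜ ∩ C (K + 1)) := by
    intro K
    ext ω
    simp only [B, C, Set.mem_union, Set.mem_inter_iff, Set.mem_compl_iff, Set.mem_ofPred_eq]
    constructor
    · rintro ⟨k, hk, h⟩
      by_cases h' : ∃ k ≤ K, l * W.density v T k ω ≤ W.density v' T k ω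
      · exact Or.inl h'
      · refine Or.inr ⟨h', ?_⟩
        have : k = K + 1 := by
          by_contra hne
          exact h' ⟨k, by omega, h⟩
        rwa [this] at h
    · rintro (⟨k, hk, h⟩ | ⟨-, h⟩)
      · exact ⟨k, by omega, h⟩
      · exact ⟨K + 1, le_rfl, h⟩
  have hstep : ∀ (u : W.State → W.Route ⊕ W.Route → ℝ), (∀ z c, 0 ≤ u z c) → ∀ K (A : Set W.Traj),
      MeasurableSet A → (∀ a b : W.Traj, (∀ i ≤ K, a i = b i) → (a ∈ A ↔ b ∈ A)) →
      ∫⁻ ω in A, ENNReal.ofReal (W.density u T (K + 1) ω) ∂W.law y =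
        ∫⁻ ω in A, ENNReal.ofReal (W.density u T K ω) ∂W.law y := by
    intro u hu K A hA hAd
    have := W.lintegral_density_succ_mul hu T y K (G := A.indicator 1)
      (measurable_one.indicator hA) (fun a b hab => by
        by_cases ha : a ∈ A
        · simp [ha, (hAd a b hab).1 ha]
        · have hb : b ∉ A := fun hb => ha ((hAd a b hab).2 hb)
          simp [ha, hb])
    rw [← lintegral_indicator hA, ← lintegral_indicator hA]
    convert! this using 3 with ω ω
    · by_cases h : ω ∈ A <;> simp [h]
    · by_cases h : ω ∈ A <;> simp [h]
  have hcl : ∀ k (A : Set W.Traj), MeasurableSet A → A ⊆ C k →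
      ENNReal.ofReal l * ∫⁻ ω in A, ENNReal.ofReal (W.density v T k ω) ∂W.law y ≤
        ∫⁻ ω in A, ENNReal.ofReal (W.density v' T k ω) ∂W.law y := by
    intro k A hA hAC
    rw [← lintegral_const_mul _ (W.measurable_density v T k).ennreal_ofReal]
    refine setLIntegral_mono' hA fun ω hω => ?_
    rw [← ENNReal.ofReal_mul hl.le]
    exact ENNReal.ofReal_le_ofReal (hAC hω)
  -- Optional stopping at the first index where the level is reached, as an induction: mass that
  -- crosses is exchanged for `l` times its `v`-mass, the rest keeps its `v'`-mass, and the total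
  -- never increases. No quotient is formed, since `density v` may vanish.
  have main : ∀ K, ENNReal.ofReal l *
      ∫⁻ ω in B K, ENNReal.ofReal (W.density v T K ω) ∂W.law y +
      ∫⁻ ω in (B K)ᶜ, ENNReal.ofReal (W.density v' T K ω) ∂W.law y ≤ 1 := by
    intro K
    induction K with
    | zero =>
      have h0 : B 0 ⊆ C 0 := by
        rintro ω ⟨k, hk, h⟩
        obtain rfl : k = 0 := by omega
        exact h
      refine (add_le_add_left (hcl 0 _ (hB 0) h0) _).trans ?_
      rw [lintegral_add_compl _ (hB 0), W.lintegral_density hv']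
    | succ K ih =>
      have hA : MeasurableSet ((B K)ᶜ ∩ C (K + 1)) := (hB K).compl.inter (hC _)
      have hdisj : Disjoint (B K) ((B K)ᶜ ∩ C (K + 1)) :=
        disjoint_compl_right.mono_right Set.inter_subset_left
      have hc : (B (K + 1))ᶜ = (B K)ᶜ \ C (K + 1) := by
        rw [hBs]; ext; simp; tauto
      rw [hBs K, lintegral_union hA hdisj, mul_add, add_assoc, ← hBs K, hc,
        hstep v hv K _ (hB K) (hdep K)]
      refine le_trans (add_le_add le_rfl ?_) ih
      rw [← hstep v' hv' K _ (hB K).compl fun a b hab => not_congr (hdep K a b hab),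
        ← lintegral_inter_add_sdiff _ (B K)ᶜ (hC (K + 1))]
      exact add_le_add (hcl _ _ hA Set.inter_subset_right) le_rfl
  have := (le_self_add.trans (main K))
  rw [one_div, ENNReal.ofReal_inv_of_pos hl, ← one_div,
    ENNReal.le_div_iff_mul_le (Or.inl (by simpa using hl)) (Or.inl ENNReal.ofReal_ne_top), mul_comm]
  exact this

/-! ### Valid trajectories -/

/-- The trajectories that start in `y` at time `0`, with positive holding times and transitions of
positive rate. -/
def Valid (y : W.State) (ω : W.Traj) : Prop :=
  ω 0 = (0, y) ∧ ∀ k, 0 < (ω (k + 1)).1 ∧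
    ∃ c, W.rate (ω k).2 c ≠ 0 ∧ (ω (k + 1)).2 = W.target (ω k).2 c

lemma ae_valid [Nonempty W.Route] (y : W.State) : ∀ᵐ ω ∂W.law y, W.Valid y ω :=
  (W.law_zero y).and (W.ae_law_valid y)

variable {W} in
/-- The time of the `k`-th jump, capped at `T`. -/
def clock (T : ℝ) (k : ℕ) (ω : W.Traj) : ℝ := min (jumpTime k ω) T

open Classical in
variable {W} in
/-- The number of transitions of type `c` among the first `k` jumps and before time `T`. -/
def count (c : W.Route ⊕ W.Route) (T : ℝ) (k : ℕ) (ω : W.Traj) : ℝ :=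
  ∑ i ∈ Finset.range k,
    if jumpTime (i + 1) ω ≤ T ∧ IsTrans c (ω i).2 (ω (i + 1)).2 then 1 else 0

lemma jumpTime_zero (ω : W.Traj) : jumpTime 0 ω = 0 := by simp [jumpTime]

lemma jumpTime_succ (k : ℕ) (ω : W.Traj) : jumpTime (k + 1) ω = jumpTime k ω + (ω (k + 1)).1 := by
  simp [jumpTime, Finset.sum_range_succ]

lemma clock_zero {T : ℝ} (hT : 0 ≤ T) (ω : W.Traj) : clock T 0 ω = 0 := by
  rw [clock, jumpTime_zero, min_eq_left hT]

lemma sum_clock {T : ℝ} (hT : 0 ≤ T) (k : ℕ) (ω : W.Traj) :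
    ∑ i ∈ Finset.range k, (clock T (i + 1) ω - clock T i ω) = clock T k ω := by
  rw [Finset.sum_range_sub (fun i => clock T i ω), clock_zero W hT, sub_zero]

section Valid

variable {W} {y : W.State} {ω : W.Traj}

lemma Valid.strictMono (h : W.Valid y ω) : StrictMono fun k => jumpTime k ω :=
  strictMono_nat_of_lt_succ fun k => by
    rw [jumpTime_succ]; linarith [(h.2 k).1]

lemma Valid.state_zero (h : W.Valid y ω) : (ω 0).2 = y := by rw [h.1]

lemma Valid.jumpTime_nonneg (h : W.Valid y ω) (k : ℕ) : 0 ≤ jumpTime k ω := by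
  rw [← W.jumpTime_zero ω]; exact h.strictMono.monotone (Nat.zero_le k)

lemma Valid.exists_trans (h : W.Valid y ω) (k : ℕ) : ∃ c, IsTrans c (ω k).2 (ω (k + 1)).2 ∧
    (ω (k + 1)).2 = W.target (ω k).2 c := by
  obtain ⟨c, hc, e⟩ := (h.2 k).2
  refine ⟨c, ?_, e⟩
  rw [e]
  exact W.isTrans_target hc

lemma Valid.clock_mono (h : W.Valid y ω) (T : ℝ) (k : ℕ) : clock T k ω ≤ clock T (k + 1) ω :=
  min_le_min_right _ (h.strictMono.monotone (Nat.le_succ k))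

/-- A jump time beyond `t` makes the set counted by `numJumps` finite, so `Set.ncard` does not take
its default value. -/
lemma Valid.numJumps_eq (h : W.Valid y ω) {t : ℝ} {k : ℕ}
    (h1 : jumpTime k ω ≤ t) (h2 : t < jumpTime (k + 1) ω) :
    numJumps t ω = k := by
  have : {j : ℕ | jumpTime (j + 1) ω ≤ t} = ↑(Finset.range k) := by
    ext j
    simp only [Set.mem_ofPred_eq, Finset.coe_range, Set.mem_Iio]
    constructor
    · intro hj
      have := h.strictMono.lt_iff_lt.1 (hj.trans_lt h2)
      omega
    · intro hj
      exact (h.strictMono.monotone (show j + 1 ≤ k by omega)).trans h1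
  rw [numJumps, this, Set.ncard_coe_finset, Finset.card_range]

lemma exists_index {t : ℝ} (ht : 0 ≤ t) {K : ℕ} (hK : t < jumpTime K ω) :
    ∃ k < K, jumpTime k ω ≤ t ∧ t < jumpTime (k + 1) ω := by
  induction K with
  | zero => rw [jumpTime_zero] at hK; linarith
  | succ K ih =>
    by_cases h' : t < jumpTime K ω
    · obtain ⟨k, hk, h1⟩ := ih h'
      exact ⟨k, by omega, h1⟩
    · exact ⟨K, by omega, not_lt.1 h', hK⟩

lemma Valid.queue_eq (h : W.Valid y ω) {t : ℝ} {k : ℕ}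
    (h1 : jumpTime k ω ≤ t) (h2 : t < jumpTime (k + 1) ω) :
    queue t ω = (ω k).2 := by
  rw [queue, h.numJumps_eq h1 h2]

lemma Valid.queue_zero (h : W.Valid y ω) : queue 0 ω = y := by
  have h0 := W.jumpTime_zero ω
  have h1 : (0 : ℝ) < jumpTime 1 ω := by
    rw [← h0]; exact h.strictMono Nat.zero_lt_one
  rw [h.queue_eq (k := 0) h0.le h1, h.state_zero]

lemma Valid.count_eq (h : W.Valid y ω) {T : ℝ} {k K : ℕ} (hk : k ≤ K) (h2 : T < jumpTime (k + 1) ω)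
    (c : W.Route ⊕ W.Route) : count c T K ω = count c T k ω := by
  obtain ⟨m, rfl⟩ := Nat.exists_eq_add_of_le hk
  rw [count, Finset.sum_range_add, ← count, add_eq_left]
  refine Finset.sum_eq_zero fun i _ => if_neg fun h' => ?_
  have := h.strictMono.monotone (show k + 1 ≤ k + i + 1 by omega)
  linarith [h'.1]

lemma Valid.arrivals_eq (h : W.Valid y ω) {T : ℝ} (hT : 0 ≤ T) {K : ℕ}
    (hK : T < jumpTime K ω) (r : W.Route) :
    (arrivals T ω r : ℝ) = count (.inl r) T K ω := by
  classical
  obtain ⟨k, hk, h1, h2⟩ := exists_index hT hK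
  rw [h.count_eq hk.le h2, arrivals, h.numJumps_eq h1 h2, Finset.card_filter, count]
  push_cast
  refine Finset.sum_congr rfl fun i hi => ?_
  have : jumpTime (i + 1) ω ≤ T :=
    (h.strictMono.monotone (Finset.mem_range.1 hi)).trans h1
  simp only [this, true_and, IsTrans]

/-- Conservation on one route: every jump has exactly one type, and `hk` ensures that `count` has
missed none of the first `k`. -/
lemma Valid.state_eq (h : W.Valid y ω) {T : ℝ} {k : ℕ} (hk : jumpTime k ω ≤ T) (r : W.Route) :
    ((ω k).2 r : ℝ) = y r + count (.inl r) T k ω - count (.inr r) T k ω := by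
  classical
  induction k with
  | zero => simp [count, h.state_zero]
  | succ k ih =>
    have hk' : jumpTime k ω ≤ T := (h.strictMono.monotone (Nat.le_succ k)).trans hk
    specialize ih hk'
    obtain ⟨c, hc, -⟩ := h.exists_trans k
    have key : ∀ c', (IsTrans c' (ω k).2 (ω (k + 1)).2) ↔ c' = c :=
      fun c' => ⟨fun h' => h'.unique hc, fun e => e ▸ hc⟩
    simp only [count, Finset.sum_range_succ, hk, true_and, key] at ih ⊢
    rcases c with s | s
    · have e : (ω (k + 1)).2 = (ω k).2 + Pi.single s 1 := hc
      by_cases hs : r = s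
      · subst hs
        simp [e, ih]; ring
      · simp [e, ih, hs]
    · have e : (ω k).2 = (ω (k + 1)).2 + Pi.single s 1 := hc
      rw [e] at ih
      by_cases hs : r = s
      · subst hs
        simp only [Pi.add_apply, Pi.single_eq_same] at ih
        push_cast at ih
        simp only [reduceCtorEq, if_false, if_true, add_zero]
        linarith
      · simpa [hs] using ih

lemma count_succ (T : ℝ) (k : ℕ) (c : W.Route ⊕ W.Route) :
    count c T k ω ≤ count c T (k + 1) ω ∧ count c T (k + 1) ω ≤ count c T k ω + 1 := by
  classical
  rw [count, count, Finset.sum_range_succ]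
  constructor <;> split_ifs <;> simp

lemma count_nonneg (c : W.Route ⊕ W.Route) (T : ℝ) (k : ℕ) : 0 ≤ count c T k ω := by
  classical
  exact Finset.sum_nonneg fun i _ => by split_ifs <;> simp

end Valid

/-! ### Pathwise bounds on densities -/

variable {W} in
lemma IsTrans.eq_target {c : W.Route ⊕ W.Route} {z z' : W.State} (h : IsTrans c z z') :
    z' = W.target z c := by
  rcases c with r | r
  · exact h
  · change z' = z - Pi.single r 1
    rw [show z = z' + Pi.single r 1 from h, add_tsub_cancel_right]

lemma stepFactor_eq (v : W.State → W.Route ⊕ W.Route → ℝ) (T : ℝ) (i : ℕ) (ω : W.Traj) :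
    W.stepFactor v T (jumpTime i ω) (ω i).2 (ω (i + 1)) =
      (if jumpTime (i + 1) ω ≤ T then weight v (ω i).2 (ω (i + 1)).2 else 1) *
        Real.exp (-W.excess v (ω i).2 * (clock T (i + 1) ω - clock T i ω)) := by
  rw [stepFactor, clock, clock, jumpTime_succ]

/-- Distributes counts and clock over the jumps, for a comparison with `density` factor by factor.
-/
lemma exp_logCount (g : W.Route ⊕ W.Route → ℝ) (e : ℝ) {T : ℝ} (hT : 0 ≤ T) (K : ℕ)
    (ω : W.Traj) (f : ℕ → W.Route ⊕ W.Route → ℝ)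
    (hf : ∀ c, count c T K ω = ∑ i ∈ Finset.range K, f i c) :
    Real.exp (∑ c, g c * count c T K ω + e * clock T K ω) =
      ∏ i ∈ Finset.range K,
        Real.exp (∑ c, g c * f i c) * Real.exp (e * (clock T (i + 1) ω - clock T i ω)) := by
  rw [← sum_clock W hT, Finset.prod_mul_distrib, ← Real.exp_sum, ← Real.exp_sum,
    ← Finset.mul_sum, ← Real.exp_add, Finset.sum_comm]
  simp only [hf, Finset.mul_sum]

section Valid

variable {W} {y : W.State} {ω : W.Traj}

lemma Valid.clock_eq_of_lt (h : W.Valid y ω) {T : ℝ} {i : ℕ} (hi : T < jumpTime i ω) :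
    clock T (i + 1) ω - clock T i ω = 0 := by
  rw [clock, clock, min_eq_right hi.le,
    min_eq_right (hi.le.trans (h.strictMono.monotone (Nat.le_succ i))), sub_self]

/-- Only states entered before `T` matter: later records have weight one and no clock increment.
`Valid.le_density` is the reverse bound. -/
lemma Valid.density_le (h : W.Valid y ω) {v : W.State → W.Route ⊕ W.Route → ℝ}
    (hv : ∀ z c, 0 ≤ v z c) {T : ℝ} (hT : 0 ≤ T) {K : ℕ} {g : W.Route ⊕ W.Route → ℝ} {e : ℝ}
    (hs : ∀ i < K, jumpTime i ω ≤ T →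
      (∀ c, v (ω i).2 c ≤ Real.exp (g c)) ∧ -W.excess v (ω i).2 ≤ e) :
    W.density v T K ω ≤ Real.exp (∑ c, g c * count c T K ω + e * clock T K ω) := by
  classical
  rw [exp_logCount W g e hT K ω _ fun c => rfl, density]
  refine Finset.prod_le_prod (fun i _ => W.stepFactor_nonneg hv _ _ _ _) fun i hi => ?_
  have hi := Finset.mem_range.1 hi
  rw [stepFactor_eq]
  by_cases h1 : jumpTime i ω ≤ T
  · obtain ⟨ha, hb⟩ := hs i hi h1
    have hexp : Real.exp (-W.excess v (ω i).2 * (clock T (i + 1) ω - clock T i ω)) ≤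
        Real.exp (e * (clock T (i + 1) ω - clock T i ω)) :=
      Real.exp_le_exp.2 (mul_le_mul_of_nonneg_right hb (sub_nonneg.2 (h.clock_mono T i)))
    refine mul_le_mul ?_ hexp (Real.exp_pos _).le (Real.exp_pos _).le
    by_cases h2 : jumpTime (i + 1) ω ≤ T
    · obtain ⟨c, hc, -⟩ := h.exists_trans i
      rw [if_pos h2, weight_eq hc, Finset.sum_eq_single c]
      · simpa [h2, hc] using ha c
      · intro c' _ hne
        rw [if_neg fun h' => hne (h'.2.unique hc), mul_zero]
      · simp
    · simp [h2]
  · have h1 := not_le.1 h1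
    have h2 : ¬ jumpTime (i + 1) ω ≤ T := not_le.2 (h1.trans (h.strictMono (Nat.lt_succ_self i)))
    simp [h2, h.clock_eq_of_lt h1]

lemma Valid.le_density (h : W.Valid y ω) {v : W.State → W.Route ⊕ W.Route → ℝ}
    {T : ℝ} (hT : 0 ≤ T) {K : ℕ} {g : W.Route ⊕ W.Route → ℝ} {e : ℝ}
    (hs : ∀ i < K, jumpTime i ω ≤ T →
      (∀ c, Real.exp (g c) ≤ v (ω i).2 c) ∧ e ≤ -W.excess v (ω i).2) :
    Real.exp (∑ c, g c * count c T K ω + e * clock T K ω) ≤ W.density v T K ω := by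
  classical
  rw [exp_logCount W g e hT K ω _ fun c => rfl, density]
  refine Finset.prod_le_prod (fun i _ => by positivity) fun i hi => ?_
  have hi := Finset.mem_range.1 hi
  rw [stepFactor_eq]
  by_cases h1 : jumpTime i ω ≤ T
  · obtain ⟨ha, hb⟩ := hs i hi h1
    have hexp : Real.exp (e * (clock T (i + 1) ω - clock T i ω)) ≤
        Real.exp (-W.excess v (ω i).2 * (clock T (i + 1) ω - clock T i ω)) :=
      Real.exp_le_exp.2 (mul_le_mul_of_nonneg_right hb (sub_nonneg.2 (h.clock_mono T i)))
    by_cases h2 : jumpTime (i + 1) ω ≤ T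
    · obtain ⟨c, hc, -⟩ := h.exists_trans i
      have hw : Real.exp (∑ c, g c * if jumpTime (i + 1) ω ≤ T ∧
          IsTrans c (ω i).2 (ω (i + 1)).2 then 1 else 0) ≤ weight v (ω i).2 (ω (i + 1)).2 := by
        rw [weight_eq hc, Finset.sum_eq_single c]
        · simpa [h2, hc] using ha c
        · intro c' _ hne
          rw [if_neg fun h' => hne (h'.2.unique hc), mul_zero]
        · simp
      rw [if_pos h2]
      exact mul_le_mul hw hexp (Real.exp_pos _).le ((Real.exp_pos _).le.trans hw)
    · simpa [h2] using hexp
  · have h1 := not_le.1 h1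
    have h2 : ¬ jumpTime (i + 1) ω ≤ T := not_le.2 (h1.trans (h.strictMono (Nat.lt_succ_self i)))
    simp [h2, h.clock_eq_of_lt h1]

/-- Comparison of a density with the one obtained by tilting its weights. -/
lemma Valid.density_mul_exp_le (h : W.Valid y ω) {v v' g : W.State → W.Route ⊕ W.Route → ℝ}
    (hv : ∀ z c, 0 ≤ v z c) (hv' : ∀ z c, v' z c = v z c * Real.exp (g z c))
    {T : ℝ} (hT : 0 ≤ T) {k : ℕ} {f : ℕ → ℝ} {e : ℝ}
    (hf : ∀ i < k, jumpTime (i + 1) ω ≤ T → ∀ c, IsTrans c (ω i).2 (ω (i + 1)).2 →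
      f i ≤ g (ω i).2 c)
    (hf' : ∀ i < k, T < jumpTime (i + 1) ω → f i ≤ 0)
    (he : ∀ i < k, jumpTime i ω ≤ T →
      ∑ c, W.rate (ω i).2 c * v (ω i).2 c * (Real.exp (g (ω i).2 c) - 1) ≤ e) :
    W.density v T k ω * Real.exp (∑ i ∈ Finset.range k, f i - e * clock T k ω) ≤
      W.density v' T k ω := by
  have e1 : Real.exp (∑ i ∈ Finset.range k, f i - e * clock T k ω) =
      ∏ i ∈ Finset.range k,
        Real.exp (f i) * Real.exp (-e * (clock T (i + 1) ω - clock T i ω)) := by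
    rw [← sum_clock W hT, Finset.prod_mul_distrib, ← Real.exp_sum, ← Real.exp_sum,
      ← Finset.mul_sum, ← Real.exp_add, neg_mul, sub_eq_add_neg]
  rw [e1, density, density, ← Finset.prod_mul_distrib]
  refine Finset.prod_le_prod (fun i _ => mul_nonneg (W.stepFactor_nonneg hv _ _ _ _)
    (by positivity)) fun i hi => ?_
  have hi := Finset.mem_range.1 hi
  rw [stepFactor_eq, stepFactor_eq, mul_mul_mul_comm, ← Real.exp_add]
  refine mul_le_mul ?_ ?_ (Real.exp_pos _).le ?_
  · by_cases h2 : jumpTime (i + 1) ω ≤ T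
    · obtain ⟨c, hc, -⟩ := h.exists_trans i
      rw [if_pos h2, if_pos h2, weight_eq hc, weight_eq hc, hv']
      exact mul_le_mul_of_nonneg_left (Real.exp_le_exp.2 (hf i hi h2 c hc)) (hv _ _)
    · rw [if_neg h2, if_neg h2, one_mul]
      exact Real.exp_le_one_iff.2 (hf' i hi (not_le.1 h2))
  · rw [Real.exp_le_exp]
    by_cases h1 : jumpTime i ω ≤ T
    -- The compensator of the tilted weights is that of `v` plus the compensator of the tilt
    -- computed with the rates `rate * v`.
    · have hex : W.excess v' (ω i).2 = W.excess v (ω i).2 +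
          ∑ c, W.rate (ω i).2 c * v (ω i).2 c * (Real.exp (g (ω i).2 c) - 1) := by
        rw [excess, excess, ← Finset.sum_add_distrib]
        refine Finset.sum_congr rfl fun c _ => ?_
        rw [hv']; ring
      have := he i hi h1
      rw [hex]
      nlinarith [sub_nonneg.2 (h.clock_mono T i)]
    · simp [h.clock_eq_of_lt (not_le.1 h1)]
  · split_ifs
    · refine weight_nonneg (fun z c => ?_) _ _
      rw [hv']
      exact mul_nonneg (hv _ _) (Real.exp_pos _).le
    · exact zero_le_one

end Valid

/-- The weights that multiply by `exp θ` the rate of the transitions of type `c₀`. -/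
def tilt (c₀ : W.Route ⊕ W.Route) (θ : ℝ) (v : W.State → W.Route ⊕ W.Route → ℝ) (z : W.State)
    (c : W.Route ⊕ W.Route) : ℝ :=
  v z c * Real.exp (if c = c₀ then θ else 0)

/-- The weights of the Doob transform by `exp L`. -/
def doob (L : W.State → ℝ) (v : W.State → W.Route ⊕ W.Route → ℝ) (z : W.State)
    (c : W.Route ⊕ W.Route) : ℝ :=
  v z c * Real.exp (L (W.target z c) - L z)

section Valid

variable {W} {y : W.State} {ω : W.Traj}

/-- The exponential martingale of the counting process of one transition type, for the process
already tilted by `v`. -/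
lemma Valid.density_mul_exp_le_tilt (h : W.Valid y ω) {v : W.State → W.Route ⊕ W.Route → ℝ}
    (hv : ∀ z c, 0 ≤ v z c) {T : ℝ} (hT : 0 ≤ T) (c₀ : W.Route ⊕ W.Route) (θ : ℝ) {k : ℕ} {e : ℝ}
    (he : ∀ i < k, jumpTime i ω ≤ T →
      W.rate (ω i).2 c₀ * v (ω i).2 c₀ * (Real.exp θ - 1) ≤ e) :
    W.density v T k ω * Real.exp (θ * count c₀ T k ω - e * clock T k ω) ≤
      W.density (W.tilt c₀ θ v) T k ω := by
  classical
  rw [count, Finset.mul_sum]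
  refine h.density_mul_exp_le (g := fun _ c => if c = c₀ then θ else 0) hv (fun z c => rfl) hT
    (fun i hi h2 c hc => ?_) (fun i hi h2 => ?_) (fun i hi h1 => ?_)
  · by_cases hcc : c = c₀
    · subst hcc; simp [h2, hc]
    · rw [if_neg hcc, if_neg fun h' => hcc (hc.unique h'.2), mul_zero]
  · simp [not_le.2 h2]
  · rw [Finset.sum_eq_single c₀]
    · simpa using he i hi h1
    · intro c _ hc; simp [hc]
    · simp

/-- The logarithms of the extra weights telescope to the increment of `L`. This requires `hk`, since
jumps after `T` carry no weight. -/
lemma Valid.density_mul_exp_le_doob (h : W.Valid y ω) {v : W.State → W.Route ⊕ W.Route → ℝ}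
    (hv : ∀ z c, 0 ≤ v z c) {T : ℝ} (hT : 0 ≤ T) (L : W.State → ℝ) {k : ℕ}
    (hk : jumpTime k ω ≤ T) {e : ℝ}
    (he : ∀ i < k, ∑ c, W.rate (ω i).2 c * v (ω i).2 c *
      (Real.exp (L (W.target (ω i).2 c) - L (ω i).2) - 1) ≤ e) :
    W.density v T k ω * Real.exp (L (ω k).2 - L y - e * clock T k ω) ≤
      W.density (W.doob L v) T k ω := by
  rw [← h.state_zero, ← Finset.sum_range_sub (fun i => L (ω i).2)]
  refine h.density_mul_exp_le hv (fun z c => rfl) hT (fun i hi h2 c hc => ?_)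
    (fun i hi h2 => ?_) (fun i hi _ => he i hi)
  · rw [hc.eq_target]
  · have := h.strictMono.monotone (show i + 1 ≤ k by omega)
    exact absurd (this.trans hk) (not_le.2 h2)

end Valid

/-- The process makes finitely many jumps on `[0, T]`. -/
lemma lintegral_density_jumpTime_le [Nonempty W.Route] {v : W.State → W.Route ⊕ W.Route → ℝ}
    (hv : ∀ z c, 0 ≤ v z c) {B : ℝ} (hB : ∀ z, ∑ c, W.rate z c * v z c ≤ B) {T : ℝ} (hT : 0 ≤ T)
    (y : W.State) (K : ℕ) :
    ∫⁻ ω in {ω | jumpTime K ω ≤ T}, ENNReal.ofReal (W.density v T K ω) ∂W.law y ≤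
      ENNReal.ofReal (Real.exp (B * T) / 2 ^ K) := by
  -- Doubling all weights multiplies the density by at least `2 ^ K * exp (-(B * T))` when `K` jumps
  -- occur before `T`, and the new density has mean one.
  have hv2 : ∀ z c, 0 ≤ v z c * Real.exp (Real.log 2) := fun z c =>
    mul_nonneg (hv z c) (Real.exp_pos _).le
  set v' : W.State → W.Route ⊕ W.Route → ℝ := fun z c => v z c * Real.exp (Real.log 2)
  calc ∫⁻ ω in {ω | jumpTime K ω ≤ T}, ENNReal.ofReal (W.density v T K ω) ∂W.law y
      ≤ ∫⁻ ω in {ω | jumpTime K ω ≤ T}, ENNReal.ofReal (Real.exp (B * T) / 2 ^ K) *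
          ENNReal.ofReal (W.density v' T K ω) ∂W.law y := by
        refine lintegral_mono_ae ?_
        filter_upwards [ae_restrict_of_ae (W.ae_valid y), ae_restrict_mem
          (measurableSet_le (W.measurable_jumpTime K) measurable_const)] with ω h hK
        have hK : jumpTime K ω ≤ T := hK
        rw [← ENNReal.ofReal_mul (by positivity)]
        refine ENNReal.ofReal_le_ofReal ?_
        have := h.density_mul_exp_le (g := fun _ _ => Real.log 2) (f := fun _ => Real.log 2)
          (v' := v') (e := B) hv (fun _ _ => rfl) hT (k := K) (fun _ _ _ _ _ => le_rfl)
          (fun i hi h2 => by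
            have := h.strictMono.monotone (show i + 1 ≤ K by omega)
            exact absurd (this.trans hK) (not_le.2 h2))
          (fun i _ _ => by
            rw [Real.exp_log two_pos, show (2 : ℝ) - 1 = 1 by norm_num]
            simpa only [mul_one] using hB _)
        rw [clock, min_eq_left hK, Finset.sum_const, Finset.card_range, nsmul_eq_mul] at this
        have hge : 2 ^ K * Real.exp (-(B * T)) ≤
            Real.exp (K * Real.log 2 - B * jumpTime K ω) := by
          rw [sub_eq_add_neg, Real.exp_add, Real.exp_nat_mul, Real.exp_log two_pos]
          have hB0 : 0 ≤ B := (Finset.sum_nonneg fun c _ =>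
            mul_nonneg (W.rate_nonneg y c) (hv y c)).trans (hB y)
          gcongr
        have h3 := (mul_le_mul_of_nonneg_left hge (W.density_nonneg hv T K ω)).trans this
        rw [Real.exp_neg] at h3
        rw [div_mul_eq_mul_div, le_div_iff₀ (by positivity)]
        calc W.density v T K ω * 2 ^ K
            = Real.exp (B * T) * (W.density v T K ω * (2 ^ K * (Real.exp (B * T))⁻¹)) := by
              field_simp
          _ ≤ _ := by gcongr
    _ ≤ ∫⁻ ω, ENNReal.ofReal (Real.exp (B * T) / 2 ^ K) *
          ENNReal.ofReal (W.density v' T K ω) ∂W.law y := setLIntegral_le_lintegral _ _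
    _ = _ := by
        rw [lintegral_const_mul _ (W.measurable_density v' T K).ennreal_ofReal,
          W.lintegral_density hv2, mul_one]

/-! ### Service rates and the stability condition -/

lemma le_load {x : W.Route → ℝ} (hx : ∀ r, 0 ≤ x r) {r : W.Route} {i : S} (hi : i ∈ r.1) :
    x r ≤ W.load x i := by
  classical
  rw [load]
  have := Finset.single_le_sum (f := fun s : W.Route => if i ∈ s.1 then x s else 0)
    (fun s _ => by split_ifs <;> simp [hx]) (Finset.mem_univ r)
  simp only [hi, if_true] at this
  convert this

lemma serviceRate_le_div {x : W.Route → ℝ} (hx : ∀ r, 0 ≤ x r) {r : W.Route} {i : S}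
    (hi : i ∈ r.1) : W.serviceRate x r ≤ W.mu r.1 * (x r * (W.cap i / W.load x i)) := by
  refine mul_le_mul_of_nonneg_left (mul_le_mul_of_nonneg_left ?_ (hx r)) (W.mu_pos _).le
  revert hi
  induction r.1 using Sym2.ind with
  | _ j k =>
    intro hi
    rcases Sym2.mem_iff.1 hi with rfl | rfl
    · exact min_le_left _ _
    · exact min_le_right _ _

lemma le_serviceRate {x : W.Route → ℝ} (hx : ∀ r, 0 ≤ x r) {r : W.Route} {b : ℝ}
    (hb : ∀ i ∈ r.1, b ≤ W.cap i / W.load x i) : W.mu r.1 * (x r * b) ≤ W.serviceRate x r := by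
  refine mul_le_mul_of_nonneg_left (mul_le_mul_of_nonneg_left ?_ (hx r)) (W.mu_pos _).le
  revert hb
  induction r.1 using Sym2.ind with
  | _ j k =>
    intro hb
    exact le_min (hb j (Sym2.mem_mk_left j k)) (hb k (Sym2.mem_mk_right j k))

lemma exists_mem_route (r : W.Route) : ∃ i, i ∈ r.1 := by
  induction r.1 using Sym2.ind with
  | _ j k => exact ⟨j, Sym2.mem_mk_left j k⟩

lemma serviceRate_pos {x : W.Route → ℝ} (hx : ∀ r, 0 ≤ x r) {r : W.Route} (hr : 0 < x r) :
    0 < W.serviceRate x r := by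
  refine mul_pos (W.mu_pos _) (mul_pos hr ?_)
  have h : ∀ i ∈ r.1, 0 < W.cap i / W.load x i := fun i hi =>
    div_pos (W.cap_pos i) (hr.trans_le (W.le_load hx hi))
  revert h
  induction r.1 using Sym2.ind with
  | _ j k =>
    intro h
    exact lt_min (h j (Sym2.mem_mk_left j k)) (h k (Sym2.mem_mk_right j k))

lemma serviceRate_le_cap {x : W.Route → ℝ} (hx : ∀ r, 0 ≤ x r) {r : W.Route} {i : S}
    (hi : i ∈ r.1) : W.serviceRate x r ≤ W.mu r.1 * W.cap i := by
  refine (W.serviceRate_le_div hx hi).trans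
    (mul_le_mul_of_nonneg_left ?_ (W.mu_pos _).le)
  -- On an empty link the quotient takes the value zero.
  rcases (W.load_nonneg hx i).eq_or_lt with h0 | h0
  · rw [← h0, div_zero, mul_zero]
    exact (W.cap_pos i).le
  · rw [mul_div_assoc', div_le_iff₀' h0]
    exact mul_le_mul_of_nonneg_right (W.le_load hx hi) (W.cap_pos i).le

lemma toReal_nonneg (z : W.State) (r : W.Route) : 0 ≤ W.toReal z r := Nat.cast_nonneg _

/-- The jump rates are bounded. -/
lemma exists_rate_le : ∃ B : ℝ, 0 ≤ B ∧ (∀ x : W.Route → ℝ, (∀ r, 0 ≤ x r) →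
    ∀ r, W.serviceRate x r ≤ B) ∧ ∀ z c, W.rate z c ≤ B := by
  choose i hi using W.exists_mem_route
  have hn : ∀ r : W.Route, 0 ≤ W.lam r.1 + W.mu r.1 * W.cap (i r) := fun r =>
    add_nonneg (W.lam_nonneg _) (mul_nonneg (W.mu_pos _).le (W.cap_pos _).le)
  have hs : ∀ r : W.Route, W.lam r.1 + W.mu r.1 * W.cap (i r) ≤
      ∑ r : W.Route, (W.lam r.1 + W.mu r.1 * W.cap (i r)) := fun r =>
    Finset.single_le_sum (f := fun r : W.Route => W.lam r.1 + W.mu r.1 * W.cap (i r))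
      (fun r _ => hn r) (Finset.mem_univ r)
  have h1 : ∀ x : W.Route → ℝ, (∀ r, 0 ≤ x r) → ∀ r, W.serviceRate x r ≤
      ∑ r : W.Route, (W.lam r.1 + W.mu r.1 * W.cap (i r)) := fun x hx r =>
    (W.serviceRate_le_cap hx (hi r)).trans ((le_add_of_nonneg_left (W.lam_nonneg _)).trans (hs r))
  refine ⟨_, Finset.sum_nonneg fun r _ => hn r, h1, fun z c => ?_⟩
  rcases c with r | r
  · exact (le_add_of_nonneg_right (mul_nonneg (W.mu_pos _).le (W.cap_pos _).le)).trans (hs r)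
  · exact h1 _ (W.toReal_nonneg z) r

/-! ### Consequences of the balance equations -/

section Balance

variable {π : PMF W.State} (hπ : ∀ z : W.State,
  ∑' y, π y * ENNReal.ofReal (W.q y z) = π z * ENNReal.ofReal (W.totalRate z))
include hπ

/-- Stationarity tested against `f`. With values in `ℝ≥0∞` the sums may be exchanged freely; nothing
is subtracted here. -/
lemma tsum_balance (f : W.State → ℝ≥0∞) :
    ∑' y, π y * ∑ c, ENNReal.ofReal (W.rate y c) * f (W.target y c) =
      ∑' z, π z * (∑ c, ENNReal.ofReal (W.rate z c)) * f z := by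
  classical
  have hq : ∀ y, ∑ c, ENNReal.ofReal (W.rate y c) * f (W.target y c) =
      ∑' z, ENNReal.ofReal (W.q y z) * f z := by
    intro y
    have : ∀ z, ENNReal.ofReal (W.q y z) * f z =
        ∑ c, if z = W.target y c then ENNReal.ofReal (W.rate y c) * f z else 0 := by
      intro z
      rw [q, ENNReal.ofReal_sum_of_nonneg, Finset.sum_mul]
      · refine Finset.sum_congr rfl fun c _ => ?_
        by_cases h : z = W.target y c
        · rw [if_pos h, if_pos h.symm]
        · rw [if_neg h, if_neg (Ne.symm h)]; simp
      · intro c _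
        split_ifs
        · exact W.rate_nonneg y c
        · exact le_rfl
    simp only [this]
    rw [Summable.tsum_finsetSum fun c _ => ENNReal.summable]
    exact Finset.sum_congr rfl fun c _ =>
      (tsum_ite_eq (W.target y c) (fun z => ENNReal.ofReal (W.rate y c) * f z)).symm
  have ht : ∀ z, ∑ c, ENNReal.ofReal (W.rate z c) = ENNReal.ofReal (W.totalRate z) := fun z =>
    (ENNReal.ofReal_sum_of_nonneg fun c _ => W.rate_nonneg z c).symm
  simp only [hq, ht, ← hπ, ← ENNReal.tsum_mul_left, ← ENNReal.tsum_mul_right]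
  rw [ENNReal.tsum_comm]
  simp only [mul_assoc]

/-- The departure from `z + e_r` to `z` has positive rate, so a zero of `π` at `z` spreads to `z +
e_r`; a zero at the empty state would spread to every state. -/
lemma invariant_zero_pos : 0 < π 0 := by
  rw [pos_iff_ne_zero]
  intro h0
  have hstep : ∀ z r, π z = 0 → π (z + Pi.single r 1) = 0 := by
    intro z r hz
    have h := hπ z
    rw [hz, zero_mul, ENNReal.tsum_eq_zero] at h
    have h1 := h (z + Pi.single r 1)
    rcases mul_eq_zero.1 h1 with h1 | h1
    · exact h1
    · exfalso
      rw [ENNReal.ofReal_eq_zero] at h1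
      have hpos : 0 < W.rate (z + Pi.single r 1) (.inr r) :=
        W.serviceRate_pos (W.toReal_nonneg _) (by
          simp only [toReal, Pi.add_apply, Pi.single_eq_same]; positivity)
      have h2 : W.rate (z + Pi.single r 1) (.inr r) ≤ W.q (z + Pi.single r 1) z := by
        have := Finset.single_le_sum (f := fun c => if W.target (z + Pi.single r 1) c = z then
          W.rate (z + Pi.single r 1) c else 0) (fun c _ => by
            split_ifs
            · exact W.rate_nonneg _ _
            · exact le_rfl) (Finset.mem_univ (Sum.inr r))
        rw [if_pos (by exact add_tsub_cancel_right z (Pi.single r 1))] at this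
        exact this
      linarith
  have hall : ∀ n (z : W.State), ∑ r, z r = n → π z = 0 := by
    intro n
    induction n with
    | zero =>
      intro z hz
      have : z = 0 := by
        funext r
        exact Finset.sum_eq_zero_iff.1 hz r (Finset.mem_univ r)
      rw [this, h0]
    | succ n ih =>
      intro z hz
      obtain ⟨r, -, hr⟩ : ∃ r ∈ Finset.univ, z r ≠ 0 := by
        by_contra! hcon
        rw [Finset.sum_eq_zero hcon] at hz
        omega
      have hz' : z = (z - Pi.single r 1) + Pi.single r 1 := by
        funext s
        by_cases hs : s = r
        · subst hs
          simp only [Pi.add_apply, Pi.sub_apply, Pi.single_eq_same]; omega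
        · simp [hs]
      rw [hz'] at hz ⊢
      apply hstep
      apply ih
      simp only [Pi.add_apply, Finset.sum_add_distrib, Finset.sum_pi_single', Finset.mem_univ,
        if_true] at hz
      simpa using hz
  have := π.tsum_coe
  simp [hall _ _ rfl] at this

/-- In equilibrium, the mean departure rate from a route is at least its arrival rate. -/
lemma lam_le_tsum_serviceRate (r : W.Route) :
    ENNReal.ofReal (W.lam r.1) ≤
      ∑' y, π y * ENNReal.ofReal (W.serviceRate (W.toReal y) r) := by
  classical
  obtain ⟨B, hB0, -, hB⟩ := W.exists_rate_le
  set M := ∑' y, π y * ENNReal.ofReal (W.serviceRate (W.toReal y) r)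
  have key : ∀ N : ℕ, ENNReal.ofReal (W.lam r.1) * ∑' y : W.State, (if y r < N then π y else 0) ≤
      M := by
    intro N
    -- The queue length itself may have infinite mean under `π`, hence the truncation.
    set f : W.State → ℝ≥0∞ := fun z => ((min (z r) N : ℕ) : ℝ≥0∞)
    have hbal := W.tsum_balance hπ f
    -- The generator applied to `f`, without subtraction: an arrival raises `f` when `y r < N`, a
    -- departure lowers it when `1 ≤ y r ≤ N`.
    have hpt : ∀ y : W.State, (∑ c, ENNReal.ofReal (W.rate y c) * f (W.target y c)) +
        ENNReal.ofReal (W.serviceRate (W.toReal y) r) * (if 1 ≤ y r ∧ y r ≤ N then 1 else 0) =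
        (∑ c, ENNReal.ofReal (W.rate y c)) * f y +
          ENNReal.ofReal (W.lam r.1) * (if y r < N then 1 else 0) := by
      intro y
      have e1 : ENNReal.ofReal (W.serviceRate (W.toReal y) r) *
          (if 1 ≤ y r ∧ y r ≤ N then 1 else 0) = ∑ c, ENNReal.ofReal (W.rate y c) *
            (if c = Sum.inr r then (if 1 ≤ y r ∧ y r ≤ N then 1 else 0) else 0) := by
        rw [Finset.sum_eq_single (Sum.inr r)]
        · rw [if_pos rfl]; rfl
        · intro c _ hc; simp [hc]
        · simp
      have e2 : ENNReal.ofReal (W.lam r.1) * (if y r < N then 1 else 0) =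
          ∑ c, ENNReal.ofReal (W.rate y c) *
            (if c = Sum.inl r then (if y r < N then 1 else 0) else 0) := by
        rw [Finset.sum_eq_single (Sum.inl r)]
        · rw [if_pos rfl]; rfl
        · intro c _ hc; simp [hc]
        · simp
      rw [e1, e2, Finset.sum_mul, ← Finset.sum_add_distrib, ← Finset.sum_add_distrib]
      refine Finset.sum_congr rfl fun c _ => ?_
      rw [← mul_add, ← mul_add]
      congr 1
      simp only [f]
      rcases c with s | s
      · by_cases hs : s = r
        · subst hs
          simp only [target, Pi.add_apply, Pi.single_eq_same, reduceCtorEq, if_false, add_zero,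
            if_true]
          split_ifs with h
          · rw [min_eq_left (by omega), min_eq_left (by omega)]; push_cast; rfl
          · rw [min_eq_right (by omega), min_eq_right (by omega), add_zero]
        · simp [target, hs, Ne.symm hs]
      · by_cases hs : s = r
        · subst hs
          simp only [target, Pi.sub_apply, Pi.single_eq_same, reduceCtorEq, if_false, add_zero,
            if_true]
          split_ifs with h
          · rw [min_eq_left (by omega), min_eq_left (by omega)]
            exact_mod_cast Nat.sub_add_cancel h.1
          · rw [add_zero]
            congr 1
            omega
        · simp [target, hs, Ne.symm hs]
    have hsum : ∑' y, π y * (∑ c, ENNReal.ofReal (W.rate y c)) * f y +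
        ∑' y, π y * (ENNReal.ofReal (W.serviceRate (W.toReal y) r) *
          (if 1 ≤ y r ∧ y r ≤ N then 1 else 0)) =
        ∑' y, π y * (∑ c, ENNReal.ofReal (W.rate y c)) * f y +
        ∑' y, π y * (ENNReal.ofReal (W.lam r.1) * (if y r < N then 1 else 0)) := by
      rw [← hbal, ← ENNReal.tsum_add]
      simp only [← mul_add, hpt]
      rw [hbal, ← ENNReal.tsum_add]
      simp only [mul_add, mul_assoc]
    -- Bounded rates and bounded `f` allow the common term to be cancelled.
    have hfin : ∑' y, π y * (∑ c, ENNReal.ofReal (W.rate y c)) * f y ≠ ∞ := by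
      refine ne_top_of_le_ne_top (b := ∑' y, π y *
        ((∑ _c : W.Route ⊕ W.Route, ENNReal.ofReal B) * N)) ?_ (ENNReal.tsum_le_tsum fun y => ?_)
      · rw [ENNReal.tsum_mul_right, π.tsum_coe, one_mul]
        exact ENNReal.mul_ne_top (by simp [ENNReal.mul_eq_top]) (ENNReal.natCast_ne_top N)
      · rw [mul_assoc]
        gcongr
        · exact hB _ _
        · exact Nat.cast_le.2 (min_le_right _ _)
    have := (ENNReal.add_right_inj hfin).1 hsum
    calc ENNReal.ofReal (W.lam r.1) * ∑' y : W.State, (if y r < N then π y else 0)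
        = ∑' y, π y * (ENNReal.ofReal (W.lam r.1) * (if y r < N then 1 else 0)) := by
          rw [← ENNReal.tsum_mul_left]
          refine tsum_congr fun y => ?_
          split_ifs <;> ring
      _ = _ := this.symm
      _ ≤ M := by
          refine ENNReal.tsum_le_tsum fun y => ?_
          gcongr
          split_ifs <;> simp
  have h1 : ENNReal.ofReal (W.lam r.1) = ENNReal.ofReal (W.lam r.1) * ∑' y, π y := by
    rw [π.tsum_coe, mul_one]
  -- Each finite set of states lies in `{y | y r < N}` for some `N`, so `key` bounds every partial
  -- sum.
  rw [h1, ENNReal.tsum_eq_iSup_sum, ENNReal.mul_iSup]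
  refine iSup_le fun s => ?_
  refine le_trans ?_ (key (s.sup (fun y => y r) + 1))
  gcongr
  refine le_trans (Finset.sum_le_sum fun y hy => ?_) (ENNReal.sum_le_tsum s)
  rw [if_pos]
  exact Nat.lt_succ_of_le (Finset.le_sup (f := fun y : W.State => y r) hy)

end Balance

open Classical in
/-- Ergodicity implies that no link is overloaded. -/
lemma Ergodic.sum_lam_div_mu_lt (hW : W.Ergodic) (i : S) :
    ∑ r : W.Route, (if i ∈ r.1 then W.lam r.1 / W.mu r.1 else 0) < W.cap i := by
  obtain ⟨π, hπ⟩ := hW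
  have h0 := W.invariant_zero_pos hπ
  have hnn : ∀ r : W.Route, 0 ≤ (if i ∈ r.1 then W.lam r.1 / W.mu r.1 else 0) := fun r => by
    split_ifs
    · exact div_nonneg (W.lam_nonneg _) (W.mu_pos _).le
    · exact le_rfl
  rw [← ENNReal.ofReal_lt_ofReal_iff (W.cap_pos i), ENNReal.ofReal_sum_of_nonneg fun r _ => hnn r]
  -- A link serves work at rate at most its capacity, and at rate zero in the empty state.
  have hstep : ∀ y : W.State, ∑ r : W.Route, (if i ∈ r.1 then
      ENNReal.ofReal (W.serviceRate (W.toReal y) r / W.mu r.1) else 0) ≤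
      if y = 0 then 0 else ENNReal.ofReal (W.cap i) := by
    intro y
    split_ifs with hy
    · refine le_of_eq (Finset.sum_eq_zero fun r _ => ?_)
      rw [W.serviceRate_eq_zero (by simp [hy, toReal])]
      simp
    · calc _ = ∑ r : W.Route, ENNReal.ofReal (if i ∈ r.1 then
            W.serviceRate (W.toReal y) r / W.mu r.1 else 0) :=
            Finset.sum_congr rfl fun r _ => by split_ifs <;> simp
        _ = ENNReal.ofReal (∑ r : W.Route, (if i ∈ r.1 then
            W.serviceRate (W.toReal y) r / W.mu r.1 else 0)) := by
            rw [ENNReal.ofReal_sum_of_nonneg fun r _ => ?_]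
            split_ifs
            · exact div_nonneg (W.serviceRate_nonneg (W.toReal_nonneg y) r) (W.mu_pos _).le
            · exact le_rfl
        _ ≤ ENNReal.ofReal (W.load (W.toReal y) i * (W.cap i / W.load (W.toReal y) i)) := by
            refine ENNReal.ofReal_le_ofReal ?_
            rw [load, Finset.sum_mul, ← load]
            refine Finset.sum_le_sum fun r _ => ?_
            split_ifs with hi
            · rw [div_le_iff₀' (W.mu_pos _)]
              exact W.serviceRate_le_div (W.toReal_nonneg y) hi
            · simp
        _ ≤ _ := by
            refine ENNReal.ofReal_le_ofReal ?_
            by_cases hl : W.load (W.toReal y) i = 0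
            · rw [hl, zero_mul]; exact (W.cap_pos i).le
            · rw [mul_div_cancel₀ _ hl]
  calc ∑ r : W.Route, ENNReal.ofReal (if i ∈ r.1 then W.lam r.1 / W.mu r.1 else 0)
      ≤ ∑ r : W.Route, ∑' y, π y * (if i ∈ r.1 then
          ENNReal.ofReal (W.serviceRate (W.toReal y) r / W.mu r.1) else 0) := by
        refine Finset.sum_le_sum fun r _ => ?_
        split_ifs with hi
        · have := W.lam_le_tsum_serviceRate hπ r
          have e : ∀ a, ENNReal.ofReal (a / W.mu r.1) =
              ENNReal.ofReal a * (ENNReal.ofReal (W.mu r.1))⁻¹ := fun a => by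
            rw [ENNReal.ofReal_div_of_pos (W.mu_pos _), div_eq_mul_inv]
          simp only [e, ← mul_assoc]
          rw [ENNReal.tsum_mul_right]
          gcongr
        · simp
    _ = ∑' y, π y * ∑ r : W.Route, (if i ∈ r.1 then
          ENNReal.ofReal (W.serviceRate (W.toReal y) r / W.mu r.1) else 0) := by
        rw [← Summable.tsum_finsetSum fun c _ => ENNReal.summable]
        simp only [Finset.mul_sum]
    _ ≤ ∑' y, π y * (if y = 0 then 0 else ENNReal.ofReal (W.cap i)) := by
        gcongr with y
        exact hstep y
    -- The strict inequality comes from the positive probability of the empty state.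
    _ < ENNReal.ofReal (W.cap i) := by
        have e : ∑' y, π y * (if y = 0 then 0 else ENNReal.ofReal (W.cap i)) +
            π 0 * ENNReal.ofReal (W.cap i) = ENNReal.ofReal (W.cap i) := by
          have : π 0 * ENNReal.ofReal (W.cap i) =
              ∑' y, if y = 0 then π y * ENNReal.ofReal (W.cap i) else 0 :=
            (tsum_ite_eq (0 : W.State) (fun y => π y * ENNReal.ofReal (W.cap i))).symm
          rw [this, ← ENNReal.tsum_add]
          calc _ = ∑' y, π y * ENNReal.ofReal (W.cap i) :=
                tsum_congr fun y => by split_ifs <;> simp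
            _ = _ := by rw [ENNReal.tsum_mul_right, π.tsum_coe, one_mul]
        have hpos : 0 < π 0 * ENNReal.ofReal (W.cap i) :=
          ENNReal.mul_pos h0.ne' (by simpa using W.cap_pos i)
        conv_rhs => rw [← e]
        refine ENNReal.lt_add_right ?_ hpos.ne'
        refine ne_top_of_le_ne_top (b := ENNReal.ofReal (W.cap i)) ENNReal.ofReal_ne_top ?_
        conv_rhs => rw [← e]
        exact le_self_add

/-! ### Comparison of service rates -/

lemma serviceRate_le_mul {x x' : W.Route → ℝ} (hx' : ∀ r, 0 ≤ x' r) {r : W.Route}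
    {a b : ℝ} (hb : 0 ≤ b) (h1 : x' r ≤ a * x r)
    (h2 : ∀ i ∈ r.1, W.cap i / W.load x' i ≤ b * (W.cap i / W.load x i)) :
    W.serviceRate x' r ≤ a * b * W.serviceRate x r := by
  have h3 : ∀ i ∈ r.1, 0 ≤ W.cap i / W.load x' i := fun i _ =>
    div_nonneg (W.cap_pos i).le (W.load_nonneg hx' i)
  have hx : 0 ≤ a * x r := (hx' r).trans h1
  rw [serviceRate, serviceRate, mul_left_comm (a * b)]
  refine mul_le_mul_of_nonneg_left ?_ (W.mu_pos _).le
  rw [mul_mul_mul_comm]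
  revert h2 h3
  induction r.1 using Sym2.ind with
  | _ i j =>
    intro h2 h3
    simp only [Sym2.lift_mk]
    refine mul_le_mul h1 ?_ (le_min (h3 i (Sym2.mem_mk_left i j)) (h3 j (Sym2.mem_mk_right i j))) hx
    rw [mul_min_of_nonneg _ _ hb]
    exact min_le_min (h2 i (Sym2.mem_mk_left i j)) (h2 j (Sym2.mem_mk_right i j))

lemma load_smul (a : ℝ) (x : W.Route → ℝ) (i : S) : W.load (a • x) i = a * W.load x i := by
  simp only [load, Finset.mul_sum, Pi.smul_apply, smul_eq_mul, mul_ite, mul_zero]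

lemma serviceRate_smul_le {a : ℝ} (ha : 0 < a) {x : W.Route → ℝ} (hx : ∀ r, 0 ≤ x r)
    (r : W.Route) : W.serviceRate (a • x) r ≤ W.serviceRate x r := by
  have := W.serviceRate_le_mul (x := x) (x' := a • x) (r := r) (a := a) (b := a⁻¹)
    (fun r => mul_nonneg ha.le (hx r)) (inv_nonneg.2 ha.le) le_rfl fun i _ => by
      rw [load_smul, div_mul_eq_div_div, div_right_comm, div_eq_inv_mul (_ / _) a]
  rwa [mul_inv_cancel₀ ha.ne', one_mul] at this

/-- Homogeneity of degree zero: the rates at a state `z` are those at `z / n`, which makes the fluid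
scaling exact. -/
lemma serviceRate_smul {a : ℝ} (ha : 0 < a) {x : W.Route → ℝ} (hx : ∀ r, 0 ≤ x r)
    (r : W.Route) : W.serviceRate (a • x) r = W.serviceRate x r := by
  refine le_antisymm (W.serviceRate_smul_le ha hx r) ?_
  have := W.serviceRate_smul_le (inv_pos.2 ha) (x := a • x)
    (fun r => mul_nonneg ha.le (hx r)) r
  rwa [inv_smul_smul₀ ha.ne'] at this

variable {W} in
lemma mem_union_jammed {Λ : Set W.Route} {r s : W.Route} {i : S} (hr : r ∈ Λ) (hi : i ∈ r.1)
    (hs : i ∈ s.1) : s ∈ Λ ∪ jammed Λ := by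
  by_cases h : s ∈ Λ
  · exact Or.inl h
  · exact Or.inr ⟨h, i, hs, r, hr, hi⟩

/-- Near a face, the service rates on the face depend continuously on the routes of `Λ ∪ Λ₁`. -/
lemma exists_serviceRate_near (Λ : Set W.Route) {η m : ℝ} (hη : 0 < η) (hm : 0 < m) :
    ∃ β > 0, ∀ x x' : W.Route → ℝ, (∀ r, 0 ≤ x r) → (∀ r, 0 ≤ x' r) → (∀ r ∈ Λ, m ≤ x r) →
      (∀ r ∈ Λ ∪ jammed Λ, |x' r - x r| ≤ β) → ∀ r ∈ Λ,
        Real.exp (-η) * W.serviceRate x r ≤ W.serviceRate x' r ∧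
        W.serviceRate x' r ≤ Real.exp η * W.serviceRate x r := by
  classical
  -- Chosen so that `(1 - κ)⁻¹ = exp (η / 2)` and `1 + κ ≤ exp (η / 2)`: one factor is spent on the
  -- route, the other on the loads.
  set κ := 1 - Real.exp (-(η / 2))
  have hκ0 : 0 < κ := sub_pos.2 (Real.exp_zero ▸ Real.exp_lt_exp.2 (by linarith))
  have hκ1 : 0 < 1 - κ := by simp only [κ, sub_sub_cancel]; positivity
  have hκ2 : (1 + κ) * (1 - κ)⁻¹ ≤ Real.exp η := by
    have h1 : κ ≤ η / 2 := by
      have := Real.add_one_le_exp (-(η / 2))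
      simp only [κ]; linarith
    have h2 : 1 + κ ≤ Real.exp (η / 2) := by
      have := Real.add_one_le_exp (η / 2); linarith
    have h3 : (1 - κ)⁻¹ = Real.exp (η / 2) := by
      simp only [κ, sub_sub_cancel, Real.exp_neg, inv_inv]
    rw [h3]
    calc (1 + κ) * Real.exp (η / 2) ≤ Real.exp (η / 2) * Real.exp (η / 2) := by gcongr
      _ = Real.exp η := by rw [← Real.exp_add, add_halves]
  set N : ℝ := Fintype.card W.Route + 1
  have hN : 0 < N := by positivity
  -- There are fewer than `N` routes, so each load on a link of `r` moves by at most `κ * m`, and `m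
  -- ≤ x r` is at most that load.
  refine ⟨κ * m / N, by positivity, fun x x' hx hx' hmx hd r hr => ?_⟩
  have hβm : κ * m / N ≤ κ * m := div_le_self (by positivity) (by simp [N])
  have hmr := hmx r hr
  have hxr := abs_le.1 (hd r (Or.inl hr))
  have hload : ∀ i ∈ r.1, |W.load x' i - W.load x i| ≤ κ * m := by
    intro i hi
    calc |W.load x' i - W.load x i|
        = |∑ s : W.Route, if i ∈ s.1 then x' s - x s else 0| := by
          rw [load, load, ← Finset.sum_sub_distrib]
          congr 1
          refine Finset.sum_congr rfl fun s _ => ?_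
          split_ifs <;> simp
      _ ≤ ∑ s : W.Route, |if i ∈ s.1 then x' s - x s else 0| := Finset.abs_sum_le_sum_abs _ _
      _ ≤ ∑ _s : W.Route, κ * m / N := by
          refine Finset.sum_le_sum fun s _ => ?_
          split_ifs with h
          · exact hd s (mem_union_jammed hr hi h)
          · rw [abs_zero]; positivity
      _ = Fintype.card W.Route * (κ * m / N) := by
          rw [Finset.sum_const, Finset.card_univ, nsmul_eq_mul]
      _ ≤ N * (κ * m / N) := by
          gcongr
          simp [N]
      _ = κ * m := by field_simp
  have hl : ∀ i ∈ r.1, 0 < W.load x i ∧ (1 - κ) * W.load x i ≤ W.load x' i ∧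
      W.load x' i ≤ (1 + κ) * W.load x i := by
    intro i hi
    have h1 := hmr.trans (W.le_load hx hi)
    have h2 := abs_le.1 (hload i hi)
    refine ⟨hm.trans_le h1, ?_, ?_⟩ <;> nlinarith
  have hκm : κ * m ≤ κ * x r := by gcongr
  constructor
  · have := W.serviceRate_le_mul (x := x') (x' := x) (r := r) (a := (1 - κ)⁻¹) (b := 1 + κ)
      hx (by linarith) (by
        rw [inv_mul_eq_div, le_div_iff₀ hκ1]; nlinarith) fun i hi => by
        obtain ⟨h0, h1, h2⟩ := hl i hi
        have h3 : 0 < W.load x' i := lt_of_lt_of_le (by positivity) h1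
        rw [mul_div_assoc', div_le_div_iff₀ h0 h3]
        nlinarith [W.cap_pos i]
    rw [Real.exp_neg, inv_mul_le_iff₀ (Real.exp_pos _)]
    refine this.trans (mul_le_mul_of_nonneg_right ?_ (W.serviceRate_nonneg hx' r))
    rwa [mul_comm]
  · have := W.serviceRate_le_mul (x := x) (x' := x') (r := r) (a := 1 + κ) (b := (1 - κ)⁻¹)
      hx' (by positivity) (by nlinarith) fun i hi => by
        obtain ⟨h0, h1, h2⟩ := hl i hi
        have h3 : 0 < W.load x' i := lt_of_lt_of_le (by positivity) h1
        rw [inv_mul_eq_div, div_div, div_le_div_iff₀ h3 (by positivity)]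
        nlinarith [W.cap_pos i]
    exact this.trans (mul_le_mul_of_nonneg_right hκ2 (W.serviceRate_nonneg hx r))

/-! ### Constrained transitions -/

open Classical in
variable {W} in
/-- The transitions whose frequency is prescribed by a generator on the face `Λ`: the arrivals on
`Λ ∪ Λ₁` and the departures on `Λ`. -/
def constrained (Λ : Set W.Route) : Finset (W.Route ⊕ W.Route) :=
  Finset.univ.filter fun c => Sum.elim (· ∈ Λ ∪ jammed Λ) (· ∈ Λ) c

open Classical in
variable {W} in
/-- The frequencies of the transitions prescribed by `G`. -/
def genRate {Λ : Set W.Route} (G : GenPair Λ) : W.Route ⊕ W.Route → ℝ :=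
  Sum.elim (fun r => if h : r ∈ Λ ∪ jammed Λ then G.1 ⟨r, h⟩ else 0)
    (fun r => if h : r ∈ Λ ∪ jammed Λ then G.1 ⟨r, h⟩ - G.2 r else 0)

/-- The rate of the transitions of type `c` at `x`. -/
def fluidRate (x : W.Route → ℝ) : W.Route ⊕ W.Route → ℝ :=
  Sum.elim (fun r => W.lam r.1) (W.serviceRate x)

variable {W} in
lemma inl_mem_constrained {Λ : Set W.Route} {r : W.Route} :
    Sum.inl r ∈ constrained Λ ↔ r ∈ Λ ∪ jammed Λ := by
  simp [constrained]

variable {W} in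
lemma inr_mem_constrained {Λ : Set W.Route} {r : W.Route} :
    Sum.inr r ∈ constrained Λ ↔ r ∈ Λ := by
  simp [constrained]

-- The strict inequalities of `calG` are lost in the closure; the closed conditions listed here are
-- all that both bounds use.
variable {W} in
lemma mem_closure_calG {Λ : Set W.Route} {G : GenPair Λ} (hG : G ∈ closure (calG Λ)) :
    G ∈ Gam Λ ∧ (∀ r ∉ Λ, G.2 r = 0) ∧ (∀ r, r.1 ∈ jammed Λ → G.1 r = 0) := by
  have hc : IsClosed {G : GenPair Λ | G ∈ Gam Λ ∧ (∀ r ∉ Λ, G.2 r = 0) ∧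
      (∀ r, r.1 ∈ jammed Λ → G.1 r = 0)} := by
    simp only [Gam, Set.ofPred_and, Set.ofPred_forall]
    refine IsClosed.inter (IsClosed.inter ?_ ?_) (IsClosed.inter ?_ ?_)
    · exact isClosed_iInter fun r => isClosed_le (by fun_prop) (by fun_prop)
    · exact isClosed_iInter fun r => isClosed_le (by fun_prop) (by fun_prop)
    · exact isClosed_iInter fun r => isClosed_iInter fun _ =>
        isClosed_eq (by fun_prop) (by fun_prop)
    · exact isClosed_iInter fun r => isClosed_iInter fun _ =>
        isClosed_eq (by fun_prop) (by fun_prop)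
  have hsub : calG Λ ⊆ {G : GenPair Λ | G ∈ Gam Λ ∧ (∀ r ∉ Λ, G.2 r = 0) ∧
      (∀ r, r.1 ∈ jammed Λ → G.1 r = 0)} := fun G hG => ⟨hG.1, hG.2.1, hG.2.2.1⟩
  exact closure_minimal hsub hc hG

section

variable {W} {Λ : Set W.Route} {G : GenPair Λ}

lemma genRate_nonneg (hG : G ∈ Gam Λ) (c : W.Route ⊕ W.Route) : 0 ≤ genRate G c := by
  rcases c with r | r <;> simp only [genRate, Sum.elim_inl, Sum.elim_inr] <;> split_ifs with h
  · exact hG.1 _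
  · exact le_rfl
  · exact hG.2 ⟨r, h⟩
  · exact le_rfl

lemma genRate_inl_sub_inr {r : W.Route} (hr : r ∈ Λ) :
    genRate G (.inl r) - genRate G (.inr r) = G.2 r := by
  have h : r ∈ Λ ∪ jammed Λ := Or.inl hr
  simp only [genRate, Sum.elim_inl, Sum.elim_inr, dif_pos h]
  ring

lemma genRate_inl_of_jammed (hG : ∀ r, r.1 ∈ jammed Λ → G.1 r = 0) {r : W.Route}
    (hr : r ∈ jammed Λ) : genRate G (.inl r) = 0 := by
  have h : r ∈ Λ ∪ jammed Λ := Or.inr hr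
  simp only [genRate, Sum.elim_inl, dif_pos h]
  exact hG ⟨r, h⟩ hr

lemma fluidRate_pos {x : W.Route → ℝ} (hx : ∀ r, 0 ≤ x r) (hΛ : ∀ r ∈ Λ, 0 < x r)
    {c : W.Route ⊕ W.Route} (hc : c ∈ constrained Λ) : 0 < W.fluidRate x c := by
  rcases c with r | r
  · exact r.2.2
  · exact W.serviceRate_pos hx (hΛ r (inr_mem_constrained.1 hc))

/-- The departures on `Λ₁` drop out: their prescribed frequency and their rate at `x` are both zero.
-/
lemma entropy_eq_sum (h0 : ∀ r ∉ Λ, G.2 r = 0) (h1 : ∀ r, r.1 ∈ jammed Λ → G.1 r = 0)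
    {x : W.Route → ℝ} (hx : x ∈ facePoints Λ) :
    W.entropy Λ G x = ∑ c ∈ constrained Λ, poissonEntropy (genRate G c) (W.fluidRate x c) := by
  classical
  rw [constrained, Finset.sum_filter, Fintype.sum_sum_type, entropy, Finset.sum_add_distrib]
  have hsum : ∀ f : W.Route → ℝ, ∑ r : ↥(Λ ∪ jammed Λ), f r.1 =
      ∑ r : W.Route, if r ∈ Λ ∪ jammed Λ then f r else 0 := by
    intro f
    rw [← Finset.sum_filter]
    refine (Finset.sum_subtype _ (fun r => ?_) f).symm
    simp
  congr 1
  · have e := hsum fun r => poissonEntropy (genRate G (.inl r)) (W.fluidRate x (.inl r))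
    refine Eq.trans (Eq.trans ?_ e) ?_
    · refine Finset.sum_congr rfl fun r _ => ?_
      simp only [genRate, Sum.elim_inl, dif_pos r.2]
      rfl
    · refine Finset.sum_congr rfl fun r _ => ?_
      by_cases hr : r ∈ Λ ∪ jammed Λ
      · rw [if_pos hr]
        exact (if_pos hr).symm
      · rw [if_neg hr]
        exact (if_neg hr).symm
  · have e := hsum fun r => poissonEntropy (genRate G (.inr r)) (W.fluidRate x (.inr r))
    refine Eq.trans (Eq.trans ?_ e) ?_
    · refine Finset.sum_congr rfl fun r _ => ?_
      simp only [genRate, Sum.elim_inr, dif_pos r.2]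
      rfl
    · refine Finset.sum_congr rfl fun r _ => ?_
      by_cases hr : r ∈ Λ
      · have h : r ∈ Λ ∪ jammed Λ := Or.inl hr
        rw [if_pos h]
        exact (if_pos hr).symm
      · refine Eq.trans ?_ (if_neg hr).symm
        split_ifs with h
        · have hj : r ∈ jammed Λ := h.resolve_left hr
          simp [genRate, h1 ⟨r, h⟩ hj, h0 r hr, fluidRate, W.serviceRate_eq_zero (hx.2 r hr),
            poissonEntropy]
        · rfl

end

/-- The rates of the constrained transitions at the states close to `n x`. -/
lemma exists_rate_near (Λ : Set W.Route) {η m : ℝ} (hη : 0 < η) (hm : 0 < m) :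
    ∃ β > 0, ∀ x : W.Route → ℝ, (∀ r, 0 ≤ x r) → (∀ r ∈ Λ, m ≤ x r) → ∀ n : ℝ, 0 < n →
      ∀ z : W.State, (∀ r ∈ Λ ∪ jammed Λ, |(z r : ℝ) - n * x r| ≤ β * n) →
        ∀ c ∈ constrained Λ, Real.exp (-η) * W.fluidRate x c ≤ W.rate z c ∧
          W.rate z c ≤ Real.exp η * W.fluidRate x c := by
  obtain ⟨β, hβ, h⟩ := W.exists_serviceRate_near Λ hη hm
  refine ⟨β, hβ, fun x hx hmx n hn z hz c hc => ?_⟩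
  rcases c with r | r
  · have h1 : Real.exp (-η) ≤ 1 := Real.exp_le_one_iff.2 (by linarith)
    have h2 : 1 ≤ Real.exp η := Real.one_le_exp hη.le
    have h3 := W.lam_nonneg r.1
    change _ * W.lam r.1 ≤ W.lam r.1 ∧ W.lam r.1 ≤ _ * W.lam r.1
    constructor <;> nlinarith
  · have hx' : ∀ r, 0 ≤ (n⁻¹ • W.toReal z) r := fun r =>
      mul_nonneg (inv_nonneg.2 hn.le) (W.toReal_nonneg z r)
    have := h x (n⁻¹ • W.toReal z) hx hx' hmx (fun r hr => by
      have h1 := hz r hr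
      have e : (n⁻¹ • W.toReal z) r - x r = n⁻¹ * ((z r : ℝ) - n * x r) := by
        simp only [Pi.smul_apply, smul_eq_mul, toReal]
        field_simp
      rw [e, abs_mul, abs_of_pos (inv_pos.2 hn), inv_mul_le_iff₀ hn]
      linarith) r (inr_mem_constrained.1 hc)
    rwa [W.serviceRate_smul (inv_pos.2 hn) (W.toReal_nonneg z)] at this

/-! ### The upper bound -/

section

variable {W} {Λ : Set W.Route} {x : W.Route → ℝ} {G : GenPair Λ} {τ δ : ℝ} {n : ℕ}

lemma norm_lt_of_mem_event {ω : W.Traj} (hE : ω ∈ event Λ x G τ δ n) {t : ℝ}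
    (ht : t ∈ Set.Icc (0 : ℝ) (n * τ)) :
    ‖W.toReal (queue t ω) - (n : ℝ) • x - t • G.2‖ < δ * n := by
  have h1 : ‖W.toReal (queue t ω) - (n : ℝ) • x - t • G.2‖ₑ < ENNReal.ofReal (δ * n) :=
    (le_iSup₂ (f := fun t (_ : t ∈ Set.Icc (0 : ℝ) (n * τ)) =>
      ‖W.toReal (queue t ω) - (n : ℝ) • x - t • G.2‖ₑ) t ht).trans_lt hE.2
  rw [← ofReal_norm] at h1
  exact (ENNReal.ofReal_lt_ofReal_iff'.1 h1).1

lemma Valid.abs_state_sub_lt {y : W.State} {ω : W.Traj} (h : W.Valid y ω)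
    (hE : ω ∈ event Λ x G τ δ n) {i : ℕ} (hi : jumpTime i ω ≤ n * τ) (r : W.Route) :
    |((ω i).2 r : ℝ) - n * x r - jumpTime i ω * G.2 r| < δ * n := by
  have h1 := norm_lt_of_mem_event hE ⟨h.jumpTime_nonneg i, hi⟩
  rw [h.queue_eq le_rfl (h.strictMono (Nat.lt_succ_self i))] at h1
  exact (norm_le_pi_norm (W.toReal (ω i).2 - (n : ℝ) • x - jumpTime i ω • G.2) r).trans_lt h1

/-- Arrivals are read from the first component of the empirical generator; departures are arrivals
minus displacement, and so carry two errors. -/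
lemma Valid.abs_count_sub_le {y : W.State} {ω : W.Traj} (h : W.Valid y ω) (hT : 0 < n * τ)
    (hδ : 0 ≤ δ) (hE : ω ∈ event Λ x G τ δ n) {K : ℕ} (hK : n * τ < jumpTime K ω)
    {c : W.Route ⊕ W.Route} (hc : c ∈ constrained Λ) :
    |count c (n * τ) K ω - n * τ * genRate G c| ≤ 2 * δ * (n * τ) := by
  set T : ℝ := n * τ
  obtain ⟨-, hd⟩ := hE.1
  rw [genDist] at hd
  have hs1 : 0 ≤ ∑ r, |(empGen Λ (n * τ) ω).1 r - G.1 r| :=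
    Finset.sum_nonneg fun _ _ => abs_nonneg _
  have hs2 : 0 ≤ ∑ r, |(empGen Λ (n * τ) ω).2 r - G.2 r| :=
    Finset.sum_nonneg fun _ _ => abs_nonneg _
  have hA : ∀ r : W.Route, r ∈ Λ ∪ jammed Λ →
      |count (.inl r) T K ω - T * genRate G (.inl r)| ≤ δ * T := by
    intro r hr
    have h1 : |(empGen Λ (n * τ) ω).1 ⟨r, hr⟩ - G.1 ⟨r, hr⟩| ≤ δ := by
      have := Finset.single_le_sum (f := fun r => |(empGen Λ (n * τ) ω).1 r - G.1 r|)
        (fun _ _ => abs_nonneg _) (Finset.mem_univ ⟨r, hr⟩)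
      linarith
    have h2 : (empGen Λ (n * τ) ω).1 ⟨r, hr⟩ = count (.inl r) T K ω / T := by
      rw [← h.arrivals_eq hT.le hK]; rfl
    have h3 : genRate G (.inl r) = G.1 ⟨r, hr⟩ := by simp only [genRate, Sum.elim_inl, dif_pos hr]
    rw [h2, ← h3] at h1
    have e : count (.inl r) T K ω - T * genRate G (.inl r) =
        (count (.inl r) T K ω / T - genRate G (.inl r)) * T := by field_simp
    rw [e, abs_mul, abs_of_pos hT]
    gcongr
  rcases c with r | r
  · refine (hA r (inl_mem_constrained.1 hc)).trans ?_
    nlinarith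
  · have hr := inr_mem_constrained.1 hc
    have h1 : |(empGen Λ (n * τ) ω).2 r - G.2 r| ≤ δ := by
      have := Finset.single_le_sum (f := fun r => |(empGen Λ (n * τ) ω).2 r - G.2 r|)
        (fun _ _ => abs_nonneg _) (Finset.mem_univ r)
      linarith
    obtain ⟨k, hk, hk1, hk2⟩ := exists_index hT.le hK
    have h2 : (empGen Λ (n * τ) ω).2 r =
        (count (.inl r) T K ω - count (.inr r) T K ω) / T := by
      change ((queue T ω r : ℝ) - queue 0 ω r) / T = _
      rw [h.queue_eq hk1 hk2, h.queue_zero, h.state_eq hk1, h.count_eq hk.le hk2,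
        h.count_eq hk.le hk2]
      ring
    rw [h2, ← genRate_inl_sub_inr hr] at h1
    have e : count (.inr r) T K ω - T * genRate G (.inr r) =
        (count (.inl r) T K ω - T * genRate G (.inl r)) -
        ((count (.inl r) T K ω - count (.inr r) T K ω) / T -
          (genRate G (.inl r) - genRate G (.inr r))) * T := by field_simp; ring
    rw [e]
    refine (abs_sub _ _).trans ?_
    rw [abs_mul, abs_of_pos hT]
    have := hA r (Or.inl hr)
    nlinarith

lemma logProb_le {y : W.State} (hT : 0 < n * τ) {a : ℝ}
    (h : W.law y (event Λ x G τ δ n) ≤ ENNReal.ofReal (Real.exp (n * τ * a))) :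
    W.logProb Λ x G τ δ n y ≤ a := by
  have h1 := ENNReal.log_monotone h
  rw [ENNReal.log_ofReal_of_pos (Real.exp_pos _), Real.log_exp] at h1
  have h2 := mul_le_mul_of_nonneg_left h1
    (EReal.coe_nonneg.2 (one_div_nonneg.2 hT.le))
  refine h2.trans (le_of_eq ?_)
  rw [← EReal.coe_mul, one_div, inv_mul_cancel_left₀ hT.ne']

lemma le_logProb {y : W.State} (hT : 0 < n * τ) {a : ℝ}
    (h : ENNReal.ofReal (Real.exp (n * τ * a)) ≤ W.law y (event Λ x G τ δ n)) :
    (a : EReal) ≤ W.logProb Λ x G τ δ n y := by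
  have h1 := ENNReal.log_monotone h
  rw [ENNReal.log_ofReal_of_pos (Real.exp_pos _), Real.log_exp] at h1
  have h2 := mul_le_mul_of_nonneg_left h1
    (EReal.coe_nonneg.2 (one_div_nonneg.2 hT.le))
  refine le_trans (le_of_eq ?_) h2
  rw [← EReal.coe_mul, one_div, inv_mul_cancel_left₀ hT.ne']

end

lemma density_one (T : ℝ) (K : ℕ) (ω : W.Traj) : W.density (fun _ _ => 1) T K ω = 1 := by
  classical
  simp [density, stepFactor, excess, weight]

/-- Non-explosion: `lintegral_density_jumpTime_le` with all weights equal to one. -/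
lemma tendsto_law_jumpTime_le [Nonempty W.Route] {T : ℝ} (hT : 0 ≤ T) (y : W.State) :
    Tendsto (fun K => W.law y {ω | jumpTime K ω ≤ T}) atTop (𝓝 0) := by
  obtain ⟨B, hB0, -, hB⟩ := W.exists_rate_le
  set B' : ℝ := ∑ _c : W.Route ⊕ W.Route, B
  have h := W.lintegral_density_jumpTime_le (v := fun _ _ => 1) (fun _ _ => zero_le_one)
    (B := B') (fun z => Finset.sum_le_sum fun c _ => by rw [mul_one]; exact hB z c) hT y
  simp only [density_one, ENNReal.ofReal_one, lintegral_one, Measure.restrict_apply_univ] at h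
  refine tendsto_of_tendsto_of_tendsto_of_le_of_le tendsto_const_nhds ?_ (fun K => zero_le) h
  rw [← ENNReal.ofReal_zero]
  refine ENNReal.tendsto_ofReal ?_
  simp only [div_eq_mul_inv, ← inv_pow]
  simpa using (tendsto_pow_atTop_nhds_zero_of_lt_one (r := (2 : ℝ)⁻¹) (by norm_num)
    (by norm_num)).const_mul (Real.exp (B' * T))

/-- Markov's inequality for a density of mean one. Paths with `K` jumps before `T` are discarded by
letting `K` tend to infinity. Measurability of `E` is not needed. -/
lemma law_le_of_le_density [Nonempty W.Route] {v : W.State → W.Route ⊕ W.Route → ℝ}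
    (hv : ∀ z c, 0 ≤ v z c) {T : ℝ} (hT : 0 ≤ T) {y : W.State} {E : Set W.Traj} {a : ℝ}
    (h : ∀ ω ∈ E, W.Valid y ω → ∀ K, T < jumpTime K ω → Real.exp (-a) ≤ W.density v T K ω) :
    W.law y E ≤ ENNReal.ofReal (Real.exp a) := by
  have hK : ∀ K, W.law y E ≤ ENNReal.ofReal (Real.exp a) +
      W.law y {ω | jumpTime K ω ≤ T} := by
    intro K
    have h1 : W.law y {ω | ENNReal.ofReal (Real.exp (-a)) ≤
        ENNReal.ofReal (W.density v T K ω)} ≤ ENNReal.ofReal (Real.exp a) := by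
      have := meas_ge_le_lintegral_div (μ := W.law y)
        (W.measurable_density v T K).ennreal_ofReal.aemeasurable
        (ε := ENNReal.ofReal (Real.exp (-a))) (by simpa using Real.exp_pos _)
        ENNReal.ofReal_ne_top
      rwa [W.lintegral_density hv, one_div, ← ENNReal.ofReal_inv_of_pos (Real.exp_pos _),
        ← Real.exp_neg, neg_neg] at this
    refine le_trans (measure_mono_ae ?_) ((measure_union_le _ _).trans (add_le_add h1 le_rfl))
    filter_upwards [W.ae_valid y] with ω hω hE
    by_cases hKT : jumpTime K ω ≤ T
    · exact Or.inr hKT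
    · exact Or.inl (ENNReal.ofReal_le_ofReal (h ω hE hω K (not_le.1 hKT)))
  have hlim := (W.tendsto_law_jumpTime_le hT y).const_add (ENNReal.ofReal (Real.exp a))
  rw [add_zero] at hlim
  exact ge_of_tendsto' hlim hK

/-- The optimal weight is `α / R`; adding `ζ` keeps it positive when `α = 0`, at cost `ζ`. The
number `e` bounds the relative fluctuation of the true rate around `R`. -/
lemma poissonEntropy_le_tilt {α R B ζ e : ℝ} (hα : 0 ≤ α) (hR : 0 < R) (hRB : R ≤ B)
    (hζ : 0 < ζ) (hζ1 : ζ ≤ 1) (he : 0 ≤ e) :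
    poissonEntropy α R - (ζ + (α + 1 + B) * e) ≤
      Real.log ((α + ζ) / R) * α -
        (((α + ζ) / R - 1) * R + |(α + ζ) / R - 1| * R * e) := by
  have h1 : α * Real.log (α / R) ≤ Real.log ((α + ζ) / R) * α := by
    rcases hα.eq_or_lt with rfl | hα'
    · simp
    · rw [mul_comm]
      gcongr
      linarith
  have h2 : ((α + ζ) / R - 1) * R = α + ζ - R := by field_simp
  have h3 : |(α + ζ) / R - 1| * R ≤ α + 1 + B := by
    rw [← abs_of_pos hR, ← abs_mul, abs_of_pos hR, h2]
    refine abs_le.2 ⟨?_, ?_⟩ <;> linarith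
  have h4 := mul_le_mul_of_nonneg_right h3 he
  rw [poissonEntropy, h2]
  linarith

/-- The upper bound of the local large deviation principle, uniformly on the points of the face
whose coordinates on `Λ` are at least `m`. -/
theorem upperRate_le [Nonempty W.Route] {Λ : Set W.Route} {G : GenPair Λ}
    (hG : G ∈ closure (calG Λ)) {m η : ℝ} (hm : 0 < m) (hη : 0 < η) :
    ∃ τ₀ > 0, ∀ τ, 0 < τ → τ < τ₀ → ∀ x ∈ facePoints Λ, (∀ r ∈ Λ, m ≤ x r) →
      ∃ δ > 0, ∃ ε > 0, W.upperRate Λ x G τ δ ε ≤ ((-W.entropy Λ G x + η : ℝ) : EReal) := by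
  classical
  obtain ⟨hGam, hD0, hA0⟩ := mem_closure_calG hG
  obtain ⟨B, hB0, hBs, -⟩ := W.exists_rate_le
  set B' : ℝ := B + ∑ r : W.Route, W.lam r.1
  have hlam : ∀ r : W.Route, W.lam r.1 ≤ ∑ r : W.Route, W.lam r.1 := fun r =>
    Finset.single_le_sum (f := fun r : W.Route => W.lam r.1) (fun r _ => W.lam_nonneg _)
      (Finset.mem_univ r)
  have hB' : ∀ x : W.Route → ℝ, (∀ r, 0 ≤ x r) → ∀ c, W.fluidRate x c ≤ B' := by
    intro x hx c
    rcases c with r | r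
    · exact (hlam r).trans (le_add_of_nonneg_left hB0)
    · exact (hBs x hx r).trans (le_add_of_nonneg_right
        (Finset.sum_nonneg fun r _ => W.lam_nonneg _))
  set J := constrained Λ
  set α := genRate G
  have hα : ∀ c, 0 ≤ α c := genRate_nonneg hGam
  have hcard : (0 : ℝ) ≤ J.card := Nat.cast_nonneg _
  set M : ℝ := ∑ c ∈ J, (α c + 1 + B')
  -- One third of `η` pays for replacing the true rates by `R`, one for `ζ`, one for the tolerance
  -- `δ` on the counts.
  obtain ⟨η₁, hη₁, hη₁M⟩ : ∃ η₁ > 0, M * (Real.exp η₁ - 1) ≤ η / 3 := by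
    have hc : Tendsto (fun t : ℝ => M * (Real.exp t - 1)) (𝓝[>] 0) (𝓝 0) := by
      have : Continuous fun t : ℝ => M * (Real.exp t - 1) := by fun_prop
      simpa using (this.tendsto 0).mono_left nhdsWithin_le_nhds
    obtain ⟨t, ht, ht0⟩ := ((hc.eventually (gt_mem_nhds (show (0 : ℝ) < η / 3 by positivity))).and
      self_mem_nhdsWithin).exists
    exact ⟨t, ht0, ht.le⟩
  obtain ⟨β, hβ, hnear⟩ := W.exists_rate_near Λ hη₁ hm
  have hζ0 : 0 < min 1 (η / 3 / (J.card + 1)) := by positivity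
  set ζ := min 1 (η / 3 / (J.card + 1))
  have hζJ : J.card * ζ ≤ η / 3 := by
    have h1 : ζ ≤ η / 3 / (J.card + 1) := min_le_right _ _
    rw [le_div_iff₀ (by positivity)] at h1
    linarith
  set Dn := ‖G.2‖
  -- During `n τ` the line `n x + t D` moves by at most `n β / 2`; the other half of `β` is left for
  -- `δ`.
  refine ⟨β / (2 * (Dn + 1)), by positivity, fun τ hτ hττ x hx hmx => ?_⟩
  have hx0 : ∀ r, 0 ≤ x r := fun r => by
    by_cases hr : r ∈ Λ
    · exact (hx.1 r hr).le
    · exact (hx.2 r hr).ge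
  have hτD : τ * Dn ≤ β / 2 := by
    rw [lt_div_iff₀ (by positivity)] at hττ
    nlinarith
  set R := W.fluidRate x
  have hR : ∀ c ∈ J, 0 < R c := fun c hc => fluidRate_pos hx0 hx.1 hc
  set b : W.Route ⊕ W.Route → ℝ := fun c => (α c + ζ) / R c
  have hb : ∀ c ∈ J, 0 < b c := fun c hc => div_pos (by linarith [hα c]) (hR c hc)
  -- This sum depends on `x`, hence so does `δ`; uniformity is only required of the bound on `τ`.
  set Lb : ℝ := ∑ c ∈ J, |Real.log (b c)|
  have hLb : 0 ≤ Lb := Finset.sum_nonneg fun _ _ => abs_nonneg _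
  set δ := min (β / 2) (η / 6 / (Lb + 1))
  have hδ : 0 < δ := by positivity
  have hδL : 2 * δ * Lb ≤ η / 3 := by
    have h1 : δ ≤ η / 6 / (Lb + 1) := min_le_right _ _
    rw [le_div_iff₀ (by positivity)] at h1
    nlinarith
  -- Any `ε` works, because the event itself confines the path, its starting point included.
  refine ⟨δ, hδ, 1, one_pos, ?_⟩
  rw [upperRate]
  refine limsup_le_of_le (by isBoundedDefault) ?_
  filter_upwards [eventually_gt_atTop 0] with n hn
  refine iSup₂_le fun y _ => ?_
  have hn' : (0 : ℝ) < n := Nat.cast_pos.2 hn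
  have hT : 0 < n * τ := by positivity
  refine logProb_le hT ?_
  set g : W.Route ⊕ W.Route → ℝ := fun c => if c ∈ J then Real.log (b c) else 0
  have hexp : ∀ c ∈ J, Real.exp (g c) = b c := fun c hc => by
    simp only [g, if_pos hc, Real.exp_log (hb c hc)]
  refine W.law_le_of_le_density (v := fun _ c => Real.exp (g c))
    (fun _ _ => (Real.exp_pos _).le) hT.le fun ω hE hω K hK => ?_
  set T : ℝ := n * τ
  set e₁ := Real.exp η₁ - 1
  have he₁ : 0 ≤ e₁ := sub_nonneg.2 (Real.one_le_exp hη₁.le)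
  set e := -∑ c ∈ J, ((b c - 1) * R c + |b c - 1| * R c * e₁)
  have hstate : ∀ i < K, jumpTime i ω ≤ T →
      (∀ c, Real.exp (g c) ≤ Real.exp (g c)) ∧
        e ≤ -W.excess (fun _ c => Real.exp (g c)) (ω i).2 := by
    intro i _ hi
    refine ⟨fun _ => le_rfl, neg_le_neg ?_⟩
    have hz : ∀ r ∈ Λ ∪ jammed Λ, |((ω i).2 r : ℝ) - n * x r| ≤ β * n := by
      intro r _
      have h1 := (hω.abs_state_sub_lt hE hi r).le
      have h2 : |jumpTime i ω * G.2 r| ≤ T * Dn := by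
        rw [abs_mul, abs_of_nonneg (hω.jumpTime_nonneg i)]
        gcongr
        exact norm_le_pi_norm G.2 r
      have h3 : δ ≤ β / 2 := min_le_left _ _
      calc |((ω i).2 r : ℝ) - n * x r|
          = |(((ω i).2 r : ℝ) - n * x r - jumpTime i ω * G.2 r) + jumpTime i ω * G.2 r| := by
            rw [sub_add_cancel]
        _ ≤ δ * n + T * Dn := (abs_add_le _ _).trans (add_le_add h1 h2)
        _ = (δ + τ * Dn) * n := by simp only [T]; ring
        _ ≤ β * n := by gcongr; linarith
    have hrate := hnear x hx0 hmx n hn' (ω i).2 hz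
    -- Unconstrained transitions have weight one and do not contribute.
    have hexc : W.excess (fun _ c => Real.exp (g c)) (ω i).2 =
        ∑ c ∈ J, W.rate (ω i).2 c * (b c - 1) := by
      rw [excess, ← Finset.sum_subset (Finset.subset_univ J)]
      · exact Finset.sum_congr rfl fun c hc => by rw [hexp c hc]
      · intro c _ hc
        simp [g, hc]
    rw [hexc]
    refine Finset.sum_le_sum fun c hc => ?_
    obtain ⟨h1, h2⟩ := hrate c hc
    have h3 : |W.rate (ω i).2 c - R c| ≤ R c * e₁ := by
      have hRc := hR c hc
      have h4 : 2 ≤ Real.exp (-η₁) + Real.exp η₁ := by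
        have := Real.add_one_le_exp η₁
        have := Real.add_one_le_exp (-η₁)
        linarith
      refine abs_le.2 ⟨?_, ?_⟩
      · simp only [e₁]
        nlinarith
      · simp only [e₁]
        nlinarith
    calc W.rate (ω i).2 c * (b c - 1)
        = (b c - 1) * R c + (W.rate (ω i).2 c - R c) * (b c - 1) := by ring
      _ ≤ (b c - 1) * R c + |W.rate (ω i).2 c - R c| * |b c - 1| := by
          rw [← abs_mul]
          gcongr
          exact le_abs_self _
      _ ≤ (b c - 1) * R c + R c * e₁ * |b c - 1| := by gcongr
      _ = _ := by ring
  refine le_trans (Real.exp_le_exp.2 ?_) (hω.le_density hT.le hstate)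
  rw [clock, min_eq_right hK.le]
  have hcount : ∑ c ∈ J, (Real.log (b c) * α c * T - |Real.log (b c)| * (2 * δ * T)) ≤
      ∑ c, g c * count c T K ω := by
    rw [← Finset.sum_subset (Finset.subset_univ J) (f := fun c => g c * count c T K ω)]
    · refine Finset.sum_le_sum fun c hc => ?_
      have h1 := hω.abs_count_sub_le hT hδ.le hE hK hc
      simp only [g, if_pos hc]
      have h2 : -(|Real.log (b c)| * (2 * δ * T)) ≤
          Real.log (b c) * (count c T K ω - T * α c) := by
        refine neg_le_of_neg_le ?_
        refine (neg_le_abs _).trans ?_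
        rw [abs_mul]
        gcongr
      linarith
    · intro c _ hc
      simp [g, hc]
  refine le_trans ?_ (add_le_add hcount le_rfl)
  have hsum : ∑ c ∈ J, (poissonEntropy (α c) (R c) - (ζ + (α c + 1 + B') * e₁)) ≤
      ∑ c ∈ J, (Real.log (b c) * α c - ((b c - 1) * R c + |b c - 1| * R c * e₁)) :=
    Finset.sum_le_sum fun c hc => poissonEntropy_le_tilt (hα c) (hR c hc) (hB' x hx0 c) hζ0
      (min_le_left _ _) he₁
  have hH : W.entropy Λ G x = ∑ c ∈ J, poissonEntropy (α c) (R c) := entropy_eq_sum hD0 hA0 hx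
  rw [Finset.sum_sub_distrib, ← hH, Finset.sum_add_distrib, ← Finset.sum_mul, Finset.sum_const,
    nsmul_eq_mul, Finset.sum_sub_distrib] at hsum
  rw [Finset.sum_sub_distrib, ← Finset.sum_mul, ← Finset.sum_mul]
  simp only [e]
  change _ ≤ _ - Lb * (2 * δ * T) + _
  have hfin : W.entropy Λ G x - η ≤ ∑ c ∈ J, Real.log (b c) * α c - Lb * (2 * δ) -
      ∑ c ∈ J, ((b c - 1) * R c + |b c - 1| * R c * e₁) := by
    have : Lb * (2 * δ) ≤ η / 3 := by linarith
    have : M * e₁ ≤ η / 3 := hη₁M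
    linarith
  have := mul_le_mul_of_nonneg_left hfin hT.le
  linarith

/-! ### A Lyapunov function for the routes away from the face -/

/-- The work `ρ_r = λ_r / μ_r` brought by route `r` per unit time. -/
def traffic (r : W.Route) : ℝ := W.lam r.1 / W.mu r.1

lemma traffic_pos (r : W.Route) : 0 < W.traffic r := div_pos r.2.2 (W.mu_pos _)

open Classical in
/-- The exponential of the Lyapunov function `lyap`. -/
def expLyap (Λ : Set W.Route) (t p : ℝ) (z : W.State) : ℝ :=
  Real.exp (2 * t * p) +
    ∑ r : W.Route, if r ∈ Λ ∪ jammed Λ then 0 else Real.exp (t * (z r / W.traffic r))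

/-- A smooth version of the maximum of `2 p` and of `z_r / ρ_r` for `r` not in `Λ ∪ Λ₁`. -/
def lyap (Λ : Set W.Route) (t p : ℝ) (z : W.State) : ℝ := Real.log (W.expLyap Λ t p z)

lemma expLyap_pos (Λ : Set W.Route) (t p : ℝ) (z : W.State) : 0 < W.expLyap Λ t p z :=
  add_pos_of_pos_of_nonneg (Real.exp_pos _) (Finset.sum_nonneg fun r _ => by
    split_ifs
    · exact le_rfl
    · exact (Real.exp_pos _).le)

lemma exp_two_mul_le_expLyap (Λ : Set W.Route) (t p : ℝ) (z : W.State) :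
    Real.exp (2 * t * p) ≤ W.expLyap Λ t p z :=
  le_add_of_nonneg_right (Finset.sum_nonneg fun r _ => by
    split_ifs
    · exact le_rfl
    · exact (Real.exp_pos _).le)

lemma exp_le_expLyap {Λ : Set W.Route} (t p : ℝ) (z : W.State) {r : W.Route}
    (hr : r ∉ Λ ∪ jammed Λ) : Real.exp (t * (z r / W.traffic r)) ≤ W.expLyap Λ t p z := by
  classical
  have := Finset.single_le_sum (f := fun r : W.Route => if r ∈ Λ ∪ jammed Λ then 0 else
    Real.exp (t * (z r / W.traffic r))) (fun r _ => by
      split_ifs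
      · exact le_rfl
      · exact (Real.exp_pos _).le) (Finset.mem_univ r)
  rw [if_neg hr] at this
  refine this.trans ?_
  rw [expLyap]
  exact le_add_of_nonneg_left (Real.exp_pos _).le

/-- The logarithm of a sum of exponentials exceeds their largest exponent by at most the logarithm
of the number of terms. -/
lemma lyap_le {Λ : Set W.Route} {t p : ℝ} (ht : 0 ≤ t) {z : W.State}
    (hz : ∀ r ∉ Λ ∪ jammed Λ, (z r : ℝ) ≤ 2 * p * W.traffic r) :
    W.lyap Λ t p z ≤ Real.log (1 + Fintype.card W.Route) + 2 * t * p := by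
  classical
  have h1 : W.expLyap Λ t p z ≤ (1 + Fintype.card W.Route) * Real.exp (2 * t * p) := by
    rw [expLyap, add_mul, one_mul]
    refine add_le_add le_rfl ?_
    rw [← nsmul_eq_mul, ← Finset.card_univ, ← Finset.sum_const]
    refine Finset.sum_le_sum fun r _ => ?_
    split_ifs with h
    · exact (Real.exp_pos _).le
    · rw [Real.exp_le_exp, mul_comm 2 t, mul_assoc]
      gcongr
      rw [div_le_iff₀ (W.traffic_pos r)]
      exact hz r h
  rw [lyap]
  refine (Real.log_le_log (W.expLyap_pos Λ t p z) h1).trans ?_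
  rw [Real.log_mul (by positivity) (Real.exp_pos _).ne', Real.log_exp]

lemma le_lyap {Λ : Set W.Route} (t p : ℝ) (z : W.State) {r : W.Route}
    (hr : r ∉ Λ ∪ jammed Λ) : t * (z r / W.traffic r) ≤ W.lyap Λ t p z := by
  rw [lyap, Real.le_log_iff_exp_le (W.expLyap_pos Λ t p z)]
  exact W.exp_le_expLyap t p z hr

-- The links of a route away from the face carry only routes of `Λ₁` and other free routes, never
-- the long queues of `Λ`.
variable {W} in
lemma notMem_of_mem_link {Λ : Set W.Route} {r s : W.Route} (hr : r ∉ Λ ∪ jammed Λ) {i : S}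
    (hi : i ∈ r.1) (hs : i ∈ s.1) : s ∉ Λ := fun h =>
  hr (mem_union_jammed h hs hi)

open Classical in
/-- A route away from the face which carries nearly the largest normalized number of connections
is served faster than it is fed. -/
lemma lam_le_serviceRate {Λ : Set W.Route} {κ : ℝ} (hκ1 : κ < 1) (hκ0 : 0 < κ)
    (hload : ∀ i, ∑ r : W.Route, (if i ∈ r.1 then W.traffic r else 0) ≤ W.cap i * (1 - κ) ^ 2)
    {p : ℝ} {z : W.State} (hj : ∀ s ∈ jammed Λ, (z s : ℝ) ≤ W.traffic s * p) {r : W.Route}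
    (hr : r ∉ Λ ∪ jammed Λ) (hpos : 0 < (z r : ℝ)) (hp : p ≤ z r / W.traffic r)
    (hmax : ∀ s ∉ Λ ∪ jammed Λ, (1 - κ) * (z s / W.traffic s) ≤ z r / W.traffic r) :
    W.lam r.1 ≤ (1 - κ) * W.serviceRate (W.toReal z) r := by
  set M := (z r : ℝ) / W.traffic r
  have hM : 0 < M := div_pos hpos (W.traffic_pos r)
  have hκ : 0 < 1 - κ := sub_pos.2 hκ1
  -- Every route met on a link of `r` has normalized length at most `M / (1 - κ)`: by `hj` and `p ≤
  -- M` on `Λ₁`, by near-maximality of `r` otherwise.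
  have hs : ∀ i ∈ r.1, ∀ s : W.Route, i ∈ s.1 → (z s : ℝ) ≤ W.traffic s * (M / (1 - κ)) := by
    intro i hi s his
    have hsΛ := notMem_of_mem_link hr hi his
    have hts := W.traffic_pos s
    by_cases h : s ∈ jammed Λ
    · refine (hj s h).trans ?_
      gcongr
      rw [le_div_iff₀ hκ]
      nlinarith
    · have := hmax s (by simp [hsΛ, h])
      rw [mul_div_assoc', div_le_iff₀ hts] at this
      rw [mul_div_assoc', le_div_iff₀ hκ]
      linarith
  -- Of the slack `(1 - κ) ^ 2`, one factor compensates near-maximality and the other is the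
  -- remaining service margin.
  have hl : ∀ i ∈ r.1, 1 / (M * (1 - κ)) ≤ W.cap i / W.load (W.toReal z) i := by
    intro i hi
    have hl0 : 0 < W.load (W.toReal z) i :=
      hpos.trans_le (W.le_load (x := W.toReal z) (W.toReal_nonneg z) hi)
    rw [div_le_div_iff₀ (by positivity) hl0, one_mul]
    calc W.load (W.toReal z) i
        ≤ ∑ s : W.Route, (if i ∈ s.1 then W.traffic s else 0) * (M / (1 - κ)) := by
          refine Finset.sum_le_sum fun s _ => ?_
          split_ifs with h
          · exact hs i hi s h
          · simp
      _ ≤ W.cap i * (1 - κ) ^ 2 * (M / (1 - κ)) := by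
          rw [← Finset.sum_mul]
          exact mul_le_mul_of_nonneg_right (hload i) (by positivity)
      _ = W.cap i * (M * (1 - κ)) := by field_simp
  have h1 := W.le_serviceRate (W.toReal_nonneg z) hl
  have h2 : W.mu r.1 * (W.toReal z r * (1 / (M * (1 - κ)))) = W.lam r.1 / (1 - κ) := by
    have e : W.toReal z r = M * W.traffic r := by
      simp only [M, toReal]
      rw [div_mul_cancel₀ _ (W.traffic_pos r).ne']
    have h3 : W.mu r.1 * W.traffic r = W.lam r.1 := mul_div_cancel₀ _ (W.mu_pos _).ne'
    rw [e, ← h3]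
    field_simp
  rw [h2, div_le_iff₀ hκ] at h1
  linarith

/-- Under ergodicity, `lyap` has a negligible drift when the routes of `Λ₁` are nearly empty. -/
theorem exists_lyap_drift_le (hW : W.Ergodic) (Λ : Set W.Route) :
    ∃ t > 0, ∃ κ > 0, ∃ K ≥ 0, ∀ p : ℝ, 0 ≤ p → ∀ (v : W.State → W.Route ⊕ W.Route → ℝ)
      (z : W.State), (∀ r ∉ Λ ∪ jammed Λ, v z (.inl r) = 1 ∧ v z (.inr r) = 1) →
      (∀ s ∈ jammed Λ, (z s : ℝ) ≤ W.traffic s * p) →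
      ∑ c, W.rate z c * v z c * (Real.exp (W.lyap Λ t p (W.target z c) - W.lyap Λ t p z) - 1) ≤
        K * Real.exp (-(κ * p)) := by
  classical
  -- The only use of ergodicity: strict inequality of traffic and capacity at finitely many links
  -- leaves a common slack.
  obtain ⟨κ, ⟨hκload, hκ1⟩, hκ0⟩ : ∃ κ : ℝ, ((∀ i, ∑ r : W.Route,
      (if i ∈ r.1 then W.traffic r else 0) ≤ W.cap i * (1 - κ) ^ 2) ∧ κ < 1) ∧ 0 < κ := by
    have h1 : ∀ i, ∀ᶠ κ in 𝓝[>] (0 : ℝ), ∑ r : W.Route,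
        (if i ∈ r.1 then W.traffic r else 0) ≤ W.cap i * (1 - κ) ^ 2 := by
      intro i
      have hc : Tendsto (fun κ : ℝ => W.cap i * (1 - κ) ^ 2) (𝓝[>] 0) (𝓝 (W.cap i)) := by
        have : Continuous fun κ : ℝ => W.cap i * (1 - κ) ^ 2 := by fun_prop
        simpa using (this.tendsto 0).mono_left nhdsWithin_le_nhds
      have := hc.eventually (lt_mem_nhds (Ergodic.sum_lam_div_mu_lt W hW i))
      filter_upwards [this] with κ hκ
      exact hκ.le
    have h2 : ∀ᶠ κ in 𝓝[>] (0 : ℝ), κ < 1 :=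
      nhdsWithin_le_nhds (gt_mem_nhds one_pos)
    exact (((eventually_all.2 h1).and h2).and self_mem_nhdsWithin).exists
  have hκ' : 0 < 1 - κ := sub_pos.2 hκ1
  -- For small `t` the discrete jumps of the exponential do not use up the margin between service
  -- and arrival.
  obtain ⟨t, htr, ht⟩ : ∃ t : ℝ, (∀ r : W.Route,
      Real.exp (t / W.traffic r) * (1 - κ) ≤ 1) ∧ 0 < t := by
    have h1 : ∀ r : W.Route, ∀ᶠ t in 𝓝[>] (0 : ℝ),
        Real.exp (t / W.traffic r) * (1 - κ) ≤ 1 := by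
      intro r
      have hc : Tendsto (fun t : ℝ => Real.exp (t / W.traffic r) * (1 - κ)) (𝓝[>] 0)
          (𝓝 (1 - κ)) := by
        have : Continuous fun t : ℝ => Real.exp (t / W.traffic r) * (1 - κ) := by fun_prop
        simpa using (this.tendsto 0).mono_left nhdsWithin_le_nhds
      filter_upwards [hc.eventually (gt_mem_nhds (show 1 - κ < 1 by linarith))] with t h
      exact h.le
    exact ((eventually_all.2 h1).and self_mem_nhdsWithin).exists
  have ha : ∀ r : W.Route, 0 ≤ W.lam r.1 * (Real.exp (t / W.traffic r) - 1) := fun r =>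
    mul_nonneg (W.lam_nonneg _) (sub_nonneg.2
      (Real.one_le_exp (div_nonneg ht.le (W.traffic_pos r).le)))
  refine ⟨t, ht, t * κ, by positivity,
    ∑ r : W.Route, W.lam r.1 * (Real.exp (t / W.traffic r) - 1),
    Finset.sum_nonneg fun r _ => ha r, fun p hp v z hv hj => ?_⟩
  set Φ := W.expLyap Λ t p
  have hΦ : ∀ z, 0 < Φ z := W.expLyap_pos Λ t p
  have hexp : ∀ z', Real.exp (W.lyap Λ t p z' - W.lyap Λ t p z) - 1 = (Φ z' - Φ z) / Φ z := by
    intro z'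
    rw [Real.exp_sub, lyap, lyap, Real.exp_log (hΦ z'), Real.exp_log (hΦ z), sub_div,
      div_self (hΦ z).ne']
  simp only [hexp]
  set φ : W.Route → ℝ := fun r => Real.exp (t * (z r / W.traffic r))
  have hΦdiff : ∀ (z' : W.State) (r : W.Route), (∀ s ≠ r, z' s = z s) → Φ z' - Φ z =
      if r ∈ Λ ∪ jammed Λ then 0 else Real.exp (t * (z' r / W.traffic r)) - φ r := by
    intro z' r h
    simp only [Φ, expLyap, φ]
    rw [add_sub_add_left_eq_sub, ← Finset.sum_sub_distrib, Finset.sum_eq_single r]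
    · split_ifs <;> simp
    · intro s _ hs
      rw [h s hs]; simp
    · simp
  have hup : ∀ r, Φ (W.target z (.inl r)) - Φ z =
      if r ∈ Λ ∪ jammed Λ then 0 else φ r * (Real.exp (t / W.traffic r) - 1) := by
    intro r
    rw [hΦdiff _ r fun s hs => by simp [target, hs]]
    split_ifs
    · rfl
    · simp only [target, Pi.add_apply, Pi.single_eq_same, φ, Nat.cast_add, Nat.cast_one]
      rw [mul_sub, mul_one, ← Real.exp_add]
      congr 2
      ring
  have hdown : ∀ r, W.rate z (.inr r) * (Φ (W.target z (.inr r)) - Φ z) =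
      if r ∈ Λ ∪ jammed Λ then 0 else
        W.rate z (.inr r) * (φ r * (Real.exp (-(t / W.traffic r)) - 1)) := by
    intro r
    rw [hΦdiff _ r fun s hs => by simp [target, hs]]
    split_ifs
    · simp
    · by_cases h0 : z r = 0
      · have : W.rate z (.inr r) = 0 := W.serviceRate_eq_zero (by simp [toReal, h0])
        rw [this, zero_mul, zero_mul]
      · simp only [target, Pi.sub_apply, Pi.single_eq_same, φ]
        rw [Nat.cast_sub (by omega), mul_sub (Real.exp _) _ 1, mul_one, ← Real.exp_add]
        congr 3
        push_cast
        ring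
  have hroute : ∀ r, W.rate z (.inl r) * v z (.inl r) * ((Φ (W.target z (.inl r)) - Φ z) / Φ z) +
      W.rate z (.inr r) * v z (.inr r) * ((Φ (W.target z (.inr r)) - Φ z) / Φ z) ≤
      W.lam r.1 * (Real.exp (t / W.traffic r) - 1) * Real.exp (-(t * κ * p)) := by
    intro r
    have e1 : W.rate z (.inl r) * v z (.inl r) * ((Φ (W.target z (.inl r)) - Φ z) / Φ z) +
        W.rate z (.inr r) * v z (.inr r) * ((Φ (W.target z (.inr r)) - Φ z) / Φ z) =
        (v z (.inl r) * (W.rate z (.inl r) * (Φ (W.target z (.inl r)) - Φ z)) +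
          v z (.inr r) * (W.rate z (.inr r) * (Φ (W.target z (.inr r)) - Φ z))) / Φ z := by
      ring
    rw [e1, hdown, hup]
    by_cases hr : r ∈ Λ ∪ jammed Λ
    · simp only [if_pos hr, mul_zero, add_zero, zero_div]
      exact mul_nonneg (ha r) (Real.exp_pos _).le
    simp only [if_neg hr]
    rw [(hv r hr).1, (hv r hr).2, one_mul, one_mul, div_le_iff₀ (hΦ z)]
    change W.lam r.1 * _ + W.serviceRate (W.toReal z) r * _ ≤ _
    set a := t / W.traffic r
    have ha0 : 0 < a := div_pos ht (W.traffic_pos r)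
    have hea : Real.exp (-a) ≤ 1 := Real.exp_le_one_iff.2 (by linarith)
    have hφ : 0 < φ r := Real.exp_pos _
    have hsr := W.serviceRate_nonneg (W.toReal_nonneg z) r
    -- Either `r` is above `p` and nearly maximal, and its drift is nonpositive, or its term is
    -- negligible in `Φ z` and only its arrivals are paid for.
    by_cases hbig : p < z r / W.traffic r ∧ ∀ s ∉ Λ ∪ jammed Λ,
        (1 - κ) * (z s / W.traffic s) ≤ z r / W.traffic r
    · have hzr : 0 < (z r : ℝ) := by
        have := hp.trans_lt hbig.1
        rwa [lt_div_iff₀ (W.traffic_pos r), zero_mul] at this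
      have h1 := W.lam_le_serviceRate hκ1 hκ0 hκload hj hr hzr hbig.1.le hbig.2
      have h2 : W.lam r.1 * Real.exp a ≤ W.serviceRate (W.toReal z) r := by
        calc W.lam r.1 * Real.exp a ≤ (1 - κ) * W.serviceRate (W.toReal z) r * Real.exp a := by
              gcongr
          _ = (Real.exp a * (1 - κ)) * W.serviceRate (W.toReal z) r := by ring
          _ ≤ 1 * W.serviceRate (W.toReal z) r := by gcongr; exact htr r
          _ = _ := one_mul _
      have h3 : W.lam r.1 * (φ r * (Real.exp a - 1)) +
          W.serviceRate (W.toReal z) r * (φ r * (Real.exp (-a) - 1)) =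
          φ r * (1 - Real.exp (-a)) * (W.lam r.1 * Real.exp a - W.serviceRate (W.toReal z) r) := by
        have : Real.exp (-a) * Real.exp a = 1 := by rw [← Real.exp_add]; simp
        linear_combination (φ r * W.lam r.1) * this
      rw [h3]
      refine le_trans (mul_nonpos_of_nonneg_of_nonpos
        (mul_nonneg hφ.le (sub_nonneg.2 hea)) (sub_nonpos.2 h2)) ?_
      exact mul_nonneg (mul_nonneg (ha r) (Real.exp_pos _).le) (hΦ z).le
    -- Below `p`, the floor `exp (2 t p)` dominates. Otherwise a longer route `s` dominates, with a
    -- gap of at least `κ * p` in normalized length.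
    · have hsmall : φ r ≤ Real.exp (-(t * κ * p)) * Φ z := by
        by_cases hrp : z r / W.traffic r ≤ p
        · calc φ r ≤ Real.exp (t * p) := Real.exp_le_exp.2 (by gcongr)
            _ ≤ Real.exp (-(t * κ * p)) * Real.exp (2 * t * p) := by
                rw [← Real.exp_add, Real.exp_le_exp]
                have : 0 ≤ (t * p) * (1 - κ) := by positivity
                linarith
            _ ≤ _ := by
                gcongr
                exact W.exp_two_mul_le_expLyap Λ t p z
        · push Not at hbig hrp
          obtain ⟨s, hs, hs'⟩ := hbig hrp
          have h1 : p ≤ z s / W.traffic s := by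
            have : 0 ≤ (z s : ℝ) / W.traffic s :=
              div_nonneg (Nat.cast_nonneg _) (W.traffic_pos s).le
            nlinarith
          calc φ r ≤ Real.exp (t * ((1 - κ) * (z s / W.traffic s))) :=
                Real.exp_le_exp.2 (by gcongr)
            _ ≤ Real.exp (-(t * κ * p)) * Real.exp (t * (z s / W.traffic s)) := by
                rw [← Real.exp_add, Real.exp_le_exp]
                have : 0 ≤ (t * κ) * (z s / W.traffic s - p) :=
                  mul_nonneg (by positivity) (by linarith)
                linarith
            _ ≤ _ := by
                gcongr
                exact W.exp_le_expLyap t p z hs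
      have h4 : W.serviceRate (W.toReal z) r * (φ r * (Real.exp (-a) - 1)) ≤ 0 :=
        mul_nonpos_of_nonneg_of_nonpos hsr
          (mul_nonpos_of_nonneg_of_nonpos hφ.le (by linarith))
      have h5 := mul_le_mul_of_nonneg_left hsmall (ha r)
      linarith
  rw [Fintype.sum_sum_type, ← Finset.sum_add_distrib, Finset.sum_mul]
  exact Finset.sum_le_sum fun r _ => hroute r

/-! ### Tools for the lower bound -/

/-- Under the probability of density `density v T K`, the paths where some ratio reaches its level
have mass at most `1 / 4`, as do those with `K` jumps before `T`. The other half of the mass lies on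
`E`, where the density is at most `exp a`. -/
lemma le_law_of_density_le [Nonempty W.Route] {ι : Type*} [Fintype ι]
    {v : W.State → W.Route ⊕ W.Route → ℝ} (hv : ∀ z c, 0 ≤ v z c) {B : ℝ}
    (hB : ∀ z, ∑ c, W.rate z c * v z c ≤ B) {T : ℝ} (hT : 0 ≤ T) {y : W.State}
    {v' : ι → W.State → W.Route ⊕ W.Route → ℝ} (hv' : ∀ i z c, 0 ≤ v' i z c) {l : ι → ℝ}
    (hl : ∀ i, 0 < l i) (hl4 : ∑ i, 1 / l i ≤ 1 / 4) {K : ℕ}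
    (hK : Real.exp (B * T) / 2 ^ K ≤ 1 / 4) {E : Set W.Traj} {a : ℝ}
    (h : ∀ ω, W.Valid y ω → T < jumpTime K ω →
      (∀ i, ∀ k ≤ K, W.density (v' i) T k ω < l i * W.density v T k ω) →
        ω ∈ E ∧ W.density v T K ω ≤ Real.exp a) :
    ENNReal.ofReal (Real.exp (-a) / 2) ≤ W.law y E := by
  set μ := W.law y
  set f : W.Traj → ℝ≥0∞ := fun ω => ENNReal.ofReal (W.density v T K ω)
  have hf : Measurable f := (W.measurable_density v T K).ennreal_ofReal
  -- A measurable hull, since `E` is not assumed measurable.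
  set A : Set W.Traj := toMeasurable μ E ∩ {ω | W.density v T K ω ≤ Real.exp a}
  have hA : MeasurableSet A := (measurableSet_toMeasurable _ _).inter
    (measurableSet_le (W.measurable_density v T K) measurable_const)
  set C : ι → Set W.Traj := fun i =>
    {ω | ∃ k ≤ K, l i * W.density v T k ω ≤ W.density (v' i) T k ω}
  set D : Set W.Traj := {ω | jumpTime K ω ≤ T}
  have hcover : ∀ᵐ ω ∂μ, ω ∈ A ∪ ((⋃ i, C i) ∪ D) := by
    filter_upwards [W.ae_valid y] with ω hω
    by_cases hD : jumpTime K ω ≤ T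
    · exact Or.inr (Or.inr hD)
    by_cases hC : ω ∈ ⋃ i, C i
    · exact Or.inr (Or.inl hC)
    · left
      have := h ω hω (not_le.1 hD) fun i k hk => by
        by_contra hcon
        exact hC (Set.mem_iUnion.2 ⟨i, k, hk, not_lt.1 hcon⟩)
      exact ⟨subset_toMeasurable _ _ this.1, this.2⟩
  have h1 : (1 : ℝ≥0∞) ≤ ∫⁻ ω in A, f ω ∂μ + ENNReal.ofReal (1 / 2) := by
    calc (1 : ℝ≥0∞) = ∫⁻ ω, f ω ∂μ := (W.lintegral_density hv T y K).symm
      _ = ∫⁻ ω in A ∪ ((⋃ i, C i) ∪ D), f ω ∂μ := by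
          rw [Measure.restrict_eq_self_of_ae_mem hcover]
      _ ≤ ∫⁻ ω in A, f ω ∂μ + (∫⁻ ω in ⋃ i, C i, f ω ∂μ + ∫⁻ ω in D, f ω ∂μ) :=
          (lintegral_union_le _ _ _).trans (add_le_add le_rfl (lintegral_union_le _ _ _))
      _ ≤ ∫⁻ ω in A, f ω ∂μ + (ENNReal.ofReal (1 / 4) + ENNReal.ofReal (1 / 4)) := by
          refine add_le_add le_rfl (add_le_add ?_ ?_)
          · refine (lintegral_iUnion_le _ _).trans ?_
            rw [tsum_fintype]
            refine (Finset.sum_le_sum fun i _ =>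
              W.lintegral_density_maximal hv (hv' i) T y K (hl i)).trans ?_
            rw [← ENNReal.ofReal_sum_of_nonneg fun i _ => one_div_nonneg.2 (hl i).le]
            exact ENNReal.ofReal_le_ofReal hl4
          · exact (W.lintegral_density_jumpTime_le hv hB hT y K).trans
              (ENNReal.ofReal_le_ofReal hK)
      _ = _ := by
          rw [← ENNReal.ofReal_add (by norm_num) (by norm_num)]
          norm_num
  have h2 : ∫⁻ ω in A, f ω ∂μ ≤ ENNReal.ofReal (Real.exp a) * μ E := by
    calc ∫⁻ ω in A, f ω ∂μ ≤ ∫⁻ _ω in A, ENNReal.ofReal (Real.exp a) ∂μ :=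
          setLIntegral_mono' hA fun ω hω => ENNReal.ofReal_le_ofReal hω.2
      _ = ENNReal.ofReal (Real.exp a) * μ A := by
          rw [lintegral_const, Measure.restrict_apply_univ]
      _ ≤ ENNReal.ofReal (Real.exp a) * μ E := by
          refine mul_le_mul' le_rfl ?_
          exact (measure_mono Set.inter_subset_left).trans (measure_toMeasurable E).le
  have h3 : ENNReal.ofReal (1 / 2) ≤ ENNReal.ofReal (Real.exp a) * μ E := by
    refine le_trans ?_ h2
    have h4 : ENNReal.ofReal (1 / 2) + ENNReal.ofReal (1 / 2) ≤
        ∫⁻ ω in A, f ω ∂μ + ENNReal.ofReal (1 / 2) := by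
      rw [← ENNReal.ofReal_add (by norm_num) (by norm_num)]
      norm_num at h1 ⊢
      exact h1
    exact (ENNReal.add_le_add_iff_right ENNReal.ofReal_ne_top).1 h4
  calc ENNReal.ofReal (Real.exp (-a) / 2)
      = ENNReal.ofReal (Real.exp (-a)) * ENNReal.ofReal (1 / 2) := by
        rw [← ENNReal.ofReal_mul (Real.exp_pos _).le]
        congr 1
        ring
    _ ≤ ENNReal.ofReal (Real.exp (-a)) * (ENNReal.ofReal (Real.exp a) * μ E) := by gcongr
    _ = μ E := by
        rw [← mul_assoc, ← ENNReal.ofReal_mul (Real.exp_pos _).le, ← Real.exp_add]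
        simp

variable {W} in
/-- The states near `n x` in the directions of `Λ` and nearly empty in those of `Λ₁`. -/
def tube (Λ : Set W.Route) (x : W.Route → ℝ) (n β γ : ℝ) : Set W.State :=
  {z | (∀ r ∈ Λ, |(z r : ℝ) - n * x r| ≤ β * n) ∧ ∀ r ∈ jammed Λ, (z r : ℝ) ≤ γ * n}

open Classical in
/-- The weights that give the rates `a` to the constrained transitions from the states in `A`. -/
def tubeWeight (Λ : Set W.Route) (A : Set W.State) (a : W.Route ⊕ W.Route → ℝ) (z : W.State)
    (c : W.Route ⊕ W.Route) : ℝ :=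
  if z ∈ A ∧ c ∈ constrained Λ then a c / W.rate z c else 1

section

variable {W} {Λ : Set W.Route} {A : Set W.State} {a : W.Route ⊕ W.Route → ℝ}

lemma tubeWeight_nonneg (ha : ∀ c, 0 ≤ a c) (z : W.State) (c : W.Route ⊕ W.Route) :
    0 ≤ W.tubeWeight Λ A a z c := by
  rw [tubeWeight]
  split_ifs
  · exact div_nonneg (ha c) (W.rate_nonneg z c)
  · exact zero_le_one

lemma rate_mul_tubeWeight {z : W.State} {c : W.Route ⊕ W.Route} (hz : z ∈ A)
    (hc : c ∈ constrained Λ) (hr : W.rate z c ≠ 0) : W.rate z c * W.tubeWeight Λ A a z c = a c := by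
  rw [tubeWeight, if_pos ⟨hz, hc⟩, mul_div_cancel₀ _ hr]

lemma rate_mul_tubeWeight_le (ha : ∀ c, 0 ≤ a c) (z : W.State) (c : W.Route ⊕ W.Route) :
    W.rate z c * W.tubeWeight Λ A a z c ≤ a c + W.rate z c := by
  have h1 := W.rate_nonneg z c
  rw [tubeWeight]
  split_ifs
  · by_cases hr : W.rate z c = 0
    · rw [hr]; simp [ha c]
    · rw [mul_div_cancel₀ _ hr]; linarith
  · linarith [ha c]

end

section

variable {W} {y : W.State} {ω : W.Traj}

/-- A tilt by `s = ±θ` whose ratio stays below `exp b` bounds `s * (count - a * clock)` by `θ ^ 2 *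
(a * T) + b`, because `exp s - 1 ≤ s + s ^ 2`. Dividing by `θ` gives the two error terms. -/
lemma Valid.abs_count_sub_clock_le (h : W.Valid y ω) {v : W.State → W.Route ⊕ W.Route → ℝ}
    (hv : ∀ z c, 0 ≤ v z c) {T : ℝ} (hT : 0 ≤ T) {c : W.Route ⊕ W.Route} {k : ℕ} {a b θ : ℝ}
    (hθ : 0 < θ) (hθ1 : θ ≤ 1) (ha : 0 ≤ a)
    (hrate : ∀ i < k, jumpTime i ω ≤ T → W.rate (ω i).2 c * v (ω i).2 c = a)
    (h1 : W.density (W.tilt c θ v) T k ω < Real.exp b * W.density v T k ω)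
    (h2 : W.density (W.tilt c (-θ) v) T k ω < Real.exp b * W.density v T k ω) :
    |count c T k ω - a * clock T k ω| ≤ θ * (a * T) + b / θ := by
  have hclock : clock T k ω ≤ T := min_le_right _ _
  have hpos : 0 < W.density v T k ω := by
    refine (W.density_nonneg hv T k ω).lt_of_ne fun h0 => ?_
    rw [← h0, mul_zero] at h1
    refine absurd h1 (not_lt.2 (W.density_nonneg (fun z c => ?_) T k ω))
    exact mul_nonneg (hv z c) (Real.exp_pos _).le
  have key : ∀ s : ℝ, |s| = θ →
      W.density (W.tilt c s v) T k ω < Real.exp b * W.density v T k ω →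
      s * (count c T k ω - a * clock T k ω) ≤ θ ^ 2 * (a * T) + b := by
    intro s hs hlt
    have h3 := (h.density_mul_exp_le_tilt hv hT c s (k := k) (e := a * (Real.exp s - 1))
      fun i hi hiT => by rw [hrate i hi hiT]).trans_lt hlt
    rw [mul_comm, mul_lt_mul_iff_left₀ hpos, Real.exp_lt_exp] at h3
    have h4 : Real.exp s - 1 ≤ s + θ ^ 2 := by
      have := (abs_le.1 (Real.abs_exp_sub_one_sub_id_le (x := s) (hs.trans_le hθ1))).2
      rw [← sq_abs s, hs] at this
      linarith
    have h0 : 0 ≤ clock T k ω := le_min (h.jumpTime_nonneg k) hT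
    have h5 : a * clock T k ω * (Real.exp s - 1) ≤ a * clock T k ω * (s + θ ^ 2) := by gcongr
    have h6 : θ ^ 2 * (a * clock T k ω) ≤ θ ^ 2 * (a * T) := by gcongr
    linarith
  have k1 := key θ (abs_of_pos hθ) h1
  have k2 := key (-θ) (by rw [abs_neg, abs_of_pos hθ]) h2
  have e : θ * (a * T) + b / θ = (θ ^ 2 * (a * T) + b) / θ := by field_simp
  rw [e, le_div_iff₀ hθ, ← abs_of_pos hθ, ← abs_mul, abs_of_pos hθ]
  refine abs_le.2 ⟨?_, ?_⟩ <;> linarith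

/-- Trajectories whose transitions have nearly the prescribed frequencies stay in the tube. -/
lemma Valid.mem_tube (h : W.Valid y ω) {Λ : Set W.Route} {x : W.Route → ℝ} {G : GenPair Λ}
    (hx : x ∈ facePoints Λ) (hA0 : ∀ r, r.1 ∈ jammed Λ → G.1 r = 0) {T : ℝ}
    {n β γ e₀ e₁ : ℝ} {K : ℕ}
    (hy : ∀ r, |(y r : ℝ) - n * x r| ≤ e₀)
    (hcount : ∀ k ≤ K, (∀ i < k, jumpTime i ω ≤ T → (ω i).2 ∈ tube Λ x n β γ) →
      ∀ c ∈ constrained Λ, |count c T k ω - genRate G c * clock T k ω| ≤ e₁)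
    (hβ : e₀ + 2 * e₁ + T * ‖G.2‖ ≤ β * n) (hγ : e₀ + e₁ ≤ γ * n) :
    ∀ k ≤ K, jumpTime k ω ≤ T → (ω k).2 ∈ tube Λ x n β γ := by
  intro k
  -- A bootstrap: the count bound at `k` requires only the earlier states to be in the tube, and it
  -- puts the `k`-th one there.
  induction k using Nat.strong_induction_on with
  | _ k ih =>
    intro hk hkT
    have hc := hcount k hk fun i hi hiT => ih i hi (hi.le.trans hk) hiT
    have hclock : clock T k ω = jumpTime k ω := min_eq_left hkT
    refine ⟨fun r hr => ?_, fun r hr => ?_⟩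
    · have h1 := abs_le.1 (hc (.inl r) (inl_mem_constrained.2 (Or.inl hr)))
      have h2 := abs_le.1 (hc (.inr r) (inr_mem_constrained.2 hr))
      have h3 := abs_le.1 (hy r)
      have h4 : |G.2 r * clock T k ω| ≤ T * ‖G.2‖ := by
        rw [abs_mul, mul_comm, hclock, abs_of_nonneg (h.jumpTime_nonneg k)]
        have := norm_le_pi_norm G.2 r
        rw [Real.norm_eq_abs] at this
        exact mul_le_mul hkT this (abs_nonneg _) ((h.jumpTime_nonneg k).trans hkT)
      have h5 := abs_le.1 h4
      rw [← genRate_inl_sub_inr hr, sub_mul] at h5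
      rw [h.state_eq hkT]
      refine abs_le.2 ⟨?_, ?_⟩ <;> linarith
    -- On `Λ₁` the prescribed arrival rate is zero, and departures only help.
    · have h1 := abs_le.1 (hc (.inl r) (inl_mem_constrained.2 (Or.inr hr)))
      have h3 := abs_le.1 (hy r)
      rw [genRate_inl_of_jammed hA0 hr] at h1
      rw [hx.2 r hr.1] at h3
      rw [h.state_eq hkT]
      have := count_nonneg (ω := ω) (Sum.inr r) T k
      linarith

/-- Trajectories whose transitions have nearly the prescribed frequencies, and which stay small
in the unconstrained directions, belong to the event of the local large deviation principle. -/
lemma Valid.mem_event (h : W.Valid y ω) {Λ : Set W.Route} {x : W.Route → ℝ} {G : GenPair Λ}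
    (hG : G ∈ closure (calG Λ)) (hx : x ∈ facePoints Λ) {τ δ σ β γ e₀ e₁ : ℝ} {n K : ℕ}
    (hT : 0 < n * τ) (hK : n * τ < jumpTime K ω)
    (hy : ∀ r, |(y r : ℝ) - n * x r| ≤ e₀)
    (htube : ∀ k ≤ K, jumpTime k ω ≤ n * τ → (ω k).2 ∈ tube Λ x n β γ)
    (hfree : ∀ k ≤ K, jumpTime k ω ≤ n * τ → ∀ r ∉ Λ ∪ jammed Λ, ((ω k).2 r : ℝ) ≤ σ * n)
    (hcount : ∀ k ≤ K, ∀ c ∈ constrained Λ,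
      |count c (n * τ) k ω - genRate G c * clock (n * τ) k ω| ≤ e₁)
    (he₁ : 1 ≤ e₁) (hσ : e₀ + 4 * e₁ ≤ σ * n) (hγσ : γ ≤ σ) (hσ0 : 0 ≤ σ) (hσδ : σ < δ) (hn : 0 < n)
    (hσδ' : (2 * Fintype.card W.Route) * (σ / τ) < δ) :
    ω ∈ event Λ x G τ δ n := by
  obtain ⟨hGam, hD0, hA0⟩ := mem_closure_calG hG
  have hα : ∀ c, 0 ≤ genRate G c := genRate_nonneg hGam
  set T : ℝ := n * τ
  have hn' : (0 : ℝ) < n := Nat.cast_pos.2 hn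
  have hτ : 0 < τ := pos_of_mul_pos_right hT hn'.le
  have hγn : γ * n ≤ σ * n := by gcongr
  -- Between two jumps, `t` lies between consecutive clocks and the counts differ by at most one,
  -- which `he₁` absorbs.
  have hcnt : ∀ k < K, ∀ t, jumpTime k ω ≤ t → t < jumpTime (k + 1) ω → t ≤ T →
      ∀ c ∈ constrained Λ, |count c T k ω - genRate G c * t| ≤ 2 * e₁ := by
    intro k hk t h1 h2 ht c hc
    have h3 := abs_le.1 (hcount k hk.le c hc)
    have h4 := abs_le.1 (hcount (k + 1) hk c hc)
    have h5 := (count_succ (ω := ω) T k c).2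
    have h6 : genRate G c * t ≤ genRate G c * clock T (k + 1) ω :=
      mul_le_mul_of_nonneg_left (le_min h2.le ht) (hα c)
    have h7 : genRate G c * clock T k ω ≤ genRate G c * t :=
      mul_le_mul_of_nonneg_left ((min_le_left _ _).trans h1) (hα c)
    refine abs_le.2 ⟨?_, ?_⟩ <;> linarith
  constructor
  · obtain ⟨k, hk, hk1, hk2⟩ := exists_index hT.le hK
    have harr : ∀ r, (arrivals T ω r : ℝ) = count (.inl r) T k ω := fun r => by
      rw [h.arrivals_eq hT.le hK, h.count_eq hk.le hk2]
    have hdiff : ∀ r, (queue T ω r : ℝ) - queue 0 ω r =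
        count (.inl r) T k ω - count (.inr r) T k ω := fun r => by
      rw [h.queue_eq hk1 hk2, h.queue_zero, h.state_eq hk1]; ring
    refine ⟨⟨fun r => ?_, fun r => ?_⟩, ?_⟩
    · exact div_nonneg (Nat.cast_nonneg _) hT.le
    · change 0 ≤ (arrivals T ω r.1 : ℝ) / T - ((queue T ω r.1 : ℝ) - queue 0 ω r.1) / T
      rw [harr, hdiff, ← sub_div, sub_sub_cancel]
      exact div_nonneg (count_nonneg _ _ _) hT.le
    · have hστ : σ / τ = σ * n / T := by
        simp only [T]; field_simp
      have h1 : ∀ r : ↥(Λ ∪ jammed Λ), |(empGen Λ (n * τ) ω).1 r - G.1 r| ≤ σ / τ := by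
        intro r
        have h2 := hcnt k hk T hk1 hk2 le_rfl (.inl r.1) (inl_mem_constrained.2 r.2)
        have h3 : genRate G (.inl r.1) = G.1 r := by
          simp only [genRate, Sum.elim_inl, dif_pos r.2]
        have h4 : (empGen Λ (n * τ) ω).1 r - G.1 r =
            (count (.inl r.1) T k ω - G.1 r * T) / T := by
          rw [← harr, sub_div, mul_div_cancel_right₀ _ hT.ne']; rfl
        rw [h4, abs_div, abs_of_pos hT, hστ, ← h3]
        have he : 0 ≤ e₀ := (abs_nonneg _).trans (hy r.1)
        gcongr
        linarith
      have h2 : ∀ r : W.Route, |(empGen Λ (n * τ) ω).2 r - G.2 r| ≤ σ / τ := by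
        intro r
        have he : 0 ≤ e₀ := (abs_nonneg _).trans (hy r)
        have h4 : (empGen Λ (n * τ) ω).2 r - G.2 r =
            ((queue T ω r : ℝ) - queue 0 ω r - G.2 r * T) / T := by
          rw [sub_div _ _ T, mul_div_cancel_right₀ _ hT.ne']; rfl
        rw [h4, abs_div, abs_of_pos hT, hστ]
        gcongr
        by_cases hr : r ∈ Λ
        · have h5 := abs_le.1 (hcnt k hk T hk1 hk2 le_rfl (.inl r)
            (inl_mem_constrained.2 (Or.inl hr)))
          have h6 := abs_le.1 (hcnt k hk T hk1 hk2 le_rfl (.inr r) (inr_mem_constrained.2 hr))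
          rw [hdiff, ← genRate_inl_sub_inr hr, sub_mul]
          refine abs_le.2 ⟨?_, ?_⟩ <;> linarith
        -- Off `Λ` both `x` and `D` vanish, and the initial and final lengths lie in `[0, σ n]`.
        · have h7 := abs_le.1 (hy r)
          rw [hx.2 r hr] at h7
          have h8 : ((ω k).2 r : ℝ) ≤ σ * n := by
            by_cases hj : r ∈ jammed Λ
            · exact ((htube k hk.le hk1).2 r hj).trans hγn
            · exact hfree k hk.le hk1 r (by simp [hr, hj])
          rw [hD0 r hr, zero_mul, sub_zero, h.queue_eq hk1 hk2, h.queue_zero]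
          have h9 : (0 : ℝ) ≤ (ω k).2 r := Nat.cast_nonneg _
          have h10 : (0 : ℝ) ≤ y r := Nat.cast_nonneg _
          refine abs_le.2 ⟨?_, ?_⟩ <;> linarith
      calc genDist (empGen Λ (n * τ) ω) G
          ≤ ∑ _r : ↥(Λ ∪ jammed Λ), σ / τ + ∑ _r : W.Route, σ / τ :=
            add_le_add (Finset.sum_le_sum fun r _ => h1 r) (Finset.sum_le_sum fun r _ => h2 r)
        _ = (Fintype.card ↥(Λ ∪ jammed Λ) + Fintype.card W.Route) * (σ / τ) := by
            rw [Finset.sum_const, Finset.sum_const, Finset.card_univ, Finset.card_univ,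
              nsmul_eq_mul, nsmul_eq_mul, add_mul]
        _ ≤ (2 * Fintype.card W.Route) * (σ / τ) := by
            have : Fintype.card ↥(Λ ∪ jammed Λ) ≤ Fintype.card W.Route :=
              Fintype.card_le_of_injective (Subtype.val) Subtype.val_injective
            have : (Fintype.card ↥(Λ ∪ jammed Λ) : ℝ) ≤ Fintype.card W.Route :=
              Nat.cast_le.2 this
            refine mul_le_mul_of_nonneg_right ?_ (by positivity)
            linarith
        _ < δ := hσδ'
  -- A supremum of strict bounds is only a weak bound, hence the room between `σ` and `δ`.
  · refine (iSup₂_le (a := ENNReal.ofReal (σ * n)) fun t ht => ?_).trans_lt ?_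
    · obtain ⟨k, hk, hk1, hk2⟩ := exists_index ht.1 (ht.2.trans_lt hK)
      have hkT : jumpTime k ω ≤ T := hk1.trans ht.2
      rw [← ofReal_norm]
      refine ENNReal.ofReal_le_ofReal ?_
      have hr' : ∀ r, ‖(W.toReal (queue t ω) - (n : ℝ) • x - t • G.2) r‖ ≤ σ * n := by
        intro r
        rw [h.queue_eq hk1 hk2]
        change |((ω k).2 r : ℝ) - n * x r - t * G.2 r| ≤ σ * n
        have he : 0 ≤ e₀ := (abs_nonneg _).trans (hy r)
        by_cases hr : r ∈ Λ
        · have h5 := abs_le.1 (hcnt k hk t hk1 hk2 ht.2 (.inl r)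
            (inl_mem_constrained.2 (Or.inl hr)))
          have h6 := abs_le.1 (hcnt k hk t hk1 hk2 ht.2 (.inr r) (inr_mem_constrained.2 hr))
          have h7 := abs_le.1 (hy r)
          rw [h.state_eq hkT, ← genRate_inl_sub_inr hr, mul_sub]
          refine abs_le.2 ⟨?_, ?_⟩ <;> linarith
        · have h8 : ((ω k).2 r : ℝ) ≤ σ * n := by
            by_cases hj : r ∈ jammed Λ
            · exact ((htube k hk.le hkT).2 r hj).trans hγn
            · exact hfree k hk.le hkT r (by simp [hr, hj])
          rw [hD0 r hr, hx.2 r hr, mul_zero, mul_zero, sub_zero, sub_zero]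
          rwa [abs_of_nonneg (Nat.cast_nonneg _)]
      exact (pi_norm_le_iff_of_nonneg (by positivity)).2 hr'
    · have := hσ0.trans_lt hσδ
      exact (ENNReal.ofReal_lt_ofReal_iff (by positivity)).2 (by gcongr)

end

/-! ### The lower bound -/

section

variable {W} {y : W.State} {ω : W.Traj}

/-- In `A` the weight `α / rate` is at most `exp η * α / R` and minus the excess is at most `∑ (exp
η * R - α)`; with counts close to `α * T` the exponents add up to `T` times the entropy, plus
errors. -/
lemma Valid.density_tubeWeight_le (h : W.Valid y ω) {Λ : Set W.Route} {A : Set W.State}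
    {α R : W.Route ⊕ W.Route → ℝ} (hα : ∀ c, 0 ≤ α c) {η : ℝ} (hη : 0 ≤ η)
    (hR : ∀ c ∈ constrained Λ, 0 < R c)
    (hrate : ∀ z ∈ A, ∀ c ∈ constrained Λ,
      Real.exp (-η) * R c ≤ W.rate z c ∧ W.rate z c ≤ Real.exp η * R c)
    {T : ℝ} (hT : 0 ≤ T) {K : ℕ} (hK : T < jumpTime K ω)
    (hA : ∀ i < K, jumpTime i ω ≤ T → (ω i).2 ∈ A) {e₁ : ℝ}
    (hc : ∀ c ∈ constrained Λ, |count c T K ω - α c * T| ≤ e₁) :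
    W.density (W.tubeWeight Λ A α) T K ω ≤
      Real.exp (T * ∑ c ∈ constrained Λ,
        (poissonEntropy (α c) (R c) + (η * α c + (Real.exp η - 1) * R c)) +
          e₁ * ∑ c ∈ constrained Λ, |Real.log (α c / R c) + η|) := by
  classical
  set J := constrained Λ
  -- Where `α c = 0` the weight vanishes, and the bound `exp 0` avoids the logarithm of zero.
  set g : W.Route ⊕ W.Route → ℝ := fun c =>
    if c ∈ J ∧ α c ≠ 0 then Real.log (α c / R c) + η else 0
  have hstate : ∀ i < K, jumpTime i ω ≤ T →
      (∀ c, W.tubeWeight Λ A α (ω i).2 c ≤ Real.exp (g c)) ∧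
        -W.excess (W.tubeWeight Λ A α) (ω i).2 ≤ ∑ c ∈ J, (Real.exp η * R c - α c) := by
    intro i hi hiT
    have hz := hA i hi hiT
    have hpos : ∀ c ∈ J, 0 < W.rate (ω i).2 c := fun c hcJ =>
      (mul_pos (Real.exp_pos _) (hR c hcJ)).trans_le (hrate _ hz c hcJ).1
    constructor
    · intro c
      by_cases hcJ : c ∈ J
      · rw [tubeWeight, if_pos ⟨hz, hcJ⟩]
        by_cases h0 : α c = 0
        · simp [h0, (Real.exp_pos _).le]
        · have hα' : 0 < α c := (hα c).lt_of_ne' h0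
          simp only [g, if_pos (And.intro hcJ h0)]
          rw [Real.exp_add, Real.exp_log (div_pos hα' (hR c hcJ)), div_mul_eq_mul_div,
            div_le_div_iff₀ (hpos c hcJ) (hR c hcJ)]
          have h1 := (hrate _ hz c hcJ).1
          have h2 : R c ≤ Real.exp η * W.rate (ω i).2 c := by
            calc R c = Real.exp η * (Real.exp (-η) * R c) := by
                  rw [← mul_assoc, ← Real.exp_add]; simp
              _ ≤ _ := by gcongr
          calc α c * R c ≤ α c * (Real.exp η * W.rate (ω i).2 c) := by gcongr
            _ = _ := by ring
      · rw [tubeWeight, if_neg fun hh => hcJ hh.2]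
        simp [g, hcJ]
    · rw [excess, ← Finset.sum_subset (Finset.subset_univ J), ← Finset.sum_neg_distrib]
      · refine Finset.sum_le_sum fun c hcJ => ?_
        rw [mul_sub, rate_mul_tubeWeight hz hcJ (hpos c hcJ).ne', mul_one]
        linarith [(hrate _ hz c hcJ).2]
      · intro c _ hcJ
        rw [tubeWeight, if_neg fun hh => hcJ hh.2, sub_self, mul_zero]
  refine (h.density_le (tubeWeight_nonneg hα) hT hstate).trans (Real.exp_le_exp.2 ?_)
  rw [clock, min_eq_right hK.le, ← Finset.sum_subset (Finset.subset_univ J), Finset.mul_sum,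
    Finset.mul_sum, Finset.sum_mul, ← Finset.sum_add_distrib, ← Finset.sum_add_distrib]
  · refine Finset.sum_le_sum fun c hcJ => ?_
    have h1 := hc c hcJ
    have he₁ : 0 ≤ e₁ := (abs_nonneg _).trans h1
    have hηα : 0 ≤ T * (η * α c) := mul_nonneg hT (mul_nonneg hη (hα c))
    rw [poissonEntropy]
    by_cases h0 : α c = 0
    · simp only [g, h0]
      have : 0 ≤ e₁ * |Real.log (0 / R c) + η| := mul_nonneg he₁ (abs_nonneg _)
      simp only [ne_eq, not_true, and_false, if_false]
      linarith
    · simp only [g, if_pos (And.intro hcJ h0)]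
      set L := Real.log (α c / R c)
      have h2 : (L + η) * (count c T K ω - α c * T) ≤ e₁ * |L + η| := by
        refine (le_abs_self _).trans ?_
        rw [abs_mul, mul_comm]
        gcongr
      linarith
  · intro c _ hcJ
    simp [g, hcJ]

/-- A Doob ratio below `exp b` bounds the increase of `lyap` by the accumulated drift plus `b`. -/
lemma Valid.mul_le_of_density_doob_lt (h : W.Valid y ω) {v : W.State → W.Route ⊕ W.Route → ℝ}
    (hv : ∀ z c, 0 ≤ v z c) {Λ : Set W.Route} {t p T e b : ℝ} (hT : 0 ≤ T) (ht : 0 ≤ t)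
    (he0 : 0 ≤ e) {k : ℕ} (hk : jumpTime k ω ≤ T)
    (he : ∀ i < k, ∑ c, W.rate (ω i).2 c * v (ω i).2 c *
      (Real.exp (W.lyap Λ t p (W.target (ω i).2 c) - W.lyap Λ t p (ω i).2) - 1) ≤ e)
    (hy : ∀ r ∉ Λ ∪ jammed Λ, (y r : ℝ) ≤ 2 * p * W.traffic r)
    (hd : W.density (W.doob (W.lyap Λ t p) v) T k ω < Real.exp b * W.density v T k ω)
    {r : W.Route} (hr : r ∉ Λ ∪ jammed Λ) :
    t * ((ω k).2 r / W.traffic r) ≤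
      Real.log (1 + Fintype.card W.Route) + 2 * t * p + e * T + b := by
  have hpos : 0 < W.density v T k ω := by
    refine (W.density_nonneg hv T k ω).lt_of_ne fun h0 => ?_
    rw [← h0, mul_zero] at hd
    refine absurd hd (not_lt.2 (W.density_nonneg (fun z c => ?_) T k ω))
    exact mul_nonneg (hv z c) (Real.exp_pos _).le
  have h1 := (h.density_mul_exp_le_doob hv hT (W.lyap Λ t p) hk he).trans_lt hd
  rw [mul_comm, mul_lt_mul_iff_left₀ hpos, Real.exp_lt_exp] at h1
  have h2 := W.le_lyap t p (ω k).2 hr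
  have h3 := W.lyap_le ht hy
  have h4 : e * clock T k ω ≤ e * T := mul_le_mul_of_nonneg_left (min_le_right _ _) he0
  linarith

end

lemma eventually_le_mul_nat (C : ℝ) {c : ℝ} (hc : 0 < c) : ∀ᶠ n : ℕ in atTop, C ≤ c * n :=
  (tendsto_natCast_atTop_atTop.const_mul_atTop hc).eventually_ge_atTop C

set_option maxHeartbeats 1000000 in
/-- The lower bound of the local large deviation principle, uniformly on the points of the face
whose coordinates on `Λ` are at least `m`. -/
theorem le_lowerRate [Nonempty W.Route] (hW : W.Ergodic) {Λ : Set W.Route} {G : GenPair Λ}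
    (hG : G ∈ closure (calG Λ)) {m η : ℝ} (hm : 0 < m) (hη : 0 < η) :
    ∃ τ₀ > 0, ∀ τ, 0 < τ → τ < τ₀ → ∀ x ∈ facePoints Λ, (∀ r ∈ Λ, m ≤ x r) →
      ∀ δ > 0, ∃ ε > 0, ((-W.entropy Λ G x - η : ℝ) : EReal) ≤ W.lowerRate Λ x G τ δ ε := by
  classical
  obtain ⟨hGam, hD0, hA0⟩ := mem_closure_calG hG
  obtain ⟨B, hB0, hBs, hBr⟩ := W.exists_rate_le
  obtain ⟨t, ht, κL, hκL, KL, hKL, hdrift⟩ := W.exists_lyap_drift_le hW Λ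
  set B' : ℝ := B + ∑ r : W.Route, W.lam r.1
  have hlam : ∀ r : W.Route, W.lam r.1 ≤ ∑ r : W.Route, W.lam r.1 := fun r =>
    Finset.single_le_sum (f := fun r : W.Route => W.lam r.1) (fun r _ => W.lam_nonneg _)
      (Finset.mem_univ r)
  have hB' : ∀ x : W.Route → ℝ, (∀ r, 0 ≤ x r) → ∀ c, W.fluidRate x c ≤ B' := by
    intro x hx c
    rcases c with r | r
    · exact (hlam r).trans (le_add_of_nonneg_left hB0)
    · exact (hBs x hx r).trans (le_add_of_nonneg_right
        (Finset.sum_nonneg fun r _ => W.lam_nonneg _))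
  set J := constrained Λ
  set α := genRate G
  have hα : ∀ c, 0 ≤ α c := genRate_nonneg hGam
  obtain ⟨η₁, hη₁, hη₁M⟩ : ∃ η₁ > 0,
      ∑ c ∈ J, (η₁ * α c + (Real.exp η₁ - 1) * B') ≤ η / 3 := by
    have hc : Tendsto (fun t : ℝ => ∑ c ∈ J, (t * α c + (Real.exp t - 1) * B')) (𝓝[>] 0)
        (𝓝 0) := by
      have : Continuous fun t : ℝ => ∑ c ∈ J, (t * α c + (Real.exp t - 1) * B') := by fun_prop
      simpa using (this.tendsto 0).mono_left nhdsWithin_le_nhds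
    obtain ⟨t, ht, ht0⟩ := ((hc.eventually (gt_mem_nhds (show (0 : ℝ) < η / 3 by positivity))).and
      self_mem_nhdsWithin).exists
    exact ⟨t, ht0, ht.le⟩
  obtain ⟨β, hβ, hnear⟩ := W.exists_rate_near Λ hη₁ hm
  set Dn := ‖G.2‖
  refine ⟨β / (4 * (Dn + 1)), by positivity, fun τ hτ hττ x hx hmx δ hδ => ?_⟩
  have hx0 : ∀ r, 0 ≤ x r := fun r => by
    by_cases hr : r ∈ Λ
    · exact (hx.1 r hr).le
    · exact (hx.2 r hr).ge
  have hτD : τ * Dn ≤ β / 4 := by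
    rw [lt_div_iff₀ (by positivity)] at hττ
    nlinarith
  set R := W.fluidRate x
  have hR : ∀ c ∈ J, 0 < R c := fun c hc => fluidRate_pos hx0 hx.1 hc
  set N : ℝ := ((Fintype.card W.Route : ℕ) : ℝ)
  have hN : 0 ≤ N := Nat.cast_nonneg _
  -- The allowed size of deviations, in units of `n`. The bound by `δ * τ` is needed because the
  -- empirical generator divides them by `n τ`.
  obtain ⟨σ, hσ, hσδ, hσβ, hστ⟩ : ∃ σ > 0, σ ≤ δ / 2 ∧ σ ≤ β / 2 ∧
      σ ≤ δ * τ / (4 * (N + 1)) :=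
    ⟨min (δ / 2) (min (β / 2) (δ * τ / (4 * (N + 1)))), by positivity, min_le_left _ _,
      (min_le_right _ _).trans (min_le_left _ _), (min_le_right _ _).trans (min_le_right _ _)⟩
  have hστ' : 2 * N * (σ / τ) < δ := by
    rw [le_div_iff₀ (by positivity)] at hστ
    rw [← mul_div_assoc, div_lt_iff₀ hτ]
    nlinarith [mul_pos hδ hτ]
  set ρ := ∑ r, W.traffic r
  have hρ : ∀ r, W.traffic r ≤ ρ := fun r =>
    Finset.single_le_sum (f := W.traffic) (fun r _ => (W.traffic_pos r).le) (Finset.mem_univ r)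
  have hρ0 : 0 ≤ ρ := Finset.sum_nonneg fun r _ => (W.traffic_pos r).le
  obtain ⟨ρ', hρ', hρ'r⟩ : ∃ ρ' > 0, ∀ r, ρ' ≤ W.traffic r :=
    ⟨Finset.univ.inf' Finset.univ_nonempty W.traffic,
      (Finset.lt_inf'_iff _).2 fun r _ => W.traffic_pos r,
      fun r => Finset.inf'_le _ (Finset.mem_univ r)⟩
  -- The level `p` of the Lyapunov function will be `β' * n`; free routes end up below `4 * p *
  -- ρ_r`, hence below `σ * n`.
  set β' := σ / (4 * (ρ + 1))
  have hβ' : 0 < β' := by positivity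
  have hβ'σ : ∀ r, W.traffic r * (4 * β') ≤ σ := fun r => by
    have : 4 * β' * (ρ + 1) = σ := by simp only [β']; field_simp
    nlinarith [hρ r]
  -- The second bound makes `Λ₁` empty enough for the drift estimate at level `p`.
  obtain ⟨γ, hγ, hγσ, hγρ⟩ : ∃ γ > 0, γ ≤ σ / 2 ∧ γ ≤ ρ' * β' :=
    ⟨min (σ / 2) (ρ' * β'), by positivity, min_le_left _ _, min_le_right _ _⟩
  set Lg : ℝ := ∑ c ∈ J, |Real.log (α c / R c) + η₁|
  have hLg : 0 ≤ Lg := Finset.sum_nonneg fun _ _ => abs_nonneg _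
  -- The tolerance on the counts, in units of `n`; the last bound limits its effect on the
  -- log-density to a third of `η`.
  obtain ⟨κ, hκ, hκσ, hκγ, hκL'⟩ : ∃ κ > 0, κ ≤ σ / 8 ∧ κ ≤ γ / 4 ∧
      κ ≤ τ * η / 3 / (Lg + 1) :=
    ⟨min (σ / 8) (min (γ / 4) (τ * η / 3 / (Lg + 1))), by positivity, min_le_left _ _,
      (min_le_right _ _).trans (min_le_left _ _), (min_le_right _ _).trans (min_le_right _ _)⟩
  have hκLg : κ * Lg ≤ τ * η / 3 := by
    rw [le_div_iff₀ (by positivity)] at hκL'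
    linarith
  obtain ⟨ε, hε, hεγ, hεσ, hερ⟩ : ∃ ε > 0, ε ≤ γ / 4 ∧ ε ≤ σ / 4 ∧ ε ≤ 2 * β' * ρ' :=
    ⟨min (γ / 4) (min (σ / 4) (2 * β' * ρ')), by positivity, min_le_left _ _,
      (min_le_right _ _).trans (min_le_left _ _), (min_le_right _ _).trans (min_le_right _ _)⟩
  set Sα := ∑ c, α c
  have hSα : ∀ c, α c ≤ Sα := fun c =>
    Finset.single_le_sum (f := α) (fun c _ => hα c) (Finset.mem_univ c)
  have hSα0 : 0 ≤ Sα := Finset.sum_nonneg fun c _ => hα c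
  -- Half of the tolerance `κ` covers the quadratic term of the tilt, the other half covers `b / θ`.
  obtain ⟨θ, hθ, hθ1, hθκ⟩ : ∃ θ > 0, θ ≤ 1 ∧ θ ≤ κ / (2 * τ * (Sα + 1)) :=
    ⟨min 1 (κ / (2 * τ * (Sα + 1))), by positivity, min_le_left _ _, min_le_right _ _⟩
  have hθα : ∀ c, θ * (α c * τ) ≤ κ / 2 := fun c => by
    rw [le_div_iff₀ (by positivity)] at hθκ
    nlinarith [hSα c, mul_pos hθ hτ]
  set N' : ℝ := ((Fintype.card ((W.Route ⊕ W.Route) × Bool) : ℕ) : ℝ)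
  have hN' : 0 ≤ N' := Nat.cast_nonneg _
  refine ⟨ε, hε, ?_⟩
  rw [lowerRate]
  refine le_liminf_of_le (by isBoundedDefault) ?_
  filter_upwards [eventually_gt_atTop 0, eventually_le_mul_nat 1 hκ,
    eventually_le_mul_nat (Real.log (1 + N) + KL * τ / (κL * β')) (mul_pos ht hβ'),
    eventually_le_mul_nat (Real.log 8) (mul_pos ht hβ'),
    eventually_le_mul_nat (Real.log (8 * (N' + 1))) (show 0 < θ * κ / 2 by positivity),
    eventually_le_mul_nat (Real.log 2) (show 0 < τ * η / 3 by positivity)]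
    with n hn hn1 hn2 hn3 hn4 hn5
  refine le_iInf₂ fun y hy => ?_
  have hn' : (0 : ℝ) < n := Nat.cast_pos.2 hn
  have hT : 0 < n * τ := by positivity
  refine le_logProb hT ?_
  set T : ℝ := n * τ with hTdef
  have hyr : ∀ r, |(y r : ℝ) - n * x r| ≤ ε * n := fun r =>
    (norm_le_pi_norm (W.toReal y - (n : ℝ) • x) r).trans hy.le
  set A := tube Λ x n β γ
  have hAnear : ∀ z ∈ A, ∀ c ∈ J, Real.exp (-η₁) * R c ≤ W.rate z c ∧
      W.rate z c ≤ Real.exp η₁ * R c := by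
    intro z hz
    refine hnear x hx0 hmx n hn' z fun r hr => ?_
    rcases hr with hr | hr
    · exact hz.1 r hr
    · rw [hx.2 r hr.1, mul_zero, sub_zero, abs_of_nonneg (Nat.cast_nonneg _)]
      refine (hz.2 r hr).trans ?_
      gcongr
      linarith
  have hApos : ∀ z ∈ A, ∀ c ∈ J, W.rate z c ≠ 0 := fun z hz c hc =>
    ((mul_pos (Real.exp_pos _) (hR c hc)).trans_le (hAnear z hz c hc).1).ne'
  set v := W.tubeWeight Λ A α
  have hv : ∀ z c, 0 ≤ v z c := tubeWeight_nonneg hα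
  have hvfree : ∀ z, ∀ r ∉ Λ ∪ jammed Λ, v z (.inl r) = 1 ∧ v z (.inr r) = 1 := by
    intro z r hr
    refine ⟨if_neg fun hh => hr (inl_mem_constrained.1 hh.2), if_neg fun hh => hr (Or.inl
      (inr_mem_constrained.1 hh.2))⟩
  set p := β' * n
  have hp : 0 ≤ p := by positivity
  set e := KL * Real.exp (-(κL * p))
  -- The drift is exponentially small in `n`, so its total over a time of order `n` stays bounded.
  have heT : e * T ≤ KL * τ / (κL * β') := by
    have h1 : κL * p * Real.exp (-(κL * p)) ≤ 1 := by
      rw [Real.exp_neg, ← div_eq_mul_inv, div_le_one (Real.exp_pos _)]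
      linarith [Real.add_one_le_exp (κL * p)]
    calc e * T = KL * τ / (κL * β') * (κL * p * Real.exp (-(κL * p))) := by
          simp only [e, T, p]; field_simp
      _ ≤ KL * τ / (κL * β') * 1 := by gcongr
      _ = _ := mul_one _
  have hdriftA : ∀ z ∈ A, ∑ c, W.rate z c * v z c *
      (Real.exp (W.lyap Λ t p (W.target z c) - W.lyap Λ t p z) - 1) ≤ e := by
    intro z hz
    refine hdrift p hp v z (hvfree z) fun s hs => (hz.2 s hs).trans ?_
    calc γ * n ≤ ρ' * β' * n := by gcongr
      _ ≤ W.traffic s * β' * n := by gcongr; exact hρ'r s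
      _ = _ := by simp only [p]; ring
  have hyfree : ∀ r ∉ Λ ∪ jammed Λ, (y r : ℝ) ≤ 2 * p * W.traffic r := by
    intro r hr
    have h1 := hyr r
    rw [hx.2 r fun hh => hr (Or.inl hh), mul_zero, sub_zero,
      abs_of_nonneg (Nat.cast_nonneg _)] at h1
    calc (y r : ℝ) ≤ 2 * β' * ρ' * n := h1.trans (by gcongr)
      _ ≤ 2 * β' * W.traffic r * n := by gcongr; exact hρ'r r
      _ = _ := by simp only [p]; ring
  set b := θ * κ / 2 * n
  -- The competing densities: `none` is the Doob transform for the free routes, the others tilt one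
  -- transition type up or down.
  set v' : Option ((W.Route ⊕ W.Route) × Bool) → W.State → W.Route ⊕ W.Route → ℝ := fun i =>
    i.elim (W.doob (W.lyap Λ t p) v) fun q => W.tilt q.1 (if q.2 then θ else -θ) v
  set l : Option ((W.Route ⊕ W.Route) × Bool) → ℝ := fun i =>
    i.elim (Real.exp (t * p)) fun _ => Real.exp b
  have hv' : ∀ i z c, 0 ≤ v' i z c := by
    rintro (_ | q) z c <;> exact mul_nonneg (hv z c) (Real.exp_pos _).le
  have hl : ∀ i, 0 < l i := by
    rintro (_ | q) <;> exact Real.exp_pos _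
  have hl4 : ∑ i, 1 / l i ≤ 1 / 4 := by
    rw [Fintype.sum_option]
    simp only [l, Option.elim, Finset.sum_const, Finset.card_univ, nsmul_eq_mul]
    have h1 : 1 / Real.exp (t * p) ≤ 1 / 8 := by
      refine one_div_le_one_div_of_le (by norm_num) ?_
      rw [← Real.log_le_iff_le_exp (by norm_num)]
      simp only [p]; linarith
    have h2 : 1 / Real.exp b ≤ 1 / (8 * (N' + 1)) := by
      refine one_div_le_one_div_of_le (by positivity) ?_
      rw [← Real.log_le_iff_le_exp (by positivity)]
      exact hn4
    have h3 : N' * (1 / Real.exp b) ≤ 1 / 8 := by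
      refine (mul_le_mul_of_nonneg_left h2 hN').trans ?_
      rw [mul_one_div, div_le_iff₀ (by positivity)]
      linarith
    change _ + N' * _ ≤ _
    linarith
  set Bt := ∑ c, (α c + B)
  have hBt : ∀ z, ∑ c, W.rate z c * v z c ≤ Bt := fun z =>
    Finset.sum_le_sum fun c _ => (rate_mul_tubeWeight_le hα z c).trans
      (add_le_add le_rfl (hBr z c))
  obtain ⟨K, hK⟩ : ∃ K : ℕ, Real.exp (Bt * T) / 2 ^ K ≤ 1 / 4 := by
    obtain ⟨K, hK⟩ := pow_unbounded_of_one_lt (4 * Real.exp (Bt * T)) (one_lt_two)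
    refine ⟨K, ?_⟩
    rw [div_le_iff₀ (by positivity)]
    linarith
  set H := W.entropy Λ G x
  refine le_trans (ENNReal.ofReal_le_ofReal ?_) (W.le_law_of_density_le hv hBt hT.le hv' hl hl4
    hK (a := T * (H + 2 * η / 3)) fun ω hω hKT hgood => ?_)
  -- The last third of `η` absorbs the factor `1 / 2`.
  · have h2 : Real.exp (-(T * η / 3)) ≤ 1 / 2 := by
      rw [one_div, ← Real.log_le_log_iff (Real.exp_pos _) (by norm_num), Real.log_exp,
        Real.log_inv]
      simp only [T]; linarith
    calc Real.exp (T * (-H - η))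
        = Real.exp (-(T * (H + 2 * η / 3))) * Real.exp (-(T * η / 3)) := by
          rw [← Real.exp_add]; congr 1; ring
      _ ≤ Real.exp (-(T * (H + 2 * η / 3))) * (1 / 2) := by gcongr
      _ = _ := by ring
  · have hcount : ∀ k ≤ K, (∀ i < k, jumpTime i ω ≤ T → (ω i).2 ∈ A) →
        ∀ c ∈ J, |count c T k ω - α c * clock T k ω| ≤ κ * n := by
      intro k hk hA c hc
      refine (hω.abs_count_sub_clock_le hv hT.le hθ hθ1 (hα c) (b := b)
        (fun i hi hiT => rate_mul_tubeWeight (hA i hi hiT) hc (hApos _ (hA i hi hiT) c hc))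
        (hgood (some (c, true)) k hk) (hgood (some (c, false)) k hk)).trans ?_
      have h1 : b / θ = κ / 2 * n := by simp only [b]; field_simp
      have h2 : θ * (α c * T) = θ * (α c * τ) * n := by simp only [T]; ring
      rw [h1, h2]
      nlinarith [hθα c]
    have htube := hω.mem_tube hx hA0 (T := T) hyr hcount
      (by
        calc ε * n + 2 * (κ * n) + T * ‖G.2‖ = (ε + 2 * κ + τ * Dn) * n := by
              simp only [T, Dn]; ring
          _ ≤ β * n := by gcongr; linarith)
      (by
        calc ε * n + κ * n = (ε + κ) * n := by ring
          _ ≤ γ * n := by gcongr; linarith)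
    have hcount' : ∀ k ≤ K, ∀ c ∈ J, |count c T k ω - α c * clock T k ω| ≤ κ * n := fun k hk =>
      hcount k hk fun i hi hiT => htube i (hi.le.trans hk) hiT
    have hfree : ∀ k ≤ K, jumpTime k ω ≤ T → ∀ r ∉ Λ ∪ jammed Λ, ((ω k).2 r : ℝ) ≤ σ * n := by
      intro k hk hkT r hr
      have h1 := hω.mul_le_of_density_doob_lt hv hT.le ht.le (by positivity) hkT
        (fun i hi => hdriftA _ (htube i (hi.le.trans hk)
          ((hω.strictMono.monotone hi.le).trans hkT))) hyfree (hgood none k hk) hr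
      -- Two units of `t * p` come from the floor, one from the level of the ratio, one from the
      -- bounded terms.
      have h2 : t * ((ω k).2 r / W.traffic r) ≤ t * (4 * p) := by
        have : Real.log (1 + N) + KL * τ / (κL * β') ≤ t * p := by
          simp only [p]; linarith
        change _ ≤ Real.log (1 + N) + _ + _ + _ at h1
        linarith
      have h3 := le_of_mul_le_mul_left h2 ht
      rw [div_le_iff₀ (W.traffic_pos r)] at h3
      calc ((ω k).2 r : ℝ) ≤ W.traffic r * (4 * β') * n := by
            refine h3.trans (le_of_eq ?_); simp only [p]; ring
        _ ≤ σ * n := by gcongr; exact hβ'σ r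
    refine ⟨hω.mem_event hG hx hT hKT hyr htube hfree hcount' hn1 ?_ (by linarith) hσ.le
      (by linarith) hn hστ', ?_⟩
    · calc ε * n + 4 * (κ * n) = (ε + 4 * κ) * n := by ring
        _ ≤ σ * n := by gcongr; linarith
    · refine (hω.density_tubeWeight_le hα hη₁.le hR hAnear hT.le hKT
        (fun i hi hiT => htube i hi.le hiT) (e₁ := κ * n) fun c hc => ?_).trans
        (Real.exp_le_exp.2 ?_)
      · have := hcount' K le_rfl c hc
        rwa [clock, min_eq_right hKT.le] at this
      · have hH : H = ∑ c ∈ J, poissonEntropy (α c) (R c) := entropy_eq_sum hD0 hA0 hx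
        rw [Finset.sum_add_distrib, ← hH]
        have h1 : ∑ c ∈ J, (η₁ * α c + (Real.exp η₁ - 1) * R c) ≤ η / 3 := by
          refine le_trans (Finset.sum_le_sum fun c _ => ?_) hη₁M
          exact add_le_add le_rfl (mul_le_mul_of_nonneg_left (hB' x hx0 c)
            (sub_nonneg.2 (Real.one_le_exp hη₁.le)))
        have h2 : κ * n * Lg ≤ T * η / 3 := by
          calc κ * n * Lg = κ * Lg * n := by ring
            _ ≤ τ * η / 3 * n := by gcongr
            _ = _ := by simp only [T]; ring
        have h3 := mul_le_mul_of_nonneg_left h1 hT.le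
        change T * (H + _) + κ * n * Lg ≤ _
        linarith

/-! ### The limits -/

section

variable {W} {Λ : Set W.Route} {x : W.Route → ℝ} {G : GenPair Λ} {τ δ ε : ℝ}

lemma event_mono {δ' : ℝ} (h : δ ≤ δ') (n : ℕ) : event Λ x G τ δ n ⊆ event Λ x G τ δ' n :=
  fun _ hω => ⟨⟨hω.1.1, hω.1.2.trans_le h⟩,
    hω.2.trans_le (ENNReal.ofReal_le_ofReal (mul_le_mul_of_nonneg_right h (Nat.cast_nonneg n)))⟩

lemma logProb_mono (hτ : 0 ≤ τ) {δ' : ℝ} (h : δ ≤ δ') (n : ℕ) (y : W.State) :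
    W.logProb Λ x G τ δ n y ≤ W.logProb Λ x G τ δ' n y :=
  mul_le_mul_of_nonneg_left (ENNReal.log_monotone (measure_mono (event_mono h n)))
    (EReal.coe_nonneg.2 (by positivity))

lemma lowerRate_antitone : Antitone (W.lowerRate Λ x G τ δ) := fun _ _ h =>
  liminf_le_liminf (Eventually.of_forall fun n => le_iInf₂ fun y hy =>
    iInf₂_le y (hy.trans_le (mul_le_mul_of_nonneg_right h (Nat.cast_nonneg n))))

lemma upperRate_monotone : Monotone (W.upperRate Λ x G τ δ) := fun _ _ h =>
  limsup_le_limsup (Eventually.of_forall fun n => iSup₂_le fun y hy =>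
    le_iSup₂ (f := fun y (_ : _ < _) => W.logProb Λ x G τ δ n y) y
      (hy.trans_le (mul_le_mul_of_nonneg_right h (Nat.cast_nonneg n))))

lemma lowerRate_mono (hτ : 0 ≤ τ) {δ' : ℝ} (h : δ ≤ δ') :
    W.lowerRate Λ x G τ δ ε ≤ W.lowerRate Λ x G τ δ' ε :=
  liminf_le_liminf (Eventually.of_forall fun n => iInf₂_mono fun y _ => logProb_mono hτ h n y)

lemma upperRate_mono (hτ : 0 ≤ τ) {δ' : ℝ} (h : δ ≤ δ') :
    W.upperRate Λ x G τ δ ε ≤ W.upperRate Λ x G τ δ' ε :=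
  limsup_le_limsup (Eventually.of_forall fun n => iSup₂_mono fun y _ => logProb_mono hτ h n y)

/-- For large `n` the integer part of `n x` is an admissible starting point, so the infimum and the
supremum run over a nonempty set. -/
lemma lowerRate_le_upperRate (hx : ∀ r, 0 ≤ x r) (hε : 0 < ε) :
    W.lowerRate Λ x G τ δ ε ≤ W.upperRate Λ x G τ δ ε := by
  refine le_trans (liminf_le_limsup) (limsup_le_limsup ?_)
  filter_upwards [(tendsto_natCast_atTop_atTop.const_mul_atTop hε).eventually_gt_atTop 1] with n hn
  set y : W.State := fun r => ⌊n * x r⌋₊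
  have hy : ‖W.toReal y - (n : ℝ) • x‖ < ε * n := by
    refine ((pi_norm_le_iff_of_nonneg zero_le_one).2 fun r => ?_).trans_lt hn
    have h0 : 0 ≤ n * x r := mul_nonneg (Nat.cast_nonneg _) (hx r)
    change |((⌊n * x r⌋₊ : ℕ) : ℝ) - n * x r| ≤ 1
    have h1 := Nat.floor_le h0
    have h2 := Nat.lt_floor_add_one (n * x r)
    exact abs_le.2 ⟨by linarith, by linarith⟩
  exact (iInf₂_le y hy).trans
    (le_iSup₂ (f := fun y (_ : _ < _) => W.logProb Λ x G τ δ n y) y hy)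

variable (W Λ G x τ) in
/-- The iterated limit of `lowerRate`. -/
def lowerLim : EReal := sInf ((fun δ => sSup (W.lowerRate Λ x G τ δ '' Set.Ioi 0)) '' Set.Ioi 0)

variable (W Λ G x τ) in
/-- The iterated limit of `upperRate`. -/
def upperLim : EReal := sInf ((fun δ => sInf (W.upperRate Λ x G τ δ '' Set.Ioi 0)) '' Set.Ioi 0)

/-- Monotone functions with values in `EReal` always have one-sided limits: shrinking `ε` increases
the infimum over starting points, shrinking `δ` decreases the event. -/
lemma hasInnerLimit_lowerRate (hτ : 0 < τ) :
    HasInnerLimit (W.lowerRate Λ x G τ) (W.lowerLim Λ x G τ) :=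
  ⟨_, fun _ _ => lowerRate_antitone.tendsto_nhdsGT 0,
    Monotone.tendsto_nhdsGT (fun _ _ h => sSup_le <| by
      rintro _ ⟨ε, hε, rfl⟩
      exact (lowerRate_mono hτ.le h).trans (le_sSup ⟨ε, hε, rfl⟩)) 0⟩

lemma hasInnerLimit_upperRate (hτ : 0 < τ) :
    HasInnerLimit (W.upperRate Λ x G τ) (W.upperLim Λ x G τ) :=
  ⟨_, fun _ _ => upperRate_monotone.tendsto_nhdsGT 0,
    Monotone.tendsto_nhdsGT (fun _ _ h => le_sInf <| by
      rintro _ ⟨ε, hε, rfl⟩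
      exact (sInf_le (Set.mem_image_of_mem _ hε)).trans (upperRate_mono hτ.le h)) 0⟩

lemma lowerLim_le_upperLim (hx : ∀ r, 0 ≤ x r) :
    W.lowerLim Λ x G τ ≤ W.upperLim Λ x G τ := by
  refine le_sInf ?_
  rintro _ ⟨δ, hδ, rfl⟩
  refine (sInf_le (Set.mem_image_of_mem
    (fun δ => sSup (W.lowerRate Λ x G τ δ '' Set.Ioi 0)) hδ)).trans (sSup_le ?_)
  rintro _ ⟨ε, hε, rfl⟩
  refine le_sInf ?_
  rintro _ ⟨ε', hε', rfl⟩
  exact (lowerRate_antitone (min_le_left ε ε')).trans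
    ((lowerRate_le_upperRate hx (lt_min hε hε')).trans (upperRate_monotone (min_le_right ε ε')))

lemma le_lowerLim {a : EReal} (h : ∀ δ > 0, ∃ ε > 0, a ≤ W.lowerRate Λ x G τ δ ε) :
    a ≤ W.lowerLim Λ x G τ := by
  refine le_sInf ?_
  rintro _ ⟨δ, hδ, rfl⟩
  obtain ⟨ε, hε, ha⟩ := h δ hδ
  exact ha.trans (le_sSup ⟨ε, hε, rfl⟩)

lemma upperLim_le {a : EReal} (h : ∃ δ > 0, ∃ ε > 0, W.upperRate Λ x G τ δ ε ≤ a) :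
    W.upperLim Λ x G τ ≤ a := by
  obtain ⟨δ, hδ, ε, hε, ha⟩ := h
  exact (sInf_le (Set.mem_image_of_mem (fun δ => sInf (W.upperRate Λ x G τ δ '' Set.Ioi 0))
    hδ)).trans ((sInf_le (Set.mem_image_of_mem _ hε)).trans ha)

/-! ### Networks without active routes, and compact subsets of a face -/

lemma event_eq_univ [IsEmpty W.Route] (hδ : 0 < δ) {n : ℕ} (hn : 0 < n) :
    event Λ x G τ δ n = Set.univ := by
  refine Set.eq_univ_of_forall fun ω => ⟨⟨⟨fun r => isEmptyElim r.1, fun r => isEmptyElim r.1⟩,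
    ?_⟩, ?_⟩
  · have : IsEmpty ↥(Λ ∪ jammed Λ) := ⟨fun r => isEmptyElim r.1⟩
    simpa [genDist] using hδ
  · have h0 : ∀ f : W.Route → ℝ, ‖f‖ₑ = 0 := fun f => by
      rw [Subsingleton.elim f 0, enorm_zero]
    have : (0 : ℝ) < n := Nat.cast_pos.2 hn
    simp only [h0, ENNReal.iSup_zero, ENNReal.ofReal_pos]
    positivity

lemma entropy_of_isEmpty [IsEmpty W.Route] : W.entropy Λ G x = 0 := by
  have : IsEmpty ↥(Λ ∪ jammed Λ) := ⟨fun r => isEmptyElim r.1⟩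
  simp [entropy]

lemma lowerRate_nonneg_of_isEmpty [IsEmpty W.Route] (hτ : 0 < τ) (hδ : 0 < δ) :
    0 ≤ W.lowerRate Λ x G τ δ ε := by
  refine le_liminf_of_le (by isBoundedDefault) ?_
  filter_upwards [eventually_gt_atTop 0] with n hn
  have : (0 : ℝ) < n := Nat.cast_pos.2 hn
  exact le_iInf₂ fun y _ => le_logProb (a := 0) (by positivity) (by
    rw [event_eq_univ hδ hn]; simp)

lemma upperRate_nonpos (hτ : 0 < τ) : W.upperRate Λ x G τ δ ε ≤ 0 := by
  refine limsup_le_of_le (by isBoundedDefault) ?_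
  filter_upwards [eventually_gt_atTop 0] with n hn
  have : (0 : ℝ) < n := Nat.cast_pos.2 hn
  exact iSup₂_le fun y _ => logProb_le (a := 0) (by positivity) (by simpa using prob_le_one)

lemma mem_facePoints_face (hx : ∀ r, 0 ≤ x r) : x ∈ facePoints (face x) :=
  ⟨fun _ hr => hr, fun r hr => le_antisymm (not_lt.1 hr) (hx r)⟩

/-- Each of the finitely many coordinates in `Λ` attains a positive minimum on `K`. -/
lemma exists_le_of_isCompact {K : Set (W.Route → ℝ)} (hK : IsCompact K) (hKΛ : K ⊆ facePoints Λ) :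
    ∃ m > 0, ∀ x ∈ K, ∀ r ∈ Λ, m ≤ x r := by
  have h : ∀ r : W.Route, ∃ m > 0, ∀ x ∈ K, r ∈ Λ → m ≤ x r := by
    intro r
    rcases K.eq_empty_or_nonempty with rfl | hne
    · exact ⟨1, one_pos, fun x hx => hx.elim⟩
    · obtain ⟨z, hz, hmin⟩ := hK.exists_isMinOn hne (continuous_apply r).continuousOn
      by_cases hr : r ∈ Λ
      · exact ⟨z r, (hKΛ hz).1 r hr, fun x hx _ => hmin hx⟩
      · exact ⟨1, one_pos, fun x _ hr' => absurd hr' hr⟩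
  choose m hm hmx using h
  rcases isEmpty_or_nonempty W.Route with hE | hE
  · exact ⟨1, one_pos, fun x _ r => isEmptyElim r⟩
  · exact ⟨Finset.univ.inf' Finset.univ_nonempty m, (Finset.lt_inf'_iff _).2 fun r _ => hm r,
      fun x hx r hr => (Finset.inf'_le _ (Finset.mem_univ r)).trans (hmx r x hx hr)⟩

end

/-- The local large deviation principle, uniformly on compact subsets of the face. -/
theorem eventually_lim_mem_Icc (hW : W.Ergodic) {Λ : Set W.Route} {G : GenPair Λ}
    (hG : G ∈ closure (calG Λ)) {K : Set (W.Route → ℝ)} (hKΛ : K ⊆ facePoints Λ)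
    (hK : IsCompact K) {η : ℝ} (hη : 0 < η) :
    ∀ᶠ τ in 𝓝[>] (0 : ℝ), ∀ x ∈ K,
      W.lowerLim Λ x G τ ∈ Set.Icc ((-W.entropy Λ G x - η : ℝ) : EReal)
        ((-W.entropy Λ G x + η : ℝ) : EReal) ∧
      W.upperLim Λ x G τ ∈ Set.Icc ((-W.entropy Λ G x - η : ℝ) : EReal)
        ((-W.entropy Λ G x + η : ℝ) : EReal) := by
  have key : ∀ᶠ τ in 𝓝[>] (0 : ℝ), ∀ x ∈ K,
      ((-W.entropy Λ G x - η : ℝ) : EReal) ≤ W.lowerLim Λ x G τ ∧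
      W.upperLim Λ x G τ ≤ ((-W.entropy Λ G x + η : ℝ) : EReal) := by
    rcases isEmpty_or_nonempty W.Route with hE | hE
    · filter_upwards [self_mem_nhdsWithin] with τ hτ x _
      rw [entropy_of_isEmpty]
      refine ⟨le_lowerLim fun δ hδ => ⟨1, one_pos, le_trans ?_
        (lowerRate_nonneg_of_isEmpty hτ hδ)⟩, upperLim_le ⟨1, one_pos, 1, one_pos,
        (upperRate_nonpos hτ).trans ?_⟩⟩
      · exact EReal.coe_nonpos.2 (by linarith)
      · exact EReal.coe_nonneg.2 (by linarith)
    · obtain ⟨m, hm, hmx⟩ := exists_le_of_isCompact hK hKΛ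
      obtain ⟨τ₁, hτ₁, h1⟩ := W.le_lowerRate hW hG hm hη
      obtain ⟨τ₂, hτ₂, h2⟩ := W.upperRate_le hG hm hη
      filter_upwards [Ioo_mem_nhdsGT (lt_min hτ₁ hτ₂)] with τ hτ x hx
      have h3 := lt_min_iff.1 hτ.2
      exact ⟨le_lowerLim (h1 τ hτ.1 h3.1 x (hKΛ hx) (hmx x hx)),
        upperLim_le (h2 τ hτ.1 h3.2 x (hKΛ hx) (hmx x hx))⟩
  filter_upwards [key] with τ hτ x hx
  -- This comparison turns the two one-sided bounds into bounds on both sides of both limits.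
  have hle : W.lowerLim Λ x G τ ≤ W.upperLim Λ x G τ := lowerLim_le_upperLim fun r => by
    by_cases hr : r ∈ Λ
    · exact ((hKΛ hx).1 r hr).le
    · exact ((hKΛ hx).2 r hr).ge
  obtain ⟨h1, h2⟩ := hτ x hx
  exact ⟨⟨h1, hle.trans h2⟩, h1.trans hle, h2⟩

lemma tendsto_coe_of_forall_mem_Icc {ι : Type*} {l : Filter ι} {f : ι → EReal} {a : ℝ}
    (h : ∀ η : ℝ, 0 < η → ∀ᶠ i in l, f i ∈ Set.Icc ((a - η : ℝ) : EReal) ((a + η : ℝ) : EReal)) :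
    Tendsto f l (𝓝 (a : EReal)) := by
  refine tendsto_order.2 ⟨fun b hb => ?_, fun b hb => ?_⟩
  · obtain ⟨z, hbz, hza⟩ := EReal.lt_iff_exists_real_btwn.1 hb
    filter_upwards [h (a - z) (sub_pos.2 (EReal.coe_lt_coe_iff.1 hza))] with i hi
    rw [sub_sub_cancel] at hi
    exact hbz.trans_le hi.1
  · obtain ⟨z, haz, hzb⟩ := EReal.lt_iff_exists_real_btwn.1 hb
    filter_upwards [h (z - a) (sub_pos.2 (EReal.coe_lt_coe_iff.1 haz))] with i hi
    rw [add_sub_cancel] at hi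
    exact hi.2.trans_lt hzb

end

end StarNetwork

/-! ### The theorem -/

theorem theorem4p1 {S : Type*} [Fintype S] (W : StarNetwork S) (hW : W.Ergodic) :
    (∀ x : W.Route → ℝ, (∀ r, 0 ≤ x r) →
      ∀ G ∈ closure (StarNetwork.calG (StarNetwork.face x)),
        ∃ hl hu : ℝ → EReal,
          (∀ τ > 0, StarNetwork.HasInnerLimit (W.lowerRate (StarNetwork.face x) x G τ) (hl τ)) ∧
          (∀ τ > 0, StarNetwork.HasInnerLimit (W.upperRate (StarNetwork.face x) x G τ) (hu τ)) ∧
          Tendsto hl (𝓝[>] 0) (𝓝 ((-W.entropy (StarNetwork.face x) G x : ℝ) : EReal)) ∧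
          Tendsto hu (𝓝[>] 0) (𝓝 ((-W.entropy (StarNetwork.face x) G x : ℝ) : EReal))) ∧
    (∀ Λ : Set W.Route, ∀ G ∈ closure (StarNetwork.calG Λ),
      ∀ K ⊆ StarNetwork.facePoints Λ, IsCompact K →
        ∃ hl hu : (W.Route → ℝ) → ℝ → EReal,
          (∀ x ∈ K, ∀ τ > 0, StarNetwork.HasInnerLimit (W.lowerRate Λ x G τ) (hl x τ)) ∧
          (∀ x ∈ K, ∀ τ > 0, StarNetwork.HasInnerLimit (W.upperRate Λ x G τ) (hu x τ)) ∧
          ∀ η : ℝ, 0 < η → ∀ᶠ τ in 𝓝[>] (0 : ℝ), ∀ x ∈ K,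
            hl x τ ∈ Set.Icc ((-W.entropy Λ G x - η : ℝ) : EReal)
              ((-W.entropy Λ G x + η : ℝ) : EReal) ∧
            hu x τ ∈ Set.Icc ((-W.entropy Λ G x - η : ℝ) : EReal)
              ((-W.entropy Λ G x + η : ℝ) : EReal)) := by
  refine ⟨fun x hx G hG => ?_, fun Λ G hG K hKΛ hK => ?_⟩
  -- The pointwise limits come from the uniform estimate on the compact set `{x}`.
  · have hK : ({x} : Set (W.Route → ℝ)) ⊆ StarNetwork.facePoints (StarNetwork.face x) :=
      Set.singleton_subset_iff.2 (StarNetwork.mem_facePoints_face hx)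
    refine ⟨W.lowerLim (StarNetwork.face x) x G, W.upperLim (StarNetwork.face x) x G,
      fun τ hτ => StarNetwork.hasInnerLimit_lowerRate hτ,
      fun τ hτ => StarNetwork.hasInnerLimit_upperRate hτ,
      StarNetwork.tendsto_coe_of_forall_mem_Icc fun η hη => ?_,
      StarNetwork.tendsto_coe_of_forall_mem_Icc fun η hη => ?_⟩
    all_goals
      filter_upwards [W.eventually_lim_mem_Icc hW hG hK isCompact_singleton hη] with τ hτ
    · exact (hτ x rfl).1
    · exact (hτ x rfl).2
  · exact ⟨fun x τ => W.lowerLim Λ x G τ, fun x τ => W.upperLim Λ x G τ,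
      fun x _ τ hτ => StarNetwork.hasInnerLimit_lowerRate hτ,
      fun x _ τ hτ => StarNetwork.hasInnerLimit_upperRate hτ,
      fun η hη => W.eventually_lim_mem_Icc hW hG hKΛ hK hη⟩
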